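/- Fix $0\le t<1$ and positive reals $(a_i)_{i\ge1}$, $(b_j)_{j\ge1}$ with $a_ib_j<1$ for all $i,j$. **Signatures.** A signature of length $N$ is an integer sequence $\kappa_1\ge\dots\ge\kappa_N$, viewed as $N$ particles on $\mathbb Z$; $|\kappa|=\sum_c\kappa_c$. A signature with nonnegative entries is identified with the Young diagram with these row lengths. **The randomized Hall–Littlewood RSK algorithm.** Let $\lambda,\mu,\nu,\rho$ be signatures of length $N$, $m=|\nu|-|\lambda|$, $n=|\mu|-|\lambda|$. An admissible function assigns to each vertex $(i,j)$ of $[0,m]\times[0,n]$ a signature $\Lambda(i,j)$ with $\Lambda(0,0)=\lambda$, $\Lambda(m,0)=\nu$, $\Lambda(0,n)=\mu$, $\Lambda(m,n)=\rho$, such that $\Lambda(i+1,j)$ (resp. $\Lambda(i,j+1)$) is obtained from $\Lambda(i,j)$ by moving one particle from a position $h_{i,j}$ (resp. $v_{i,j}$) by $+1$, $h_{i,j}<h_{i+1,j}$, $v_{i,j}<v_{i,j+1}$, and $h_{i,j}=v_{i,j}=q$ implies $h_{i,j+1}=v_{i+1,j}\in\{q,q+1\}$. In the last case the box with south-western corner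 $(i,j)$ is a zero-box (value $q$) or a one-box (value $q+1$); the common value is its upper label. Other boxes, and boxes outside the rectangle, are trivial; labels outside the rectangle are $-\infty$. A trivial box has weight $1$. For a zero- or one-box with lower label $q=h_{i,j}=v_{i,j}$ let $c=t^{\#\{\text{coordinates of }\Lambda(i,j)\text{ equal to }q\}}$. A one-box has weight: $1$ if its western or southern neighbour is a one-box, or its south-western neighbour is a one-box with upper label $q-1$; $0$ if its south-western neighbour is a zero-box with upper label $q-1$; otherwise $1-t$ if exactly one of $h_{i-1,j},v_{i,j-1}$ equals $q-1$, and $\frac{1-t}{1-c}$ if both are $<q-1$. A zero-box has weight: $1$ (resp. $0$) if its south-western neighbour is a zero-box (resp. one-box) with upper label $q-1$; otherwise $t$ if exactly one of $h_{i-1,j},v_{i,j-1}$ equals $q-1$, and $\frac{t-c}{1-c}$ if both are $<q-1$. There is at most one admissible function; $U(\mu\to\rho\mid\lambda\to\nu)$ is the product of its box weights, or $0$ if it does not exist. For $\lambda,\nu$ of length $N-1$, $\mu,\rho$ of length $N$ and $r\ge0$, let $U^r(\mu\to\rho\mid\lambda\to\nu):=U(\mu\to\rho\mid\lambda\cup\{-V-r\}\to\nu\cup\{-V\})$,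 where $-V$ is an integer smaller than all coordinates of $\mu,\nu$ (the choice is immaterial). **The Hall–Littlewood RSK field** is a random array $\Lambda(i,j)$, $i,j\ge0$, of signatures of length $j$, with $\Lambda(i,0)=\varnothing$, $\Lambda(0,j)=(0,\dots,0)$, driven by independent inputs $r_{i,j}$, $i,j\ge1$, $$P(r_{i,j}=d)=(1-t\mathbf 1_{d\ge1})(a_ib_j)^d\,\frac{1-a_ib_j}{1-ta_ib_j},\qquad d\ge0:$$ given $\Lambda(i-1,j-1),\Lambda(i-1,j),\Lambda(i,j-1)$ and $r_{i,j}$, one takes $\Lambda(i,j)=\rho$ with probability $U^{r_{i,j}}(\Lambda(i-1,j)\to\rho\mid\Lambda(i-1,j-1)\to\Lambda(i,j-1))$, independently for distinct $(i,j)$. **Hall–Littlewood processes.** For Young diagrams $\mu\subset\lambda$ such that $\lambda/\mu$ has at most one box in every column (a horizontal strip, $\mu\prec\lambda$) let $\phi_{\lambda/\mu}$ be the product of $1-t^{m_i(\lambda)}$ over $i\ge1$ such that $\lambda/\mu$ has a box in column $i$ but none in column $i+1$, and $\psi_{\lambda/\mu}$ the product of $1-t^{m_i(\mu)}$ over $i\ge1$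 such that $\lambda/\mu$ has no box in column $i$ but one in column $i+1$, where $m_i$ is the number of rows of length $i$. Let $$P_{\lambda/\mu}(x_1,\dots,x_s)=\sum_{\mu=\kappa^0\prec\dots\prec\kappa^s=\lambda}\ \prod_{i=1}^s\psi_{\kappa^i/\kappa^{i-1}}x_i^{|\kappa^i|-|\kappa^{i-1}|},$$ and $Q_{\lambda/\mu}$ the same with $\phi$; $P_\lambda=P_{\lambda/\varnothing}$, $Q_\lambda=Q_{\lambda/\varnothing}$. For finite families $X_1,\dots,X_k,Y_1,\dots,Y_k$ put $Z=\prod_{1\le i\le j\le k}\prod_{x\in X_i,y\in Y_j}\frac{1-txy}{1-xy}$. The Hall–Littlewood process with specializations $\rho_i^+=\rho(X_i)$, $\rho_i^-=\rho(Y_i)$ gives $(\lambda^1,\dots,\lambda^k)$ the probability $$\mathbb{HL}(\lambda^1,\dots,\lambda^k)=\frac1Z\,P_{\lambda^1}(X_1)\prod_{i=1}^{k-1}\Big(\sum_{\kappa}Q_{\lambda^i/\kappa}(Y_i)P_{\lambda^{i+1}/\kappa}(X_{i+1})\Big)Q_{\lambda^k}(Y_k);$$ with its intermediate diagrams it gives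 $(\lambda^1,\mu^1,\lambda^2,\dots,\mu^{k-1},\lambda^k)$ the probability $\frac1ZP_{\lambda^1}(X_1)\prod_{i<k}Q_{\lambda^i/\mu^i}(Y_i)P_{\lambda^{i+1}/\mu^i}(X_{i+1})\,Q_{\lambda^k}(Y_k)$. **The stochastic six vertex model in the quadrant** with vertices $(i,j)$, $i,j\ge1$: a random set of edges of the quadrant; all edges entering the quadrant from the left are present, none of those entering from below. Given the edges entering a vertex $(i,j)$ from the left and from below, the edges leaving it are chosen independently of the rest as follows, with $u=a_ib_j$: both entering edges present (absent) — both leaving edges present (absent); only the left one — right with probability $\frac{1-u}{1-tu}$, up with probability $\frac{(1-t)u}{1-tu}$; only the lower one — up with probability $\frac{t(1-u)}{1-tu}$, right with probability $\frac{1-t}{1-tu}$. The height $h(i,j)$ is the number of present edges leaving the vertices $(i,1),\dots,(i,j)$ to the right (for $i=0$: the number $j$ of edges entering from the left in the rows $1,\dots,j$). **Proposition.** The Hall–Littlewood RSK field exists. Let $k\ge1$ and let $m_1\ge\dots\ge m_k$, $n_1\le\dots\le n_k$ be positive integers, $m_{k+1}=0$, $n_0=0$; let $X_i=(b_{n_{i-1}+1},\dots,b_{n_i})$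 and $Y_i=(a_{m_{i+1}+1},\dots,a_{m_i})$. 1. For the Hall–Littlewood RSK field, the collection $$\Lambda(m_1,n_1),\ \Lambda(m_2,n_1),\ \Lambda(m_2,n_2),\ \dots,\ \Lambda(m_k,n_{k-1}),\ \Lambda(m_k,n_k)$$ is distributed as the Hall–Littlewood process with specializations $\rho^+_i=\rho(X_i)$, $\rho_i^-=\rho(Y_i)$ together with its intermediate diagrams $\mu^i=\Lambda(m_{i+1},n_i)$; in particular $(\Lambda(m_i,n_i))_{1\le i\le k}$ is distributed as $\mathbb{HL}$. 2. Let $d_0(i,j)$ be the number of zero coordinates of $\Lambda(i,j)$. Declare the edge leaving $(i,j)$ to the right present iff $d_0(i,j-1)\ne d_0(i,j)$, and the edge leaving $(i,j)$ upwards present iff $d_0(i-1,j)\ne d_0(i,j)$ (this includes $i=0$, resp. $j=0$, for the entering edges). This is a stochastic six vertex model, and almost surely $d_0$ is its height function. 3. For the height function $h$ of the stochastic six vertex model, $(h(m_i,n_i))_{1\le i\le k}$ has the same law as $(n_i-\ell(\lambda^i))_{1\le i\le k}$, where $(\lambda^1,\dots,\lambda^k)$ is distributed as $\mathbb{HL}$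 and $\ell(\lambda)$ is the length of the first column of $\lambda$. -/

import Mathlib

open MeasureTheory

noncomputable section

/-! ### Signatures and the randomized Hall-Littlewood RSK algorithm -/

/-- Signatures of length `N`: weakly decreasing sequences of `N` integers. -/
abbrev Signature (N : ℕ) : Type := {κ : Fin N → ℤ // Antitone κ}

/-- The signature `(0, …, 0)` of length `N`. -/
def Signature.zero (N : ℕ) : Signature N := ⟨fun _ => 0, fun _ _ _ => le_rfl⟩

/-- `κ'` arises from `κ` by moving one particle from position `p` to position `p + 1`. -/
def MovesBy {N : ℕ} (κ κ' : Fin N → ℤ) (p : ℤ) : Prop :=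
  ∃ c : Fin N, κ c = p ∧ κ' = Function.update κ c (p + 1)

/-- `L` is an admissible function on all vertices `(i, j)`, `i ≤ m`, `j ≤ n`, of the rectangle
`[0, m] × [0, n]`, with corner values `lam, nu, mu, rho`; `h i j` is the label of the horizontal
edge from `(i, j)` to `(i + 1, j)`, and `v i j` that of the vertical edge from `(i, j)` to
`(i, j + 1)`. Values outside the rectangle are irrelevant. -/
structure IsAdmissible {N : ℕ} (m n : ℕ) (lam mu nu rho : Fin N → ℤ)
    (L : ℕ → ℕ → Fin N → ℤ) (h v : ℕ → ℕ → ℤ) : Prop where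
  antitone : ∀ i ≤ m, ∀ j ≤ n, Antitone (L i j)
  sw : L 0 0 = lam
  se : L m 0 = nu
  nw : L 0 n = mu
  ne : L m n = rho
  moves_h : ∀ i < m, ∀ j ≤ n, MovesBy (L i j) (L (i + 1) j) (h i j)
  moves_v : ∀ i ≤ m, ∀ j < n, MovesBy (L i j) (L i (j + 1)) (v i j)
  lt_h : ∀ i, i + 1 < m → ∀ j ≤ n, h i j < h (i + 1) j
  lt_v : ∀ i ≤ m, ∀ j, j + 1 < n → v i j < v i (j + 1)
  box : ∀ i < m, ∀ j < n, h i j = v i j →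
    h i (j + 1) = v (i + 1) j ∧ (h i (j + 1) = h i j ∨ h i (j + 1) = h i j + 1)

/-- The box with south-western corner `(i, j)` is a zero-box. -/
def IsZeroBox (h v : ℕ → ℕ → ℤ) (i j : ℕ) : Prop :=
  h i j = v i j ∧ h i (j + 1) = h i j ∧ v (i + 1) j = h i j

/-- The box with south-western corner `(i, j)` is a one-box. -/
def IsOneBox (h v : ℕ → ℕ → ℤ) (i j : ℕ) : Prop :=
  h i j = v i j ∧ h i (j + 1) = h i j + 1 ∧ v (i + 1) j = h i j + 1

/-- The number of coordinates of `κ` equal to `p`. -/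
def multAt {N : ℕ} (κ : Fin N → ℤ) (p : ℤ) : ℕ := (Finset.univ.filter fun c => κ c = p).card

open Classical in
/-- The weight of the box with south-western corner `(i, j)`. The conditions `0 < i`, `0 < j`
implement the conventions that boxes outside of the rectangle are trivial and that labels outside
of it are `-∞`. Since labels increase strictly, in the last branch for a one-box and for a
zero-box both neighbouring labels are smaller than `h i j - 1`. -/
def boxWeight {N : ℕ} (t : ℝ) (L : ℕ → ℕ → Fin N → ℤ) (h v : ℕ → ℕ → ℤ) (i j : ℕ) : ℝ :=
  let q : ℤ := h i j
  let c : ℝ := t ^ multAt (L i j) q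
  -- the label of the horizontal edge to the west, resp. the vertical edge to the south, is `q - 1`
  let west : Prop := 0 < i ∧ h (i - 1) j = q - 1
  let south : Prop := 0 < j ∧ v i (j - 1) = q - 1
  -- the box to the south-west is a zero-box (one-box) whose upper label is `q - 1`
  let swZero : Prop :=
    0 < i ∧ 0 < j ∧ IsZeroBox h v (i - 1) (j - 1) ∧ h (i - 1) j = q - 1
  let swOne : Prop :=
    0 < i ∧ 0 < j ∧ IsOneBox h v (i - 1) (j - 1) ∧ h (i - 1) j = q - 1
  if IsOneBox h v i j then
    if (0 < i ∧ IsOneBox h v (i - 1) j) ∨ (0 < j ∧ IsOneBox h v i (j - 1)) then 1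
    else if swOne then 1
    else if swZero then 0
    else if Xor west south then 1 - t
    else (1 - t) / (1 - c)
  else if IsZeroBox h v i j then
    if swZero then 1
    else if swOne then 0
    else if Xor west south then t
    else (t - c) / (1 - c)
  else 1

open Classical in
/-- The coefficient `U(mu → rho ∣ lam → nu)` for signatures of the same length: the product of the
box weights of the admissible function (there is at most one), and `0` if there is none. -/
def rskU {N : ℕ} (t : ℝ) (lam mu nu rho : Fin N → ℤ) : ℝ :=
  let m : ℕ := (∑ c, nu c - ∑ c, lam c).toNat
  let n : ℕ := (∑ c, mu c - ∑ c, lam c).toNat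
  if H : ∃ A : (ℕ → ℕ → Fin N → ℤ) × (ℕ → ℕ → ℤ) × (ℕ → ℕ → ℤ),
      IsAdmissible m n lam mu nu rho A.1 A.2.1 A.2.2 then
    ∏ i ∈ Finset.range m, ∏ j ∈ Finset.range n,
      boxWeight t H.choose.1 H.choose.2.1 H.choose.2.2 i j
  else 0

/-- The coefficient `U^r(mu → rho ∣ lam → nu)` of the algorithm with input `r`, for `lam, nu` of
length `N` and `mu, rho` of length `N + 1`: a last coordinate `-V - r`, resp. `-V`, is appended to
`lam`, resp. `nu`, where `-V` is smaller than all coordinates of `mu` and `nu`. Here `-V` is the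
last coordinate of `mu` minus one; if `lam` interlaces with both `mu` and `nu`, that is smaller
than all coordinates of both, and otherwise there is no admissible function. -/
def rskUInput {N : ℕ} (t : ℝ) (r : ℕ) (lam : Signature N) (mu : Signature (N + 1))
    (nu : Signature N) (rho : Signature (N + 1)) : ℝ :=
  let z : ℤ := mu.1 (Fin.last N) - 1
  rskU t (Fin.snoc lam.1 (z - r)) mu.1 (Fin.snoc nu.1 z) rho.1

/-- The probability that an input variable with parameter `u = a_i b_j` takes the value `d`. -/
def inputProb (t u : ℝ) (d : ℕ) : ℝ :=
  (if d = 0 then 1 else 1 - t) * u ^ d * ((1 - u) / (1 - t * u))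

/-- The random state `L`, with inputs `r i j` (`i, j ≥ 1`), is a Hall-Littlewood RSK field: the
boundary values are zero, the inputs are independent with laws `inputProb t (a i * b j)`, and each
`L i j`, `i, j ≥ 1`, is the output of the algorithm with input `L (i-1) (j-1)`, `L (i-1) j`,
`L i (j-1)`, `r i j`, all the steps being independent. That is, the joint law on every finite
rectangle is the product of the probabilities of the inputs and of the steps. -/
structure IsHLRSKField {Ω : Type*} [MeasurableSpace Ω] (P : Measure Ω) (t : ℝ) (a b : ℕ → ℝ)
    (r : ℕ → ℕ → Ω → ℕ) (L : (i j : ℕ) → Ω → Signature j) : Prop where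
  measurable_r : ∀ i j, Measurable (r i j)
  measurable_L : ∀ i j, Measurable (L i j)
  left : ∀ j ω, L 0 j ω = Signature.zero j
  law : ∀ (M N : ℕ) (d : ℕ → ℕ → ℕ) (lam : (i j : ℕ) → Signature j),
    (∀ j, lam 0 j = Signature.zero j) →
    P.real {ω | ∀ i < M, ∀ j < N,
        r (i + 1) (j + 1) ω = d (i + 1) (j + 1) ∧ L (i + 1) (j + 1) ω = lam (i + 1) (j + 1)} =
      ∏ i ∈ Finset.range M, ∏ j ∈ Finset.range N,
        inputProb t (a (i + 1) * b (j + 1)) (d (i + 1) (j + 1)) *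
          rskUInput t (d (i + 1) (j + 1)) (lam i j) (lam i (j + 1)) (lam (i + 1) j)
            (lam (i + 1) (j + 1))

/-! ### Hall-Littlewood functions and Hall-Littlewood processes -/

/-- `lam / mu` is a horizontal strip. -/
def IsHorizontalStrip (lam mu : YoungDiagram) : Prop :=
  mu ≤ lam ∧ ∀ c, lam.colLen c ≤ mu.colLen c + 1

open Classical in
/-- The coefficient `φ_{lam / mu}(t)`: the product of `1 - t ^ m_i(lam)` over all `i ≥ 1` such
that `lam / mu` has a box in column `i` and none in column `i + 1`. Here `m_i(lam)` is the number
of rows of length `i`, and Mathlib's column `c` is column `i = c + 1`. -/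
def hlPhi (t : ℝ) (lam mu : YoungDiagram) : ℝ :=
  if IsHorizontalStrip lam mu then
    ∏ c ∈ Finset.range (lam.rowLen 0),
      if lam.colLen c ≠ mu.colLen c ∧ lam.colLen (c + 1) = mu.colLen (c + 1) then
        1 - t ^ (lam.colLen c - lam.colLen (c + 1))
      else 1
  else 0

open Classical in
/-- The coefficient `ψ_{lam / mu}(t)`: the product of `1 - t ^ m_i(mu)` over all `i ≥ 1` such
that `lam / mu` has no box in column `i` and a box in column `i + 1`. -/
def hlPsi (t : ℝ) (lam mu : YoungDiagram) : ℝ :=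
  if IsHorizontalStrip lam mu then
    ∏ c ∈ Finset.range (lam.rowLen 0),
      if lam.colLen c = mu.colLen c ∧ lam.colLen (c + 1) ≠ mu.colLen (c + 1) then
        1 - t ^ (mu.colLen c - mu.colLen (c + 1))
      else 1
  else 0

open Classical in
/-- The skew Hall-Littlewood function `P_{lam / mu}(x₁, …, xₙ; t)`: the sum of
`∏ ψ_{κᵢ / κᵢ₋₁} xᵢ ^ (|κᵢ| - |κᵢ₋₁|)` over all chains of horizontal strips
`mu = κ₀ ≺ κ₁ ≺ … ≺ κₙ = lam` (a finite sum). -/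
def hlP (t : ℝ) : List ℝ → YoungDiagram → YoungDiagram → ℝ
  | [], lam, mu => if lam = mu then 1 else 0
  | x :: xs, lam, mu =>
      ∑ᶠ κ : YoungDiagram, hlPsi t κ mu * x ^ (κ.card - mu.card) * hlP t xs lam κ

open Classical in
/-- The skew Hall-Littlewood function `Q_{lam / mu}(x₁, …, xₙ; t)`; the same with `φ`. -/
def hlQ (t : ℝ) : List ℝ → YoungDiagram → YoungDiagram → ℝ
  | [], lam, mu => if lam = mu then 1 else 0
  | x :: xs, lam, mu =>
      ∑ᶠ κ : YoungDiagram, hlPhi t κ mu * x ^ (κ.card - mu.card) * hlQ t xs lam κ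

/-- The Cauchy kernel `∏ (1 - t x y) / (1 - x y)`. -/
def hlKernel (t : ℝ) (xs ys : List ℝ) : ℝ :=
  (xs.map fun x => (ys.map fun y => (1 - t * (x * y)) / (1 - x * y)).prod).prod

/-- The normalization of a Hall-Littlewood process with specializations `X 0, …, X k` (plus)
and `Y 0, …, Y k` (minus). -/
def hlNorm {k : ℕ} (t : ℝ) (X Y : Fin (k + 1) → List ℝ) : ℝ :=
  ∏ i, ∏ j ∈ Finset.Ici i, hlKernel t (X i) (Y j)

/-- `Ψ_{lam, mu}(X, Y) = ∑_κ P_{lam / κ}(X) Q_{mu / κ}(Y)` (a finite sum). -/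
def hlPsiKernel (t : ℝ) (X Y : List ℝ) (lam mu : YoungDiagram) : ℝ :=
  ∑ᶠ κ : YoungDiagram, hlP t X lam κ * hlQ t Y mu κ

/-- The Hall-Littlewood process on sequences of `k + 1` Young diagrams, determined by the finite
alpha specializations `X i` (plus) and `Y i` (minus). -/
def hlProcess {k : ℕ} (t : ℝ) (X Y : Fin (k + 1) → List ℝ) (lam : Fin (k + 1) → YoungDiagram) :
    ℝ :=
  hlP t (X 0) (lam 0) ⊥ *
    (∏ i : Fin k, hlPsiKernel t (X i.succ) (Y i.castSucc) (lam i.succ) (lam i.castSucc)) *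
    hlQ t (Y (Fin.last k)) (lam (Fin.last k)) ⊥ / hlNorm t X Y

/-- The Hall-Littlewood process together with its intermediate diagrams
`lam 0 ⊇ mu 0 ⊆ lam 1 ⊇ mu 1 ⊆ … ⊆ lam k`. -/
def hlProcessFull {k : ℕ} (t : ℝ) (X Y : Fin (k + 1) → List ℝ)
    (lam : Fin (k + 1) → YoungDiagram) (mu : Fin k → YoungDiagram) : ℝ :=
  hlP t (X 0) (lam 0) ⊥ *
    (∏ i : Fin k, hlQ t (Y i.castSucc) (lam i.castSucc) (mu i) *
      hlP t (X i.succ) (lam i.succ) (mu i)) *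
    hlQ t (Y (Fin.last k)) (lam (Fin.last k)) ⊥ / hlNorm t X Y

/-- The signature `s` is the Young diagram `lam`, with zeros added to its row lengths. -/
def Represents {N : ℕ} (s : Signature N) (lam : YoungDiagram) : Prop :=
  (∀ c : Fin N, s.1 c = lam.rowLen c) ∧ lam.colLen 0 ≤ N

/-- The specialization `ρ(c_{lo+1}, …, c_{hi})`. -/
def paramBlock (c : ℕ → ℝ) (lo hi : ℕ) : List ℝ := (List.range' (lo + 1) (hi - lo)).map c

/-- The plus specializations `ρ(b_{n_{i-1}+1}, …, b_{n_i})`, where the entry before the first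
one is `0`. -/
def plusBlock {k : ℕ} (b : ℕ → ℝ) (n : Fin (k + 1) → ℕ) (i : Fin (k + 1)) : List ℝ :=
  paramBlock b ((Fin.cons 0 n : Fin (k + 2) → ℕ) i.castSucc) (n i)

/-- The minus specializations `ρ(a_{m_{i+1}+1}, …, a_{m_i})`, where the entry after the last one
is `0`. -/
def minusBlock {k : ℕ} (a : ℕ → ℝ) (m : Fin (k + 1) → ℕ) (i : Fin (k + 1)) : List ℝ :=
  paramBlock a ((Fin.snoc m 0 : Fin (k + 2) → ℕ) i.succ) (m i)

/-! ### The stochastic six vertex model in the quadrant -/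

/-- The weight of a vertex, given the presence of the edges entering from the left and from below
and of those leaving to the right and upwards. -/
def sixVertexWeight (t u : ℝ) : (left below right up : Bool) → ℝ
  | true, true, true, true => 1
  | false, false, false, false => 1
  | true, false, true, false => (1 - u) / (1 - t * u)
  | true, false, false, true => (1 - t) * u / (1 - t * u)
  | false, true, false, true => t * (1 - u) / (1 - t * u)
  | false, true, true, false => (1 - t) / (1 - t * u)
  | _, _, _, _ => 0

/-- The random edge configuration is a stochastic six vertex model in the quadrant, whose vertices
are `(i, j)`, `i, j ≥ 1`. `H i j` (`V i j`) tells whether the edge leaving the vertex `(i, j)` to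
the right (upwards) is present; `H 0 j` and `V i 0` are the edges that enter the quadrant. All
edges entering from the left are present, and none of those entering from below. -/
structure IsSixVertex {Ω : Type*} [MeasurableSpace Ω] (P : Measure Ω) (t : ℝ) (a b : ℕ → ℝ)
    (H V : ℕ → ℕ → Ω → Bool) : Prop where
  measurable_H : ∀ i j, Measurable (H i j)
  measurable_V : ∀ i j, Measurable (V i j)
  left : ∀ j ω, H 0 (j + 1) ω = true
  below : ∀ i ω, V (i + 1) 0 ω = false
  law : ∀ (M N : ℕ) (eH eV : ℕ → ℕ → Bool),
    (∀ j, eH 0 (j + 1) = true) → (∀ i, eV (i + 1) 0 = false) →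
    P.real {ω | ∀ i < M, ∀ j < N, H (i + 1) (j + 1) ω = eH (i + 1) (j + 1) ∧
        V (i + 1) (j + 1) ω = eV (i + 1) (j + 1)} =
      ∏ i ∈ Finset.range M, ∏ j ∈ Finset.range N,
        sixVertexWeight t (a (i + 1) * b (j + 1)) (eH i (j + 1)) (eV (i + 1) j)
          (eH (i + 1) (j + 1)) (eV (i + 1) (j + 1))

/-- The height function at `(i, j)`: the number of paths crossing the vertical line right of the
`i`-th column of vertices in the rows `1, …, j`. -/
def sixVertexHeight {Ω : Type*} (H : ℕ → ℕ → Ω → Bool) (i j : ℕ) (ω : Ω) : ℕ :=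
  ((Finset.Icc 1 j).filter fun y => H i y ω = true).card

/-- `d₀(i, j)`, the number of zero coordinates of `L i j`. -/
def zeroCount {Ω : Type*} (L : (i j : ℕ) → Ω → Signature j) (i j : ℕ) (ω : Ω) : ℕ :=
  multAt (L i j ω).1 0

end

/-!
The algorithm is first rewritten so that it acts on the columns of Young diagrams from left to
right. The labels in a row of an admissible function stay constant except along a run of
one-boxes, so in every row at most one box, the first nontrivial one, has a weight different from
`1`, and this weight depends only on the columns of the diagrams at the position of its label and
the one before (`IsAdmissible.prod_boxWeight`). At a column, `a`, `b` tell whether `ν/λ`, `μ/λ`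
have a box there, `a'`, `b'` do so for `ρ/μ`, `ρ/ν`, and a number `s` of pairs of boxes is pushed
in from the left. If `s > 0`, the rule `CarryStep` is deterministic. A random decision, with
probabilities `colWt`, takes place only if `a = b = 1` and `s = 0`: the pair of boxes stays or is
pushed on. Conversely, every run of these rules comes from an admissible function
(`IsCarryRun.exists_isAdmissible`). For diagrams with an input `r`, the appended coordinate has
the effect that `r` pairs are pushed into the first column, where a decision is made as if exactly
one of the two boxes were present before it (`IsColumnRun.rskUInput_eq`).

In this form two facts become visible. The two outcomes of a decision have total probability `1`,
so the algorithm is stochastic (`hasSum_diagramU_mul`, `hasSum_rskUInput`). And it is reversible: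
the rule `CarryStep` is symmetric under the exchange of input and output, and after multiplication
by the weights `ψ φ` the column weights turn into those of the same algorithm read from right to
left (`colWt_reversal`, `IsColumnRun.reversal`). The reversed algorithm is stochastic as well, and
summing over `λ` gives the skew Cauchy identity in a refined form, `hasSum_stepLaw_cauchy`:
averaged over the input, the algorithm maps the weight of a path around a box on the lower left to
that of the path on the upper right, up to the factor `(1 - xy) / (1 - txy)`.

The field is Markovian in the sense that given everything outside of the quadrant above a box, the
step at this box has the law of the algorithm (`markov_input`). Hence the law of the states along
a path from the horizontal to the vertical axis is found by pushing its corners across boxes one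
after another until it runs along the axes, where all diagrams are empty
(`measureReal_pathEvent`): it is the product of the weights `φ` and `ψ` of the steps. Summing over
the states that are not prescribed turns the straight pieces into skew Hall-Littlewood functions,
and the factors of the boxes combine to the normalization of the Hall-Littlewood process
(`measureReal_corners`). The field exists, as it is generated by independent noise at the boxes
(`exists_isHLRSKField`).

The number of zeros of a state of length `j` is `j` minus the length of the first column, and the
first column evolves autonomously, since the algorithm proceeds from left to right. Averaged over
the input, its transition probabilities are the six vertex weights (`hasSum_firstColumn`), so with
the Markov property the edges form a six vertex model (`isSixVertex`). The law of a six vertex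
model on a rectangle is determined by its weights (`IsSixVertex.measureReal_eq`), and this
transfers the result to the height function of an arbitrary one (`IsSixVertex.hasSum_height`).
-/

noncomputable section

/-! ### Column heights of integer vectors -/

/-- The number of coordinates of `κ` larger than `q`; for a partition, the length of the
(zero-indexed) column `q`. Moving a particle from `p` to `p + 1` adds a box to column `p`. -/
def colCount {N : ℕ} (κ : Fin N → ℤ) (q : ℤ) : ℕ := (Finset.univ.filter fun c => q < κ c).card

theorem colCount_eq_sum {N : ℕ} (κ : Fin N → ℤ) (q : ℤ) :
    colCount κ q = ∑ c, if q < κ c then 1 else 0 := by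
  rw [colCount, Finset.card_filter]

theorem colCount_le {N : ℕ} (κ : Fin N → ℤ) (q : ℤ) : colCount κ q ≤ N :=
  (Finset.card_le_univ _).trans_eq (Fintype.card_fin N)

theorem colCount_anti {N : ℕ} (κ : Fin N → ℤ) {q q' : ℤ} (h : q ≤ q') :
    colCount κ q' ≤ colCount κ q := by
  apply Finset.card_le_card
  intro c
  simp only [Finset.mem_filter, Finset.mem_univ, true_and]
  omega

theorem lt_iff_lt_colCount {N : ℕ} {κ : Fin N → ℤ} (hκ : Antitone κ) (q : ℤ) (c : Fin N) :
    q < κ c ↔ (c : ℕ) < colCount κ q := by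
  constructor
  · intro h
    have : Finset.Iic c ⊆ Finset.univ.filter fun c => q < κ c := by
      intro d hd
      have := hκ (Finset.mem_Iic.1 hd)
      simp only [Finset.mem_filter, Finset.mem_univ, true_and]
      omega
    have := Finset.card_le_card this
    rw [Fin.card_Iic] at this
    exact this
  · intro h
    by_contra hc
    have : (Finset.univ.filter fun c => q < κ c) ⊆ Finset.Iio c := by
      intro d hd
      simp only [Finset.mem_filter, Finset.mem_univ, true_and] at hd
      rw [Finset.mem_Iio]
      by_contra hdc
      have := hκ (not_lt.1 hdc)
      omega
    have := Finset.card_le_card this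
    rw [Fin.card_Iio] at this
    exact absurd h (not_lt.2 this)

theorem eq_of_colCount_eq {N : ℕ} {κ κ' : Fin N → ℤ} (hκ : Antitone κ) (hκ' : Antitone κ')
    (h : ∀ q, colCount κ q = colCount κ' q) : κ = κ' := by
  funext c
  by_contra hne
  rcases lt_or_gt_of_ne hne with h1 | h1
  · have := (lt_iff_lt_colCount hκ' (κ c) c).1 h1
    rw [← h, ← lt_iff_lt_colCount hκ] at this
    exact lt_irrefl _ this
  · have := (lt_iff_lt_colCount hκ (κ' c) c).1 h1
    rw [h, ← lt_iff_lt_colCount hκ'] at this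
    exact lt_irrefl _ this

theorem colCount_pred_eq {N : ℕ} (κ : Fin N → ℤ) (p : ℤ) :
    colCount κ (p - 1) = colCount κ p + multAt κ p := by
  rw [colCount, colCount, multAt, ← Finset.card_union_of_disjoint]
  · congr 1
    ext c
    simp only [Finset.mem_filter, Finset.mem_univ, true_and, Finset.mem_union]
    omega
  · rw [Finset.disjoint_filter]
    intro c _ h1 h2
    omega

theorem MovesBy.colCount {N : ℕ} {κ κ' : Fin N → ℤ} {p : ℤ} (h : MovesBy κ κ' p) (q : ℤ) :
    colCount κ' q = colCount κ q + if q = p then 1 else 0 := by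
  obtain ⟨c, hc, rfl⟩ := h
  rw [colCount_eq_sum, colCount_eq_sum, ← Finset.add_sum_erase _ _ (Finset.mem_univ c),
    ← Finset.add_sum_erase (a := c) Finset.univ (fun c => if q < κ c then 1 else 0)
      (Finset.mem_univ c)]
  have : ∑ x ∈ Finset.univ.erase c, (if q < Function.update κ c (p + 1) x then 1 else 0) =
      ∑ x ∈ Finset.univ.erase c, if q < κ x then 1 else 0 := by
    apply Finset.sum_congr rfl
    intro x hx
    rw [Function.update_of_ne (Finset.ne_of_mem_erase hx)]
  rw [this, Function.update_self]
  split_ifs <;> omega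

theorem MovesBy.sum {N : ℕ} {κ κ' : Fin N → ℤ} {p : ℤ} (h : MovesBy κ κ' p) :
    ∑ c, κ' c = ∑ c, κ c + 1 := by
  obtain ⟨c, hc, rfl⟩ := h
  rw [← Finset.add_sum_erase _ _ (Finset.mem_univ c),
    ← Finset.add_sum_erase (a := c) Finset.univ κ (Finset.mem_univ c)]
  have : ∑ x ∈ Finset.univ.erase c, Function.update κ c (p + 1) x =
      ∑ x ∈ Finset.univ.erase c, κ x := by
    apply Finset.sum_congr rfl
    intro x hx
    rw [Function.update_of_ne (Finset.ne_of_mem_erase hx)]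
  rw [this, Function.update_self]
  omega

theorem exists_movesBy {N : ℕ} {κ : Fin N → ℤ} (hκ : Antitone κ) {p : ℤ}
    (h : colCount κ p < colCount κ (p - 1)) : ∃ κ', Antitone κ' ∧ MovesBy κ κ' p := by
  have hN : colCount κ p < N := h.trans_le (colCount_le _ _)
  obtain ⟨c, hcc⟩ : ∃ c : Fin N, (c : ℕ) = colCount κ p := ⟨⟨_, hN⟩, rfl⟩
  have hc : κ c = p := by
    have h1 := (lt_iff_lt_colCount hκ (p - 1) c).2 (by omega)
    have h2 := (lt_iff_lt_colCount hκ p c).not.2 (by omega)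
    omega
  refine ⟨Function.update κ c (p + 1), ?_, c, hc, rfl⟩
  intro x y hxy
  by_cases hx : x = c
  · by_cases hy : y = c
    · rw [hx, hy]
    · have := hκ hxy
      subst hx
      rw [Function.update_self, Function.update_of_ne hy]
      omega
  · rw [Function.update_of_ne hx]
    by_cases hy : y = c
    · subst hy
      rw [Function.update_self]
      have := (lt_iff_lt_colCount hκ p x).2 (by
        have : x < y := lt_of_le_of_ne hxy hx
        omega)
      omega
    · rw [Function.update_of_ne hy]
      exact hκ hxy

theorem exists_movesBy_to {N : ℕ} {κ' : Fin N → ℤ} (hκ : Antitone κ') {p : ℤ}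
    (h : colCount κ' (p + 1) < colCount κ' p) : ∃ κ, Antitone κ ∧ MovesBy κ κ' p := by
  have hN : colCount κ' p - 1 < N := by have := colCount_le κ' p; omega
  obtain ⟨c, hcc⟩ : ∃ c : Fin N, (c : ℕ) = colCount κ' p - 1 := ⟨⟨_, hN⟩, rfl⟩
  have hc : κ' c = p + 1 := by
    have h1 := (lt_iff_lt_colCount hκ p c).2 (by omega)
    have h2 := (lt_iff_lt_colCount hκ (p + 1) c).not.2 (by omega)
    omega
  refine ⟨Function.update κ' c p, ?_, c, Function.update_self _ _ _, ?_⟩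
  · intro x y hxy
    by_cases hx : x = c
    · by_cases hy : y = c
      · rw [hx, hy]
      · subst hx
        rw [Function.update_self, Function.update_of_ne hy]
        have := (lt_iff_lt_colCount hκ p y).not.2 (by
          have : x < y := lt_of_le_of_ne hxy (Ne.symm hy)
          omega)
        omega
    · rw [Function.update_of_ne hx]
      by_cases hy : y = c
      · subst hy
        have := hκ hxy
        rw [Function.update_self]
        omega
      · rw [Function.update_of_ne hy]
        exact hκ hxy
  · rw [Function.update_idem, ← hc, Function.update_eq_self]

theorem movesBy_of_colCount {N : ℕ} {κ κ' : Fin N → ℤ} (hκ : Antitone κ) (hκ' : Antitone κ')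
    {p : ℤ} (h : ∀ q, colCount κ' q = colCount κ q + if q = p then 1 else 0) :
    MovesBy κ κ' p := by
  have h1 := h p
  have h2 := h (p - 1)
  have h3 := colCount_anti κ' (show p - 1 ≤ p by omega)
  simp only [if_true] at h1
  rw [if_neg (by omega)] at h2
  obtain ⟨κ'', ha, hm⟩ := exists_movesBy hκ (p := p) (by omega)
  have : κ' = κ'' := eq_of_colCount_eq hκ' ha fun q => by rw [h, hm.colCount]
  rwa [this]

/-! ### The labels of an admissible function -/

/-- The edge labels of an admissible function, without the signatures: labels increase along rows
and columns, equal labels either stay or are both raised by one, and different labels cross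
unchanged. -/
structure IsLabelling (m n : ℕ) (h v : ℕ → ℕ → ℤ) : Prop where
  lt_h : ∀ i, i + 1 < m → ∀ j ≤ n, h i j < h (i + 1) j
  lt_v : ∀ i ≤ m, ∀ j, j + 1 < n → v i j < v i (j + 1)
  box : ∀ i < m, ∀ j < n,
    (h i j = v i j ∧ h i (j + 1) = v (i + 1) j ∧
      (h i (j + 1) = h i j ∨ h i (j + 1) = h i j + 1)) ∨
    (h i j ≠ v i j ∧ h i (j + 1) = h i j ∧ v (i + 1) j = v i j)

theorem IsAdmissible.isLabelling {N m n : ℕ} {lam mu nu rho : Fin N → ℤ}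
    {L : ℕ → ℕ → Fin N → ℤ} {h v : ℕ → ℕ → ℤ} (H : IsAdmissible m n lam mu nu rho L h v) :
    IsLabelling m n h v where
  lt_h := H.lt_h
  lt_v := H.lt_v
  box i hi j hj := by
    by_cases heq : h i j = v i j
    · exact Or.inl ⟨heq, H.box i hi j hj heq⟩
    · right
      refine ⟨heq, ?_⟩
      have key : ∀ q, ((if q = h i j then 1 else 0) + if q = v (i + 1) j then 1 else 0) =
          (if q = v i j then 1 else 0) + if q = h i (j + 1) then 1 else 0 := by
        intro q
        have h1 := (H.moves_h i hi j hj.le).colCount q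
        have h2 := (H.moves_v (i + 1) hi j hj).colCount q
        have h3 := (H.moves_v i hi.le j hj).colCount q
        have h4 := (H.moves_h i hi (j + 1) hj).colCount q
        omega
      have k1 := key (h i j)
      have k2 := key (v i j)
      rw [if_neg heq, if_pos rfl] at k1
      rw [if_neg (Ne.symm heq), if_pos rfl] at k2
      constructor
      · by_contra hc
        rw [if_neg (Ne.symm hc)] at k1
        omega
      · by_contra hc
        rw [if_neg (Ne.symm hc)] at k2
        omega

namespace IsLabelling

variable {m n : ℕ} {h v : ℕ → ℕ → ℤ}

theorem restrict (H : IsLabelling m (n + 1) h v) : IsLabelling m n h v where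
  lt_h i hi j hj := H.lt_h i hi j (by omega)
  lt_v i hi j hj := H.lt_v i hi j (by omega)
  box i hi j hj := H.box i hi j (by omega)

theorem h_lt (H : IsLabelling m n h v) {i i' j : ℕ} (hi : i < i') (hi' : i' < m) (hj : j ≤ n) :
    h i j < h i' j := by
  induction i', hi using Nat.le_induction with
  | base => exact H.lt_h i hi' j hj
  | succ k hk ih => exact (ih (by omega)).trans (H.lt_h k hi' j hj)

theorem v_lt (H : IsLabelling m n h v) {i j j' : ℕ} (hj : j < j') (hj' : j' < n) (hi : i ≤ m) :
    v i j < v i j' := by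
  induction j', hj using Nat.le_induction with
  | base => exact H.lt_v i hi j hj'
  | succ k hk ih => exact (ih (by omega)).trans (H.lt_v i hi k hj')

theorem h_lt_iff (H : IsLabelling m n h v) {i i' j : ℕ} (hi : i < m) (hi' : i' < m)
    (hj : j ≤ n) : h i j < h i' j ↔ i < i' := by
  refine ⟨fun hlt => ?_, fun hlt => H.h_lt hlt hi' hj⟩
  by_contra hc
  rcases (not_lt.1 hc).eq_or_lt with rfl | hc
  · exact lt_irrefl _ hlt
  · exact lt_asymm hlt (H.h_lt hc hi hj)

theorem h_inj (H : IsLabelling m n h v) {i i' j : ℕ} (hi : i < m) (hi' : i' < m)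
    (hj : j ≤ n) (heq : h i j = h i' j) : i = i' := by
  rcases lt_trichotomy i i' with hlt | hlt | hlt
  · have := H.h_lt hlt hi' hj; omega
  · exact hlt
  · have := H.h_lt hlt hi hj; omega

theorem v_inj (H : IsLabelling m n h v) {i j j' : ℕ} (hj : j < n) (hj' : j' < n)
    (hi : i ≤ m) (heq : v i j = v i j') : j = j' := by
  rcases lt_trichotomy j j' with hlt | hlt | hlt
  · have := H.v_lt hlt hj' hi; omega
  · exact hlt
  · have := H.v_lt hlt hj hi; omega

theorem v_step (H : IsLabelling m n h v) {i j : ℕ} (hi : i < m) (hj : j < n) :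
    v (i + 1) j = v i j ∨
      (v (i + 1) j = v i j + 1 ∧ h i j = v i j ∧ h i (j + 1) = v (i + 1) j) := by
  rcases H.box i hi j hj with ⟨h1, h2, h3⟩ | ⟨h1, h2, h3⟩
  · omega
  · exact Or.inl h3

theorem v_mono (H : IsLabelling m n h v) {i i' j : ℕ} (hi : i ≤ i') (hi' : i' ≤ m) (hj : j < n) :
    v i j ≤ v i' j := by
  induction i', hi using Nat.le_induction with
  | base => exact le_rfl
  | succ k hk ih =>
    refine (ih (by omega)).trans ?_
    rcases H.v_step (i := k) (by omega) hj with h1 | h1 <;> omega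

/-- Vertical labels rise by at most one per box, so every intermediate value is attained at
a one-box. -/
theorem exists_one (H : IsLabelling m n h v) {i i' j : ℕ} (hi : i ≤ i') (hi' : i' ≤ m) (hj : j < n)
    {q : ℤ} (hq : v i j < q) (hq' : q ≤ v i' j) :
    ∃ k, i ≤ k ∧ k < i' ∧ h k j = q - 1 ∧ v k j = q - 1 ∧ h k (j + 1) = q ∧ v (k + 1) j = q := by
  induction i', hi using Nat.le_induction with
  | base => omega
  | succ k hk ih =>
    by_cases hqk : q ≤ v k j
    · obtain ⟨l, h1, h2, h3⟩ := ih (by omega) hqk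
      exact ⟨l, h1, by omega, h3⟩
    · refine ⟨k, hk, by omega, ?_⟩
      rcases H.v_step (i := k) (by omega) hj with h1 | h1 <;> omega

end IsLabelling

/-- The number of horizontal edges with label `q` on the horizontal line `j`: it is the indicator
that the skew diagram between the end points of that line has a box in column `q`. -/
def hCount (m : ℕ) (h : ℕ → ℕ → ℤ) (j : ℕ) (q : ℤ) : ℕ :=
  ∑ i ∈ Finset.range m, if q = h i j then 1 else 0

/-- The number of vertical edges with label `q` on the first `n` edges of the vertical line `i`. -/
def vCount (n : ℕ) (v : ℕ → ℕ → ℤ) (i : ℕ) (q : ℤ) : ℕ :=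
  ∑ j ∈ Finset.range n, if q = v i j then 1 else 0

/-- The number of rows whose vertical label is raised from below `q` to at least `q`. -/
def labelCarry (m n : ℕ) (v : ℕ → ℕ → ℤ) (q : ℤ) : ℕ :=
  ∑ j ∈ Finset.range n, if v 0 j < q ∧ q ≤ v m j then 1 else 0

theorem sum_ite_le_one_of_inj {f : ℕ → ℤ} {m : ℕ}
    (hf : ∀ i < m, ∀ i' < m, f i = f i' → i = i') (q : ℤ) :
    (∑ i ∈ Finset.range m, if q = f i then 1 else 0) ≤ 1 := by
  rw [← Finset.card_filter, Finset.card_le_one]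
  intro i hi i' hi'
  simp only [Finset.mem_filter, Finset.mem_range] at hi hi'
  exact hf i hi.1 i' hi'.1 (hi.2.symm.trans hi'.2)

theorem sum_ite_pos_iff {f : ℕ → Prop} [DecidablePred f] {m : ℕ} :
    0 < (∑ i ∈ Finset.range m, if f i then 1 else 0) ↔ ∃ i < m, f i := by
  rw [← Finset.card_filter, Finset.card_pos]
  simp [Finset.Nonempty]

theorem hCount_pos {m : ℕ} {h : ℕ → ℕ → ℤ} {j : ℕ} {q : ℤ} :
    0 < hCount m h j q ↔ ∃ i < m, q = h i j := sum_ite_pos_iff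

theorem vCount_pos {n : ℕ} {v : ℕ → ℕ → ℤ} {i : ℕ} {q : ℤ} :
    0 < vCount n v i q ↔ ∃ j < n, q = v i j := sum_ite_pos_iff

theorem labelCarry_pos {m n : ℕ} {v : ℕ → ℕ → ℤ} {q : ℤ} :
    0 < labelCarry m n v q ↔ ∃ j < n, v 0 j < q ∧ q ≤ v m j := sum_ite_pos_iff

theorem IsLabelling.hCount_le {m n : ℕ} {h v : ℕ → ℕ → ℤ} (H : IsLabelling m n h v) {j : ℕ}
    (hj : j ≤ n) (q : ℤ) : hCount m h j q ≤ 1 :=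
  sum_ite_le_one_of_inj (fun _ hi _ hi' => H.h_inj hi hi' hj) q

theorem IsLabelling.vCount_le {m n : ℕ} {h v : ℕ → ℕ → ℤ} (H : IsLabelling m n h v) {i : ℕ}
    (hi : i ≤ m) (q : ℤ) : vCount n v i q ≤ 1 :=
  sum_ite_le_one_of_inj (fun _ hj _ hj' => H.v_inj hj hj' hi) q

/-- Crossing a row moves a label from the entrance to the exit of the vertical label. -/
theorem IsLabelling.hCount_succ {m n : ℕ} {h v : ℕ → ℕ → ℤ} (H : IsLabelling m n h v) {j : ℕ}
    (hj : j < n) (q : ℤ) :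
    hCount m h (j + 1) q + (if q = v 0 j then 1 else 0) =
      hCount m h j q + if q = v m j then 1 else 0 := by
  suffices ∀ k ≤ m, hCount k h (j + 1) q + (if q = v 0 j then 1 else 0) =
      hCount k h j q + if q = v k j then 1 else 0 from this m le_rfl
  intro k hk
  induction k with
  | zero => simp [hCount]
  | succ k ih =>
    have ih := ih (by omega)
    simp only [hCount, Finset.sum_range_succ] at ih ⊢
    rcases H.box k (by omega) j hj with ⟨h1, h2, h3⟩ | ⟨h1, h2, h3⟩
    · rw [h1, h2]; omega
    · rw [h2, h3]; omega

/-- The local rule of the algorithm read from column to column. At a given column, `a`, `b` are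
the indicators of a box in the input skew diagrams `ν/λ`, `μ/λ`, and `a'`, `b'` those of a box in
the output skew diagrams `ρ/μ`, `ρ/ν`; `s` and `s'` are the numbers of pairs of boxes carried
into and out of the column. Boxes are conserved, and if something is carried into a column with
`a = b`, this column is flipped. -/
def CarryStep (s a b a' b' s' : ℕ) : Prop :=
  a' + s' = a + s ∧ b' + s' = b + s ∧ (0 < s → a = b → a' ≠ a)

theorem IsLabelling.carryStep {m : ℕ} {h v : ℕ → ℕ → ℤ} : ∀ {n : ℕ}, IsLabelling m n h v →
    ∀ q : ℤ, CarryStep (labelCarry m n v q) (hCount m h 0 q) (vCount n v 0 q)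
      (hCount m h n q) (vCount n v m q) (labelCarry m n v (q + 1))
  | 0, H, q => by simp [CarryStep, labelCarry, vCount]
  | n + 1, H, q => by
    obtain ⟨c1, c2, c3⟩ := H.restrict.carryStep q
    have hs := H.hCount_succ (Nat.lt_succ_self n) q
    have l1 := H.hCount_le (Nat.zero_le _) q
    have l2 := H.hCount_le n.le_succ q
    have l3 := H.hCount_le le_rfl q
    have l4 := H.vCount_le (Nat.zero_le _) q
    have l5 := H.vCount_le le_rfl q
    have hmono := H.v_mono (Nat.zero_le m) le_rfl (Nat.lt_succ_self n)
    -- columns strictly between entrance and exit of the last row are occupied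
    have hrun : v 0 n < q → q < v m n → hCount m h n q = 1 := by
      intro h1 h2
      obtain ⟨k, hk1, hk2, hk3, -⟩ := H.exists_one (Nat.zero_le m) le_rfl (Nat.lt_succ_self n)
        (q := q + 1) (by omega) (by omega)
      have := hCount_pos.2 ⟨k, hk2, show q = h k n by omega⟩
      omega
    -- later rows have larger labels, so nothing else enters or leaves beyond the last row
    have hent : v 0 n ≤ q → vCount n v 0 q = 0 := by
      intro h1
      by_contra hc
      obtain ⟨j, hj, hj'⟩ := vCount_pos.1 (Nat.pos_of_ne_zero hc)
      have := H.v_lt hj (Nat.lt_succ_self n) (Nat.zero_le m)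
      omega
    have hexit : v m n ≤ q → labelCarry m n v q = 0 := by
      intro h1
      by_contra hc
      obtain ⟨j, hj, hj'⟩ := labelCarry_pos.1 (Nat.pos_of_ne_zero hc)
      have := H.v_lt hj (Nat.lt_succ_self n) le_rfl
      omega
    simp only [CarryStep, labelCarry, vCount, Finset.sum_range_succ]
      at c1 c2 c3 hrun hent hexit l4 l5 hs ⊢
    generalize (∑ j ∈ Finset.range n, if v 0 j < q ∧ q ≤ v m j then 1 else 0) = s at *
    generalize (∑ j ∈ Finset.range n, if v 0 j < q + 1 ∧ q + 1 ≤ v m j then 1 else 0) = s' at *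
    generalize (∑ j ∈ Finset.range n, if q = v 0 j then 1 else 0) = bq at *
    generalize (∑ j ∈ Finset.range n, if q = v m j then 1 else 0) = bq' at *
    generalize hCount m h 0 q = aq at *
    generalize hCount m h n q = aq' at *
    generalize hCount m h (n + 1) q = aq'' at *
    generalize v 0 n = x at *
    generalize v m n = e at *
    rcases lt_trichotomy q x with hx | hx | hx <;> rcases lt_trichotomy q e with he | he | he <;>
      split_ifs at * <;> omega

/-! ### From box weights to column weights -/

/-- The weight of a column in the column-by-column description of the algorithm. Here `pa`, `pb`
are the indicators of a box of the output skew diagrams in the previous column and `ps` is the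
number of pairs carried into the previous column; `n` is the multiplicity in `λ` of the position
in question, and `a`, `b`, `s`, `a'` are as in `CarryStep`. A random decision takes place only if
`a = b = 1` and nothing is carried into the column. -/
def colWt (t : ℝ) (pa pb ps n a b s a' : ℕ) : ℝ :=
  if a = 1 ∧ b = 1 ∧ s = 0 then
    if pa = 1 ∧ pb = 1 then (if (ps = 0 ↔ a' = 1) then 1 else 0)
    else if pa = 1 ∨ pb = 1 then (if a' = 1 then t else 1 - t)
    else (if a' = 1 then (t - t ^ n) / (1 - t ^ n) else (1 - t) / (1 - t ^ n))
  else 1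

theorem colWt_eq_one {t : ℝ} {pa pb ps n a b s a' : ℕ} (h : ¬ (a = 1 ∧ b = 1 ∧ s = 0)) :
    colWt t pa pb ps n a b s a' = 1 := if_neg h

theorem colWt_choice (t : ℝ) (pa pb ps n a' : ℕ) : colWt t pa pb ps n 1 1 0 a' =
    if pa = 1 ∧ pb = 1 then (if (ps = 0 ↔ a' = 1) then 1 else 0)
    else if pa = 1 ∨ pb = 1 then (if a' = 1 then t else 1 - t)
    else (if a' = 1 then (t - t ^ n) / (1 - t ^ n) else (1 - t) / (1 - t ^ n)) :=
  if_pos ⟨rfl, rfl, rfl⟩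

/-- The column weights of an array of labels over a signature `lam`. -/
def labelWt {N : ℕ} (t : ℝ) (m n : ℕ) (lam : Fin N → ℤ) (h v : ℕ → ℕ → ℤ) (q : ℤ) : ℝ :=
  colWt t (hCount m h n (q - 1)) (vCount n v m (q - 1)) (labelCarry m n v (q - 1)) (multAt lam q)
    (hCount m h 0 q) (vCount n v 0 q) (labelCarry m n v q) (hCount m h n q)

namespace IsLabelling

variable {m n : ℕ} {h v : ℕ → ℕ → ℤ}

theorem not_isOneBox_of_ne {i j : ℕ} (hne : h i j ≠ v i j) : ¬ IsOneBox h v i j :=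
  fun H => hne H.1

theorem not_isZeroBox_of_ne {i j : ℕ} (hne : h i j ≠ v i j) : ¬ IsZeroBox h v i j :=
  fun H => hne H.1

theorem isOneBox_or_isZeroBox (H : IsLabelling m n h v) {i j : ℕ} (hi : i < m) (hj : j < n)
    (heq : h i j = v i j) : IsOneBox h v i j ∨ IsZeroBox h v i j := by
  rcases H.box i hi j hj with ⟨h1, h2, h3⟩ | ⟨h1, -⟩
  · rcases h3 with h3 | h3
    · exact Or.inr ⟨h1, h3, by omega⟩
    · exact Or.inl ⟨h1, h3, by omega⟩
  · exact absurd heq h1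

/-- A nontrivial box whose label is not that of the entrance of its row continues a run of
one-boxes. -/
theorem isOneBox_of_ne (H : IsLabelling m n h v) {i j : ℕ} (hi : i < m) (hj : j < n)
    (heq : h i j = v i j) (hne : v i j ≠ v 0 j) :
    0 < i ∧ IsOneBox h v (i - 1) j ∧ IsOneBox h v i j := by
  have h0 := H.v_mono (Nat.zero_le i) hi.le hj
  obtain ⟨k, -, hk, k1, k2, k3, k4⟩ := H.exists_one (Nat.zero_le i) hi.le hj
    (lt_of_le_of_ne h0 (Ne.symm hne)) le_rfl
  have hki : k + 1 = i := by
    by_contra hc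
    have e1 := H.h_lt (i := k + 1) (i' := i) (j := j) (by omega) hi hj.le
    have e2 := H.lt_h k (by omega) (j + 1) hj
    rcases H.box (k + 1) (by omega) j hj with h1 | h1 <;> omega
  subst hki
  refine ⟨Nat.succ_pos _, ⟨by simp only [Nat.add_sub_cancel]; omega,
    by simp only [Nat.add_sub_cancel]; omega, by simp only [Nat.add_sub_cancel]; omega⟩, ?_⟩
  have e2 := H.lt_h k hi (j + 1) hj
  rcases H.box (k + 1) hi j hj with h1 | h1
  · exact ⟨heq, by omega, by omega⟩
  · exact absurd heq h1.1

theorem boxWeight_of_ne_head {N : ℕ} (t : ℝ) (L : ℕ → ℕ → Fin N → ℤ) (H : IsLabelling m n h v)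
    {i j : ℕ} (hi : i < m) (hj : j < n) (hne : h i j ≠ v 0 j) : boxWeight t L h v i j = 1 := by
  by_cases heq : h i j = v i j
  · obtain ⟨h1, h2, h3⟩ := H.isOneBox_of_ne hi hj heq (by omega)
    simp only [boxWeight]
    rw [if_pos h3, if_pos (Or.inl ⟨h1, h2⟩)]
  · simp only [boxWeight]
    rw [if_neg (not_isOneBox_of_ne heq), if_neg (not_isZeroBox_of_ne heq)]

theorem v_eq_head (H : IsLabelling m n h v) {i j : ℕ} (hi : i < m) (hj : j < n)
    (heq : h i j = v 0 j) : v i j = v 0 j := by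
  by_contra hne
  have h0 := H.v_mono (Nat.zero_le i) hi.le hj
  obtain ⟨k, -, hk, k1, -⟩ := H.exists_one (Nat.zero_le i) hi.le hj
    (q := v 0 j + 1) (by omega) (by omega)
  have := H.h_inj (hk.trans hi) hi hj.le (by omega)
  omega

/-- Below the entrance of the last row nothing changes in that row. -/
theorem counts_succ_of_lt (H : IsLabelling m (n + 1) h v) {q : ℤ} (hq : q < v 0 n) :
    hCount m h (n + 1) q = hCount m h n q ∧ vCount (n + 1) v m q = vCount n v m q ∧
    vCount (n + 1) v 0 q = vCount n v 0 q ∧ labelCarry m (n + 1) v q = labelCarry m n v q := by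
  have h0 := H.v_mono (Nat.zero_le m) le_rfl (Nat.lt_add_one n)
  have h1 := H.hCount_succ (Nat.lt_add_one n) q
  rw [if_neg (by omega), if_neg (by omega)] at h1
  simp only [vCount, labelCarry, Finset.sum_range_succ]
  rw [if_neg (by omega), if_neg (by omega), if_neg (by omega)]
  exact ⟨h1, rfl, rfl, rfl⟩

theorem labelCarry_succ_head : labelCarry m (n + 1) v (v 0 n) = labelCarry m n v (v 0 n) := by
  simp only [labelCarry, Finset.sum_range_succ]
  rw [if_neg (by omega), add_zero]

theorem vCount_succ_head (H : IsLabelling m (n + 1) h v) :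
    vCount n v 0 (v 0 n) = 0 ∧ vCount (n + 1) v 0 (v 0 n) = 1 := by
  have h1 := H.vCount_le (Nat.zero_le m) (v 0 n)
  simp only [vCount, Finset.sum_range_succ, if_true] at h1 ⊢
  omega

/-- The southern neighbour of the first nontrivial box of a row is a one-box exactly if something
is carried into the column of the entrance of that row. -/
theorem south_isOneBox_iff (H : IsLabelling m (n + 1) h v) {i : ℕ} (hi : i < m)
    (heq : h i n = v 0 n) :
    (0 < n ∧ IsOneBox h v i (n - 1)) ↔ 0 < labelCarry m n v (v 0 n) := by
  rw [labelCarry_pos]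
  constructor
  · rintro ⟨hn, h1, h2, h3⟩
    obtain ⟨n, rfl⟩ : ∃ k, n = k + 1 := ⟨n - 1, by omega⟩
    simp only [Nat.add_sub_cancel] at h1 h2 h3
    have e1 := H.v_lt (i := 0) (Nat.lt_add_one n) (by omega) (Nat.zero_le m)
    have e2 := H.v_mono (i := i + 1) (i' := m) (j := n) hi le_rfl (by omega)
    exact ⟨n, by omega, e1, by omega⟩
  · rintro ⟨j, hj, h1, h2⟩
    obtain ⟨n, rfl⟩ : ∃ k, n = k + 1 := ⟨n - 1, by omega⟩
    refine ⟨by omega, ?_⟩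
    simp only [Nat.add_sub_cancel]
    have e1 := H.v_lt (i := 0) (Nat.lt_add_one n) (by omega) (Nat.zero_le m)
    have e2 : v m j ≤ v m n := by
      rcases Nat.lt_succ_iff_lt_or_eq.1 hj with h3 | rfl
      · exact (H.v_lt h3 (by omega) le_rfl).le
      · exact le_rfl
    obtain ⟨k, -, k0, k1, k2, k3, k4⟩ := H.exists_one (Nat.zero_le m) le_rfl
      (show n < n + 1 + 1 by omega) e1 (h2.trans e2)
    have := H.h_inj (j := n + 1) k0 hi (by omega) (by omega)
    subst this
    exact ⟨by omega, by omega, by omega⟩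

theorem not_west_isOneBox (H : IsLabelling m n h v) {i j : ℕ} (hi : i < m) (hj : j < n)
    (heq : h i j = v 0 j) : ¬ (0 < i ∧ IsOneBox h v (i - 1) j) := by
  rintro ⟨h0, h1, h2, h3⟩
  obtain ⟨i, rfl⟩ : ∃ k, i = k + 1 := ⟨i - 1, by omega⟩
  simp only [Nat.add_sub_cancel] at h1 h2 h3
  have e1 := H.v_eq_head hi hj heq
  have e2 := H.v_mono (Nat.zero_le i) (by omega) hj
  omega

theorem west_iff (H : IsLabelling m n h v) {i j : ℕ} (hi : i < m) (hj : j ≤ n) :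
    (0 < i ∧ h (i - 1) j = h i j - 1) ↔ hCount m h j (h i j - 1) = 1 := by
  have hle := H.hCount_le hj (h i j - 1)
  have hpos := hCount_pos (m := m) (h := h) (j := j) (q := h i j - 1)
  constructor
  · rintro ⟨h0, h1⟩
    have := hpos.2 ⟨i - 1, by omega, h1.symm⟩
    omega
  · intro h1
    obtain ⟨k, hk, hk'⟩ := hpos.1 (by omega)
    have hki : k < i := (H.h_lt_iff hk hi hj).1 (by omega)
    have : k + 1 = i := by
      by_contra hc
      have e1 := H.h_lt (i := k + 1) (i' := i) (by omega) hi hj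
      have e2 := H.h_lt (i := k) (i' := k + 1) (by omega) (by omega) hj
      omega
    subst this
    exact ⟨by omega, by simp only [Nat.add_sub_cancel]; omega⟩

theorem south_iff (H : IsLabelling m (n + 1) h v) {i : ℕ} (hi : i < m) (heq : h i n = v 0 n)
    (hs : labelCarry m n v (v 0 n) = 0) :
    (0 < n ∧ v i (n - 1) = v 0 n - 1) ↔ vCount n v m (v 0 n - 1) = 1 := by
  have hle := H.restrict.vCount_le le_rfl (v 0 n - 1)
  have hpos := vCount_pos (n := n) (v := v) (i := m) (q := v 0 n - 1)
  have hexit : ∀ j < n, v m j < v 0 n := by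
    intro j hj
    by_contra hc
    have := labelCarry_pos.2 ⟨j, hj, H.v_lt hj (Nat.lt_add_one n) (Nat.zero_le m), not_lt.1 hc⟩
    omega
  constructor
  · rintro ⟨h0, h1⟩
    have e1 := H.v_mono hi.le le_rfl (show n - 1 < n + 1 by omega)
    have e2 := hexit (n - 1) (by omega)
    have := hpos.2 ⟨n - 1, by omega, by omega⟩
    omega
  · intro h1
    obtain ⟨j, hj, hj'⟩ := hpos.1 (by omega)
    have hjn : j = n - 1 := by
      by_contra hc
      have e1 := H.v_lt (show j < n - 1 by omega) (show n - 1 < n + 1 by omega) (le_refl m)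
      have e2 := hexit (n - 1) (by omega)
      omega
    subst hjn
    refine ⟨by omega, ?_⟩
    by_contra hc
    have e1 := H.v_mono hi.le le_rfl (show n - 1 < n + 1 by omega)
    obtain ⟨k, k0, k1, k2, k3, k4, k5⟩ := H.exists_one hi.le le_rfl
      (show n - 1 < n + 1 by omega) (q := v 0 n - 1) (by omega) (by omega)
    rw [Nat.sub_add_cancel (by omega)] at k4
    have := (H.h_lt_iff k1 hi (show n ≤ n + 1 by omega)).1 (by omega)
    omega

/-- If both neighbouring labels are one less, the type of the south-western box is recorded by
the carry. -/
theorem southWest (H : IsLabelling m (n + 1) h v) {i : ℕ} (hi : i < m) (heq : h i n = v 0 n)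
    (hs : labelCarry m n v (v 0 n) = 0) (hw : 0 < i ∧ h (i - 1) n = h i n - 1)
    (hso : 0 < n ∧ v i (n - 1) = v 0 n - 1) :
    (IsZeroBox h v (i - 1) (n - 1) ∧ labelCarry m n v (v 0 n - 1) = 0) ∨
    (IsOneBox h v (i - 1) (n - 1) ∧ labelCarry m n v (v 0 n - 1) ≠ 0) := by
  obtain ⟨i, rfl⟩ : ∃ k, i = k + 1 := ⟨i - 1, by omega⟩
  obtain ⟨n, rfl⟩ : ∃ k, n = k + 1 := ⟨n - 1, by omega⟩
  simp only [Nat.add_sub_cancel] at hw hso ⊢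
  have hexit : ∀ j < n + 1, v m j < v 0 (n + 1) := by
    intro j hj
    by_contra hc
    have := labelCarry_pos.2 ⟨j, hj, H.v_lt hj (Nat.lt_add_one _) (Nat.zero_le m), not_lt.1 hc⟩
    omega
  rcases H.box i (by omega) n (by omega) with ⟨h1, h2, h3 | h3⟩ | ⟨h1, h2, h3⟩
  · refine Or.inl ⟨⟨h1, h3, by omega⟩, ?_⟩
    have e0 : v 0 n = v i n := by
      by_contra hc
      have e1 := H.v_mono (Nat.zero_le i) (by omega) (show n < n + 1 + 1 by omega)
      obtain ⟨k, k0, k1, k2, k3, k4, k5⟩ := H.exists_one (Nat.zero_le i) (by omega)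
        (show n < n + 1 + 1 by omega) (q := v i n) (by omega) le_rfl
      have := H.h_inj (i := k) (i' := i) (by omega) (by omega)
        (show n + 1 ≤ n + 1 + 1 by omega) (by omega)
      omega
    by_contra hc
    obtain ⟨j, hj, j1, j2⟩ := labelCarry_pos.1 (Nat.pos_of_ne_zero hc)
    have := hexit n (by omega)
    rcases Nat.lt_succ_iff_lt_or_eq.1 hj with h4 | rfl
    · have := H.v_lt h4 (by omega) (le_refl m)
      omega
    · omega
  · refine Or.inr ⟨⟨h1, h3, by omega⟩, ?_⟩
    have e1 := H.v_mono (Nat.zero_le i) (by omega) (show n < n + 1 + 1 by omega)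
    have e2 := H.v_mono (i := i + 1) (i' := m) hi.le le_rfl (show n < n + 1 + 1 by omega)
    have := labelCarry_pos.2 ⟨n, Nat.lt_add_one n, show v 0 n < v 0 (n + 1) - 1 by omega,
      show v 0 (n + 1) - 1 ≤ v m n by omega⟩
    exact this.ne'
  · omega

end IsLabelling

theorem IsAdmissible.colCount_h {N m n : ℕ} {lam mu nu rho : Fin N → ℤ}
    {L : ℕ → ℕ → Fin N → ℤ} {h v : ℕ → ℕ → ℤ} (H : IsAdmissible m n lam mu nu rho L h v)
    {i j : ℕ} (hi : i ≤ m) (hj : j ≤ n) (q : ℤ) :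
    colCount (L i j) q = colCount (L 0 j) q + hCount i h j q := by
  induction i with
  | zero => simp [hCount]
  | succ i ih =>
    rw [(H.moves_h i hi j hj).colCount, ih (by omega), hCount, hCount, Finset.sum_range_succ,
      add_assoc]

theorem IsAdmissible.colCount_v {N m n : ℕ} {lam mu nu rho : Fin N → ℤ}
    {L : ℕ → ℕ → Fin N → ℤ} {h v : ℕ → ℕ → ℤ} (H : IsAdmissible m n lam mu nu rho L h v)
    {i j : ℕ} (hi : i ≤ m) (hj : j ≤ n) (q : ℤ) :
    colCount (L i j) q = colCount (L i 0) q + vCount j v i q := by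
  induction j with
  | zero => simp [vCount]
  | succ j ih =>
    rw [(H.moves_v i hi j hj).colCount, ih (by omega), vCount, vCount, Finset.sum_range_succ,
      add_assoc]

/-- The weight of the first nontrivial box of a row is the weight of the column of the entrance of
that row. All later nontrivial boxes of the row continue a run of one-boxes and have weight `1`. -/
theorem IsAdmissible.boxWeight_head {N m n : ℕ} (t : ℝ) {lam mu nu rho : Fin N → ℤ}
    {L : ℕ → ℕ → Fin N → ℤ} {h v : ℕ → ℕ → ℤ}
    (H : IsAdmissible m (n + 1) lam mu nu rho L h v) {i : ℕ} (hi : i < m) (heq : h i n = v 0 n) :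
    boxWeight t L h v i n = labelWt t m (n + 1) lam h v (v 0 n) := by
  have G := H.isLabelling
  have hv := G.v_eq_head hi (Nat.lt_add_one n) heq
  have hb := G.vCount_succ_head
  obtain ⟨p1, p2, -, p4⟩ := G.counts_succ_of_lt (q := v 0 n - 1) (by omega)
  have hc := G.carryStep (v 0 n)
  have hc' := G.restrict.carryStep (v 0 n)
  have hsou := G.south_isOneBox_iff hi heq
  have hnw := G.not_west_isOneBox hi (Nat.lt_add_one n) heq
  have hwest := G.west_iff hi n.le_succ
  have hs1 := G.hCount_succ (Nat.lt_add_one n) (v 0 n)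
  have hle := G.hCount_le le_rfl (v 0 n)
  have hle' := G.vCount_le le_rfl (v 0 n)
  have hle0 := G.hCount_le (Nat.zero_le _) (v 0 n)
  -- `v 0 n` is among the labels just below the row
  have hold : hCount m h n (v 0 n) = 1 := by
    have h1 := hCount_pos.2 ⟨i, hi, heq.symm⟩
    have h2 := G.hCount_le n.le_succ (v 0 n)
    omega
  have hstep := G.v_step hi (Nat.lt_add_one n)
  have hmono := G.v_mono (i := i + 1) (i' := m) hi le_rfl (Nat.lt_add_one n)
  -- the type of the box is the output in the column
  have hone : IsOneBox h v i n → hCount m h (n + 1) (v 0 n) = 0 := by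
    rintro ⟨-, h1, h2⟩
    rw [if_pos rfl, if_neg (by omega)] at hs1
    omega
  have hzero : IsZeroBox h v i n → hCount m h (n + 1) (v 0 n) = 1 := by
    rintro ⟨-, h1, h2⟩
    have := hCount_pos.2 ⟨i, hi, show v 0 n = h i (n + 1) by omega⟩
    omega
  have htype := G.isOneBox_or_isZeroBox hi (Nat.lt_add_one n) (heq.trans hv.symm)
  have hexcl : IsOneBox h v i n → ¬ IsZeroBox h v i n := fun h1 h2 => by
    have := hone h1; have := hzero h2; omega
  rw [labelWt, IsLabelling.labelCarry_succ_head, hb.2, p1, p2, p4]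
  rw [IsLabelling.labelCarry_succ_head, hb.2] at hc
  rw [hb.1] at hc'
  by_cases hs : labelCarry m n v (v 0 n) = 0
  -- nothing is carried into the column: the southern neighbour is no one-box, and a decision is
  -- made
  · have ha : hCount m h 0 (v 0 n) = 1 := by
      have := hc'.1
      omega
    have hsouth := G.south_iff hi heq hs
    have hsw := G.southWest hi heq hs
    rw [heq] at hwest hsw
    rw [ha, hs, colWt_choice]
    simp only [boxWeight]
    rw [if_neg (c := _ ∨ _) 
      (fun hx => hx.elim hnw fun hx => (hsou.1 hx).ne' hs), heq]
    set WB : Prop := 0 < i ∧ h (i - 1) n = v 0 n - 1 with hWB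
    set SB : Prop := 0 < n ∧ v i (n - 1) = v 0 n - 1 with hSB
    simp only [← hwest, ← hsouth]
    -- a nontrivial south-western box with the right label forces both neighbouring labels
    have himpZ : (0 < i ∧ 0 < n ∧ IsZeroBox h v (i - 1) (n - 1) ∧ h (i - 1) n = v 0 n - 1) →
        WB ∧ SB := by
      rintro ⟨i0, n0, ⟨h1, h2, h3⟩, h4⟩
      rw [Nat.sub_add_cancel i0] at h3
      rw [Nat.sub_add_cancel n0] at h2
      exact ⟨⟨i0, h4⟩, n0, by omega⟩
    have himpO : (0 < i ∧ 0 < n ∧ IsOneBox h v (i - 1) (n - 1) ∧ h (i - 1) n = v 0 n - 1) →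
        WB ∧ SB := by
      rintro ⟨i0, n0, ⟨h1, h2, h3⟩, h4⟩
      rw [Nat.sub_add_cancel i0] at h3
      rw [Nat.sub_add_cancel n0] at h2
      exact ⟨⟨i0, h4⟩, n0, by omega⟩
    by_cases hboth : WB ∧ SB
    · rw [if_pos hboth]
      have hw := hboth.1
      have hso := hboth.2
      rcases hsw hw hso with ⟨z1, z2⟩ | ⟨z1, z2⟩
      · have hno : ¬ (0 < i ∧ 0 < n ∧ IsOneBox h v (i - 1) (n - 1) ∧ h (i - 1) n = v 0 n - 1) :=
          fun hx => by
            have := hx.2.2.1.2.1; have := z1.2.1; omega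
        have hyes : 0 < i ∧ 0 < n ∧ IsZeroBox h v (i - 1) (n - 1) ∧ h (i - 1) n = v 0 n - 1 :=
          ⟨hw.1, hso.1, z1, hw.2⟩
        rcases htype with hty | hty
        · rw [if_pos hty, if_neg hno, if_pos hyes, hone hty]
          simp [z2]
        · rw [if_neg (fun hx => hexcl hx hty), if_pos hty, if_pos hyes, hzero hty]
          simp [z2]
      · have hno : ¬ (0 < i ∧ 0 < n ∧ IsZeroBox h v (i - 1) (n - 1) ∧ h (i - 1) n = v 0 n - 1) :=
          fun hx => by
            have := hx.2.2.1.2.1; have := z1.2.1; omega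
        have hyes : 0 < i ∧ 0 < n ∧ IsOneBox h v (i - 1) (n - 1) ∧ h (i - 1) n = v 0 n - 1 :=
          ⟨hw.1, hso.1, z1, hw.2⟩
        rcases htype with hty | hty
        · rw [if_pos hty, if_pos hyes, hone hty]
          simp [z2]
        · rw [if_neg (fun hx => hexcl hx hty), if_pos hty, if_neg hno, if_pos hyes, hzero hty]
          simp [z2]
    · rw [if_neg hboth]
      have hO := fun hx => hboth (himpO hx)
      have hZ := fun hx => hboth (himpZ hx)
      by_cases hxor : WB ∨ SB
      · have hx : Xor WB SB := by
          rw [xor_iff_or_and_not_and]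
          exact ⟨hxor, hboth⟩
        rw [if_pos hxor]
        rcases htype with hty | hty
        · rw [if_pos hty, if_neg hO, if_neg hZ, if_pos hx, hone hty]
          simp
        · rw [if_neg (fun hx => hexcl hx hty), if_pos hty, if_neg hZ, if_neg hO,
            if_pos hx, hzero hty]
          simp
      · have hx : ¬ Xor WB SB := by
          rw [xor_iff_or_and_not_and]
          exact fun hx => hxor hx.1
        rw [if_neg hxor]
        -- no box was moved to or from this position on the way from `lam` to `L i n`
        have hmult : multAt (L i n) (v 0 n) = multAt lam (v 0 n) := by
          have c1 := colCount_pred_eq (L i n) (v 0 n)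
          have c2 := colCount_pred_eq lam (v 0 n)
          have e1 := fun q => H.colCount_h hi.le n.le_succ q
          have e2 := fun q => H.colCount_v (Nat.zero_le m) n.le_succ q
          rw [e1, e1, e2, e2, H.sw] at c1
          have z1 : hCount i h n (v 0 n) = 0 := by
            by_contra hc
            obtain ⟨k, hk, hk'⟩ := hCount_pos.1 (Nat.pos_of_ne_zero hc)
            have := G.h_lt hk hi n.le_succ
            omega
          have z2 : hCount m h n (v 0 n - 1) = 0 := by
            have := G.hCount_le n.le_succ (v 0 n - 1)
            have : hCount m h n (v 0 n - 1) ≠ 1 := fun hx => hxor (Or.inl (hwest.2 hx))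
            omega
          have z3 : vCount n v m (v 0 n - 1) = 0 := by
            have := G.restrict.vCount_le le_rfl (v 0 n - 1)
            have : vCount n v m (v 0 n - 1) ≠ 1 := fun hx => hxor (Or.inr (hsouth.2 hx))
            omega
          have z4 := G.restrict.carryStep (v 0 n - 1)
          rw [z2, z3, sub_add_cancel, hs] at z4
          have z5 : hCount i h n (v 0 n - 1) = 0 := by
            by_contra hc
            obtain ⟨k, hk, hk'⟩ := hCount_pos.1 (Nat.pos_of_ne_zero hc)
            have := hCount_pos.2 ⟨k, hk.trans hi, hk'⟩
            omega
          have := z4.2.1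
          omega
        rw [hmult]
        rcases htype with hty | hty
        · rw [if_pos hty, if_neg hO, if_neg hZ, if_neg hx, hone hty]
          simp
        · rw [if_neg (fun hx => hexcl hx hty), if_pos hty, if_neg hZ, if_neg hO,
            if_neg hx, hzero hty]
          simp
  -- otherwise the box continues a run of one-boxes from the south
  · have hty : IsOneBox h v i n := by
      rcases htype with hty | hty
      · exact hty
      · have := hzero hty
        rw [this] at hc
        obtain ⟨x1, x2, x3⟩ := hc
        have : 0 < labelCarry m n v (v 0 n) := Nat.pos_of_ne_zero hs
        omega
    rw [colWt_eq_one (fun hx => hs hx.2.2)]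
    simp only [boxWeight]
    rw [if_pos hty, if_pos (Or.inr (hsou.2 (Nat.pos_of_ne_zero hs)))]

theorem IsAdmissible.prod_boxWeight_row {N m n : ℕ} (t : ℝ) {lam mu nu rho : Fin N → ℤ}
    {L : ℕ → ℕ → Fin N → ℤ} {h v : ℕ → ℕ → ℤ}
    (H : IsAdmissible m (n + 1) lam mu nu rho L h v) :
    ∏ i ∈ Finset.range m, boxWeight t L h v i n = labelWt t m (n + 1) lam h v (v 0 n) := by
  have G := H.isLabelling
  by_cases hex : ∃ i < m, h i n = v 0 n
  · obtain ⟨i, hi, heq⟩ := hex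
    rw [← H.boxWeight_head t hi heq]
    refine Finset.prod_eq_single i (fun k hk hki => ?_)
      (fun hc => absurd (Finset.mem_range.2 hi) hc)
    exact G.boxWeight_of_ne_head t L (Finset.mem_range.1 hk) (Nat.lt_add_one n)
      (fun hx => hki (G.h_inj (Finset.mem_range.1 hk) hi n.le_succ (hx.trans heq.symm)))
  -- a row whose entrance is not among the labels below consists of trivial boxes
  · rw [Finset.prod_eq_one fun i hi => G.boxWeight_of_ne_head t L (Finset.mem_range.1 hi)
      (Nat.lt_add_one n) fun hx => hex ⟨i, Finset.mem_range.1 hi, hx⟩]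
    have h0 : hCount m h n (v 0 n) = 0 := by
      by_contra hc
      obtain ⟨k, hk, hk'⟩ := hCount_pos.1 (Nat.pos_of_ne_zero hc)
      exact hex ⟨k, hk, hk'.symm⟩
    have hc := G.restrict.carryStep (v 0 n)
    rw [h0, G.vCount_succ_head.1] at hc
    rw [labelWt, colWt_eq_one]
    obtain ⟨x1, x2, -⟩ := hc
    omega

theorem IsAdmissible.restrict {N m n : ℕ} {lam mu nu rho : Fin N → ℤ}
    {L : ℕ → ℕ → Fin N → ℤ} {h v : ℕ → ℕ → ℤ} (H : IsAdmissible m (n + 1) lam mu nu rho L h v) :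
    IsAdmissible m n lam (L 0 n) nu (L m n) L h v where
  antitone i hi j hj := H.antitone i hi j (by omega)
  sw := H.sw
  se := H.se
  nw := rfl
  ne := rfl
  moves_h i hi j hj := H.moves_h i hi j (by omega)
  moves_v i hi j hj := H.moves_v i hi j (by omega)
  lt_h i hi j hj := H.lt_h i hi j (by omega)
  lt_v i hi j hj := H.lt_v i hi j (by omega)
  box i hi j hj := H.box i hi j (by omega)

/-- The product of the box weights of an admissible function is a product over columns. -/
theorem IsAdmissible.prod_boxWeight {N m n : ℕ} (t : ℝ) {lam mu nu rho : Fin N → ℤ}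
    {L : ℕ → ℕ → Fin N → ℤ} {h v : ℕ → ℕ → ℤ} (H : IsAdmissible m n lam mu nu rho L h v) :
    ∏ i ∈ Finset.range m, ∏ j ∈ Finset.range n, boxWeight t L h v i j =
      ∏ j ∈ Finset.range n, labelWt t m n lam h v (v 0 j) := by
  rw [Finset.prod_comm]
  induction n generalizing mu rho with
  | zero => simp
  | succ n ih =>
    have G := H.isLabelling
    rw [Finset.prod_range_succ, Finset.prod_range_succ, ih H.restrict, H.prod_boxWeight_row]
    congr 1
    apply Finset.prod_congr rfl
    intro j hj
    have hlt := G.v_lt (Finset.mem_range.1 hj) (Nat.lt_add_one n) (Nat.zero_le m)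
    obtain ⟨p1, p2, p3, p4⟩ := G.counts_succ_of_lt hlt
    obtain ⟨q1, q2, q3, q4⟩ := G.counts_succ_of_lt (q := v 0 j - 1) (by omega)
    simp only [labelWt]
    rw [p1, p3, p4, q1, q2, q4]

/-! ### Existence of admissible functions -/

theorem hCount_self_pos {m i j : ℕ} {h : ℕ → ℕ → ℤ} (hi : i < m) : 0 < hCount m h j (h i j) :=
  hCount_pos.2 ⟨i, hi, rfl⟩

theorem vCount_self_pos {n i j : ℕ} {v : ℕ → ℕ → ℤ} (hj : j < n) : 0 < vCount n v i (v i j) :=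
  vCount_pos.2 ⟨j, hj, rfl⟩

theorem exists_colCount_bounds {N : ℕ} (κ : Fin N → ℤ) :
    ∃ B : ℤ, (∀ q, B ≤ q → colCount κ q = 0) ∧ ∀ q, q ≤ -B → colCount κ q = N := by
  have hle : ∀ c, |κ c| ≤ ∑ c, |κ c| := fun c =>
    Finset.single_le_sum (f := fun c => |κ c|) (fun _ _ => abs_nonneg _) (Finset.mem_univ c)
  refine ⟨∑ c, |κ c| + 1, fun q hq => ?_, fun q hq => ?_⟩
  · rw [colCount, Finset.card_eq_zero, Finset.filter_eq_empty_iff]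
    intro c _
    have := hle c
    have := le_abs_self (κ c)
    omega
  · rw [colCount, Finset.filter_true_of_mem, Finset.card_univ, Fintype.card_fin]
    intro c _
    have := hle c
    have := neg_abs_le (κ c)
    omega

/-- Adding the boxes of a horizontal strip from left to right: an admissible function on a rectangle
of height zero. -/
theorem exists_chain {N : ℕ} {lam : Fin N → ℤ} (hlam : Antitone lam) (S : Finset ℤ) :
    ∀ {nu : Fin N → ℤ}, Antitone nu →
      (∀ q, colCount nu q = colCount lam q + if q ∈ S then 1 else 0) →
      ∃ m L h v, IsAdmissible m 0 lam lam nu nu L h v := by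
  induction S using Finset.induction_on_max with
  | empty =>
    intro nu hnu hcol
    have : nu = lam := eq_of_colCount_eq hnu hlam fun q => by simp [hcol]
    subst this
    refine ⟨0, fun _ _ => nu, fun _ _ => 0, fun _ _ => 0, ?_⟩
    constructor <;> intros <;> first | rfl | assumption | omega
  | insert x S hmax ih =>
    intro nu hnu hcol
    have hxS : x ∉ S := fun hx => lt_irrefl _ (hmax x hx)
    have h1 := hcol x
    have h2 := hcol (x + 1)
    have h3 := colCount_anti lam (show x ≤ x + 1 by omega)
    rw [if_pos (Finset.mem_insert_self x S)] at h1
    rw [if_neg (by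
      rw [Finset.mem_insert]
      rintro (hx | hx)
      · omega
      · have := hmax _ hx; omega)] at h2
    -- remove the box in the last column
    obtain ⟨nu', hnu', hmv⟩ := exists_movesBy_to hnu (p := x) (by omega)
    have hcol' : ∀ q, colCount nu' q = colCount lam q + if q ∈ S then 1 else 0 := by
      intro q
      have e1 := hcol q
      have e2 := hmv.colCount q
      simp only [Finset.mem_insert] at e1
      by_cases hq : q = x
      · subst hq
        rw [if_pos rfl] at e2
        rw [if_pos (Or.inl rfl)] at e1
        rw [if_neg hxS]
        omega
      · simp only [hq, false_or, if_false] at e1 e2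
        omega
    obtain ⟨m, L, h, v, H⟩ := ih hnu' hcol'
    have hS : ∀ i < m, h i 0 < x := by
      intro i hi
      apply hmax
      have e1 := H.colCount_h le_rfl le_rfl (h i 0)
      rw [H.se, H.sw, hcol'] at e1
      have e2 := hCount_self_pos (h := h) (j := 0) hi
      by_contra hc
      rw [if_neg hc] at e1
      omega
    refine ⟨m + 1, fun i j => if i ≤ m then L i j else nu, fun i j => if i < m then h i j else x,
      v, ?_⟩
    constructor
    · intro i hi j hj
      split_ifs with him
      · exact H.antitone i him j hj
      · exact hnu
    · simpa using H.sw
    · simp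
    · simpa using H.nw
    · simp
    · intro i hi j hj
      obtain rfl : j = 0 := by omega
      by_cases him : i < m
      · rw [if_pos him.le, if_pos (show i + 1 ≤ m by omega), if_pos him]
        exact H.moves_h i him 0 hj
      · obtain rfl : i = m := by omega
        rw [if_pos le_rfl, if_neg (by omega), if_neg him, H.se]
        exact hmv
    · intro i _ j hj
      omega
    · intro i hi j hj
      obtain rfl : j = 0 := by omega
      rw [if_pos (show i < m by omega)]
      split_ifs with him
      · exact H.lt_h i him 0 hj
      · exact hS i (by omega)
    · intro i _ j hj
      omega
    · intro i _ j hj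
      omega

/-- The vertical labels of a new row on top of a line with labels `h`, for a row with entrance `x`
and exit `e`. -/
def rowLabel (x e : ℤ) (h : ℕ → ℤ) : ℕ → ℤ
  | 0 => x
  | i + 1 => max x (min e (h i + 1))

theorem rowLabel_spec {m : ℕ} {x e : ℤ} {h : ℕ → ℤ} (hxe : x ≤ e)
    (hh : ∀ i i', i < m → i' < m → (h i < h i' ↔ i < i'))
    (hrun : ∀ q, x ≤ q → q < e → ∃ i < m, q = h i) :
    (∀ i < m, (h i = rowLabel x e h i ∧
        (rowLabel x e h (i + 1) = h i ∨ rowLabel x e h (i + 1) = h i + 1)) ∨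
      (h i ≠ rowLabel x e h i ∧ rowLabel x e h (i + 1) = rowLabel x e h i)) ∧
    rowLabel x e h m = e := by
  constructor
  · intro i hi
    by_cases heq : h i = rowLabel x e h i
    · refine Or.inl ⟨heq, ?_⟩
      cases i with
      | zero => simp only [rowLabel] at heq ⊢; omega
      | succ i => simp only [rowLabel] at heq ⊢; omega
    · refine Or.inr ⟨heq, ?_⟩
      cases i with
      | zero =>
        simp only [rowLabel] at heq ⊢
        by_cases hx : x < e
        · obtain ⟨k, hk, hk'⟩ := hrun x le_rfl hx
          have := hh k 0 hk hi
          omega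
        · omega
      | succ i =>
        simp only [rowLabel] at heq ⊢
        have hlt := (hh i (i + 1) (by omega) hi).2 (by omega)
        -- an occupied column directly after `max x (h i + 1)` would lie between two neighbours
        by_cases hx : max x (h i + 1) < e
        · obtain ⟨k, hk, hk'⟩ := hrun _ (le_max_left _ _) hx
          have := hh i k (by omega) hk
          have := hh k (i + 1) hk hi
          omega
        · omega
  · cases m with
    | zero =>
      simp only [rowLabel]
      by_contra hc
      obtain ⟨k, hk, -⟩ := hrun x le_rfl (by omega)
      omega
    | succ m =>
      simp only [rowLabel]
      by_cases hx : x < e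
      · obtain ⟨k, hk, hk'⟩ := hrun (e - 1) (by omega) (by omega)
        have := hh m k (by omega) hk
        omega
      · omega

/-- Adding a row to an admissible function: the row enters at `x` and exits at `e`, beyond all
earlier entrances and exits. Between the two all columns have to be occupied on the line below,
and `e` has to be free, unless the label is constant. -/
theorem IsAdmissible.exists_succ {N m n : ℕ} {lam mu' nu rho' : Fin N → ℤ}
    {L : ℕ → ℕ → Fin N → ℤ} {h v : ℕ → ℕ → ℤ} (H : IsAdmissible m n lam mu' nu rho' L h v)
    {mu rho : Fin N → ℤ} (hmu : Antitone mu) (hrho : Antitone rho) {x e : ℤ} (hxe : x ≤ e)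
    (hcmu : ∀ q, colCount mu q = colCount mu' q + if q = x then 1 else 0)
    (hcrho : ∀ q, colCount rho q = colCount rho' q + if q = e then 1 else 0)
    (hx : ∀ j < n, v 0 j < x) (he : ∀ j < n, v m j < e)
    (hrun : ∀ q, x ≤ q → q < e → ∃ i < m, q = h i n) (hgap : x < e → ∀ i < m, h i n ≠ e) :
    ∃ L' h' v', IsAdmissible m (n + 1) lam mu nu rho L' h' v' := by
  have G := H.isLabelling
  obtain ⟨w1, w2⟩ := rowLabel_spec (m := m) (h := fun i => h i n) hxe
    (fun i i' hi hi' => G.h_lt_iff hi hi' le_rfl) hrun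
  set w := rowLabel x e fun i => h i n with hw
  have w0 : w 0 = x := rfl
  have wsucc : ∀ i, w (i + 1) = max x (min e (h i n + 1)) := fun _ => rfl
  have hLanti : ∀ i ≤ m, Antitone (L i n) := fun i hi => H.antitone i hi n le_rfl
  -- the particle needed for the vertical move exists at each vertex of the line
  have hmove : ∀ i ≤ m, colCount (L i n) (w i) < colCount (L i n) (w i - 1) := by
    intro i hi
    -- before the first raise the particle is the one that moves from `mu'` to `mu`
    have hbottom : w i = x → (∀ k < i, h k n < x) →
        colCount (L i n) (w i) < colCount (L i n) (w i - 1) := by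
      intro hwx hk
      rw [hwx, H.colCount_h hi le_rfl, H.colCount_h hi le_rfl, H.nw]
      have e1 := hcmu x
      have e2 := hcmu (x - 1)
      have e3 := colCount_anti mu (show x - 1 ≤ x by omega)
      rw [if_pos rfl] at e1
      rw [if_neg (by omega)] at e2
      have : hCount i h n x = 0 := by
        by_contra hc
        obtain ⟨k, k1, k2⟩ := hCount_pos.1 (Nat.pos_of_ne_zero hc)
        have := hk k k1
        omega
      omega
    cases i with
    | zero => exact hbottom w0 (fun k hk => by omega)
    | succ i =>
      by_cases hix : h i n < x
      · refine hbottom (by rw [wsucc]; omega) fun k hk => ?_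
        rcases Nat.lt_succ_iff_lt_or_eq.1 hk with hk | rfl
        · exact (G.h_lt hk (by omega) le_rfl).trans hix
        · exact hix
      · by_cases hie : h i n < e
        -- in between it is the particle that has just been moved horizontally
        · have hwi : w (i + 1) = h i n + 1 := by rw [wsucc]; omega
          have e1 := (H.moves_h i hi n le_rfl).colCount (h i n)
          have e2 := (H.moves_h i hi n le_rfl).colCount (h i n + 1)
          have e3 := colCount_anti (L i n) (show h i n ≤ h i n + 1 by omega)
          rw [if_pos rfl] at e1
          rw [if_neg (by omega)] at e2
          rw [hwi, add_sub_cancel_right]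
          omega
        -- after the last raise it is the one that moves from `rho'` to `rho`
        · have hwi : w (i + 1) = e := by rw [wsucc]; omega
          have e1 := hcrho e
          have e2 := hcrho (e - 1)
          have e3 := colCount_anti rho (show e - 1 ≤ e by omega)
          rw [if_pos rfl] at e1
          rw [if_neg (by omega)] at e2
          rw [← H.ne, H.colCount_h le_rfl le_rfl] at e1 e2
          rw [hwi, H.colCount_h hi le_rfl, H.colCount_h hi le_rfl]
          have e4 : hCount (i + 1) h n e ≤ hCount m h n e :=
            Finset.sum_le_sum_of_subset (Finset.range_subset_range.2 hi)
          have e5 : hCount m h n (e - 1) ≤ hCount (i + 1) h n (e - 1) := by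
            rw [hCount, hCount]
            refine (Finset.sum_subset (Finset.range_subset_range.2 hi) fun k k1 k2 => ?_).ge
            rw [Finset.mem_range] at k1 k2
            have := G.h_lt (show i < k by omega) k1 le_rfl
            rw [if_neg (by omega)]
          omega
  choose! T hT using fun i (hi : i ≤ m) => exists_movesBy (hLanti i hi) (hmove i hi)
  have hT0 : T 0 = mu := eq_of_colCount_eq (hT 0 (Nat.zero_le _)).1 hmu fun q => by
    rw [(hT 0 (Nat.zero_le _)).2.colCount, H.nw, hcmu, w0]
  have hTm : T m = rho := eq_of_colCount_eq (hT m le_rfl).1 hrho fun q => by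
    rw [(hT m le_rfl).2.colCount, H.ne, hcrho, w2]
  refine ⟨fun i j => if j ≤ n then L i j else T i,
    fun i j => if j ≤ n then h i j else if h i n = w i then w (i + 1) else h i n,
    fun i j => if j < n then v i j else w i, ?_⟩
  constructor
  · intro i hi j hj
    split_ifs with hjn
    · exact H.antitone i hi j hjn
    · exact (hT i hi).1
  · simpa using H.sw
  · simpa using H.se
  · simpa using hT0
  · simpa using hTm
  · intro i hi j hj
    by_cases hjn : j ≤ n
    · rw [if_pos hjn, if_pos hjn, if_pos hjn]
      exact H.moves_h i hi j hjn
    · rw [if_neg hjn, if_neg hjn, if_neg hjn]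
      refine movesBy_of_colCount (hT i hi.le).1 (hT (i + 1) hi).1 fun q => ?_
      rw [(hT i hi.le).2.colCount, (hT (i + 1) hi).2.colCount, (H.moves_h i hi n le_rfl).colCount]
      rcases w1 i hi with ⟨k1, -⟩ | ⟨k1, k2⟩
      · rw [if_pos k1, k1]
      · rw [if_neg k1, k2]
        omega
  · intro i hi j hj
    by_cases hjn : j < n
    · rw [if_pos hjn.le, if_pos (show j + 1 ≤ n by omega), if_pos hjn]
      exact H.moves_v i hi j hjn
    · obtain rfl : j = n := by omega
      rw [if_pos le_rfl, if_neg (by omega), if_neg hjn]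
      exact (hT i hi).2
  · intro i hi j hj
    by_cases hjn : j ≤ n
    · rw [if_pos hjn, if_pos hjn]
      exact H.lt_h i hi j hjn
    · rw [if_neg hjn, if_neg hjn]
      have hlt := G.lt_h i hi n le_rfl
      have k1 := w1 i (by omega)
      have k2 := w1 (i + 1) hi
      have k3 := wsucc i
      have k5 := wsucc (i + 1)
      have k6 : x ≤ w i := by
        cases i with
        | zero => exact w0.ge
        | succ i => rw [wsucc]; exact le_max_left _ _
      have k4 : x < e → h (i + 1) n ≠ e := fun hxe => hgap hxe (i + 1) hi
      split_ifs with hc1 hc2 hc2 <;> omega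
  · intro i hi j hj
    rw [if_pos (show j < n by omega)]
    by_cases hjn : j + 1 < n
    · rw [if_pos hjn]
      exact H.lt_v i hi j hjn
    · rw [if_neg hjn]
      obtain rfl : n = j + 1 := by omega
      have hx0 := hx j (by omega)
      have hem := he j (by omega)
      have hvm := G.v_mono hi le_rfl (show j < j + 1 by omega)
      -- the vertical label of the previous row is its entrance or at most the label above it
      have key : ∀ k, k < m → v (k + 1) j = v 0 j ∨ v (k + 1) j ≤ h k (j + 1) := by
        intro k
        induction k with
        | zero =>
          intro hk
          rcases G.box 0 hk j (by omega) with hb | hb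
          · right; exact hb.2.1.ge
          · left; exact hb.2.2
        | succ k ih =>
          intro hk
          rcases G.box (k + 1) hk j (by omega) with hb | hb
          · right; exact hb.2.1.ge
          · have := G.lt_h k hk (j + 1) le_rfl
            rcases ih (by omega) with h1 | h1
            · left; omega
            · right; omega
      cases i with
      | zero => rw [w0]; exact hx0
      | succ i =>
        rw [wsucc]
        rcases key i hi with h1 | h1 <;> omega
  · intro i hi j hj
    by_cases hjn : j < n
    · rw [if_pos hjn.le, if_pos hjn, if_pos (show j + 1 ≤ n by omega), if_pos hjn]
      exact H.box i hi j hjn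
    · obtain rfl : j = n := by omega
      rw [if_pos le_rfl, if_neg hjn, if_neg (by omega), if_neg hjn]
      intro heq
      rw [if_pos heq]
      rcases w1 i hi with k | k
      · exact ⟨rfl, k.2⟩
      · exact absurd heq k.1

/-- An abstract run of the column-by-column algorithm on signatures of length `N`, with nothing
carried in from `-∞` and nothing carried out to `∞`. -/
structure IsCarryRun {N : ℕ} (lam mu nu rho : Fin N → ℤ) (a b a' b' s : ℤ → ℕ) : Prop where
  nu_eq : ∀ q, colCount nu q = colCount lam q + a q
  mu_eq : ∀ q, colCount mu q = colCount lam q + b q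
  rho_eq : ∀ q, colCount rho q = colCount mu q + a' q
  rho_eq' : ∀ q, colCount rho q = colCount nu q + b' q
  a_le : ∀ q, a q ≤ 1
  b_le : ∀ q, b q ≤ 1
  a'_le : ∀ q, a' q ≤ 1
  b'_le : ∀ q, b' q ≤ 1
  step : ∀ q, CarryStep (s q) (a q) (b q) (a' q) (b' q) (s (q + 1))
  bot : ∃ B, ∀ q ≤ B, s q = 0
  top : ∃ B, ∀ q, B ≤ q → s q = 0

namespace IsCarryRun

variable {N : ℕ} {lam mu nu rho : Fin N → ℤ} {a b a' b' s : ℤ → ℕ}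

theorem exists_finset {f : ℤ → ℕ} (hf : ∀ q, f q ≤ 1) {κ κ' : Fin N → ℤ}
    (h : ∀ q, colCount κ' q = colCount κ q + f q) :
    ∃ S : Finset ℤ, ∀ q, f q = if q ∈ S then 1 else 0 := by
  obtain ⟨B, -, h1⟩ := exists_colCount_bounds κ
  obtain ⟨B', h2, -⟩ := exists_colCount_bounds κ'
  refine ⟨(Finset.Icc (-B) B').filter fun q => f q = 1, fun q => ?_⟩
  have e1 := h q
  have e2 := hf q
  have e3 := colCount_le κ' q
  have e4 := h1 q
  have e5 := h2 q
  simp only [Finset.mem_filter, Finset.mem_Icc]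
  split_ifs with hc <;> omega

theorem zero_of_ge (R : IsCarryRun lam mu nu rho a b a' b' s) {x : ℤ}
    (hx : ∀ q, x ≤ q → b q = 0 ∧ b' q = 0) {q : ℤ} (hq : x ≤ q) : s q = 0 := by
  obtain ⟨B, hB⟩ := R.top
  by_cases hqB : B ≤ q
  · exact hB q hqB
  suffices ∀ k : ℕ, s q = s (q + k) by
    rw [this (B - q).toNat]
    exact hB _ (by omega)
  intro k
  induction k with
  | zero => simp
  | succ k ih =>
    have h1 := (R.step (q + k)).2.1
    have h2 := hx (q + k) (by omega)
    rw [ih, Nat.cast_succ, ← add_assoc]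
    omega

/-- A valid run of the column-by-column algorithm comes from an admissible function. By induction on
the number of boxes of `μ/λ`, the last of them is removed together with the last box of `ρ/ν`; all
columns in between then carry one pair less. -/
theorem exists_isAdmissible (hlam : Antitone lam) (hnu : Antitone nu) :
    ∀ (T : Finset ℤ) {mu rho : Fin N → ℤ} {b a' b' s : ℤ → ℕ}, Antitone mu → Antitone rho →
      IsCarryRun lam mu nu rho a b a' b' s → (∀ q, b q = if q ∈ T then 1 else 0) →
      ∃ m n L h v, IsAdmissible m n lam mu nu rho L h v := by
  intro T
  induction T using Finset.induction_on_max with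
  | empty =>
    intro mu rho b a' b' s hmu hrho R hb
    simp only [Finset.notMem_empty, if_false] at hb
    -- without entrances the carry decreases from zero
    have hs : ∀ q, s q = 0 := by
      obtain ⟨B, hB⟩ := R.bot
      intro q
      by_cases hqB : q ≤ B
      · exact hB q hqB
      suffices ∀ k : ℕ, s (B + k) = 0 by
        have := this (q - B).toNat
        rwa [show B + ((q - B).toNat : ℤ) = q by omega] at this
      intro k
      induction k with
      | zero => simpa using hB B le_rfl
      | succ k ih =>
        have h1 := (R.step (B + k)).2.1
        rw [hb, ih] at h1
        rw [Nat.cast_succ, ← add_assoc]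
        omega
    have hmul : mu = lam := eq_of_colCount_eq hmu hlam fun q => by rw [R.mu_eq, hb, add_zero]
    have hrhon : rho = nu := eq_of_colCount_eq hrho hnu fun q => by
      have h1 := (R.step q).2.1
      rw [hb, hs, hs] at h1
      rw [R.rho_eq']
      omega
    obtain ⟨S, hS⟩ := exists_finset R.a_le R.nu_eq
    obtain ⟨m, L, h, v, H⟩ := exists_chain hlam S hnu fun q => by rw [R.nu_eq, hS]
    exact ⟨m, 0, L, h, v, by rw [hmul, hrhon]; exact H⟩
  | insert x T hmax ih =>
    intro mu rho b a' b' s hmu hrho R hb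
    have hxT : x ∉ T := fun hx => lt_irrefl _ (hmax x hx)
    have hbx : b x = 1 := by rw [hb, if_pos (Finset.mem_insert_self x T)]
    have hbgt : ∀ q, x < q → b q = 0 := fun q hq => by
      rw [hb, if_neg]
      rw [Finset.mem_insert]
      rintro (h | h)
      · omega
      · have := hmax q h; omega
    -- the exit of the last row is the largest column of `ρ/ν`
    obtain ⟨e, he, hemax⟩ : ∃ e, b' e = 1 ∧ ∀ q, b' q = 1 → q ≤ e := by
      obtain ⟨S, hS⟩ := exists_finset R.b'_le R.rho_eq'
      have hmem : ∀ q, q ∈ S ↔ b' q = 1 := fun q => by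
        rw [hS]; split_ifs with h <;> simp [h]
      have hne : S.Nonempty := by
        by_contra hc
        rw [Finset.not_nonempty_iff_eq_empty] at hc
        have hb'0 : ∀ q, b' q = 0 := fun q => by rw [hS, hc]; simp
        have hsx := R.zero_of_ge (x := x + 1) (fun q hq => ⟨hbgt q (by omega), hb'0 q⟩) le_rfl
        have := (R.step x).2.1
        rw [hb'0, hsx, hbx] at this
        omega
      exact ⟨S.max' hne, (hmem _).1 (S.max'_mem hne), fun q hq => S.le_max' q ((hmem q).2 hq)⟩
    have hb'gt : ∀ q, e < q → b' q = 0 := fun q hq => by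
      have h1 := R.b'_le q
      have h2 := hemax q
      omega
    have hxe : x ≤ e := by
      by_contra hc
      have h1 := R.zero_of_ge (x := x + 1)
        (fun q hq => ⟨hbgt q (by omega), hb'gt q (by omega)⟩) le_rfl
      have h2 := (R.step x).2.1
      have h3 := hb'gt x (by omega)
      omega
    have hse : s (e + 1) = 0 := R.zero_of_ge (x := e + 1)
      (fun q hq => ⟨hbgt q (by omega), hb'gt q (by omega)⟩) le_rfl
    have hspos : ∀ q, x < q → q ≤ e → 0 < s q := by
      intro q hq hqe
      suffices ∀ k : ℕ, x < e - k → 0 < s (e - k) by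
        have := this (e - q).toNat
        rw [show e - ((e - q).toNat : ℤ) = q by omega] at this
        exact this hq
      intro k
      induction k with
      | zero =>
        intro hk
        have h1 := (R.step e).2.1
        rw [Nat.cast_zero, sub_zero] at hk ⊢
        have h2 := hbgt e hk
        omega
      | succ k ih =>
        intro hk
        rw [Nat.cast_succ] at hk ⊢
        have h0 := ih (by omega)
        have h1 := (R.step (e - (k + 1))).2.1
        have h2 := hbgt (e - (k + 1)) hk
        rw [show e - ((k : ℤ) + 1) + 1 = e - k by ring] at h1
        omega
    obtain ⟨mu', hmu', hmvmu⟩ := exists_movesBy_to hmu (p := x) (by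
      have h1 := R.mu_eq x
      have h2 := R.mu_eq (x + 1)
      have h3 := hbgt (x + 1) (by omega)
      have h4 := colCount_anti lam (show x ≤ x + 1 by omega)
      omega)
    obtain ⟨rho', hrho', hmvrho⟩ := exists_movesBy_to hrho (p := e) (by
      have h1 := R.rho_eq' e
      have h2 := R.rho_eq' (e + 1)
      have h3 := hb'gt (e + 1) (by omega)
      have h4 := colCount_anti nu (show e ≤ e + 1 by omega)
      omega)
    have R' : IsCarryRun lam mu' nu rho' a (fun q => if q = x then 0 else b q)
        (fun q => if q = e then (if q = x then a' q else a' q - 1)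
          else if q = x then a' q + 1 else a' q)
        (fun q => if q = e then 0 else b' q)
        (fun q => if x < q ∧ q ≤ e then s q - 1 else s q) := by
      have hstep := R.step
      have hall : ∀ q, CarryStep ((fun q => if x < q ∧ q ≤ e then s q - 1 else s q) q) (a q)
          ((fun q => if q = x then 0 else b q) q)
          ((fun q => if q = e then (if q = x then a' q else a' q - 1)
            else if q = x then a' q + 1 else a' q) q)
          ((fun q => if q = e then 0 else b' q) q)
          ((fun q => if x < q ∧ q ≤ e then s q - 1 else s q) (q + 1)) ∧
          (q = e → x ≠ e → a' q = 1) ∧ (q = x → x ≠ e → a' q = 0) := by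
        intro q
        obtain ⟨h1, h2, h3⟩ := R.step q
        have h4 := R.a_le q
        have h5 := R.b_le q
        have h6 := R.a'_le q
        have h7 := R.b'_le q
        have h8 := hbgt q
        have h9 := hb'gt q
        have h10 := hspos q
        have h11 := hspos (q + 1)
        have h12 : q = e → b' q = 1 ∧ s (q + 1) = 0 := by rintro rfl; exact ⟨he, hse⟩
        have h13 : q = x → b q = 1 := by rintro rfl; exact hbx
        simp only [CarryStep]
        rcases lt_trichotomy q x with hqx | hqx | hqx <;>
          rcases lt_trichotomy q e with hqe | hqe | hqe <;> split_ifs <;>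
          refine ⟨⟨?_, ?_, ?_⟩, ?_, ?_⟩ <;> intros <;> omega
      have hrho'col : ∀ q, colCount rho' q + (if q = e then 1 else 0) = colCount rho q :=
        fun q => (hmvrho.colCount q).symm
      have hmu'col : ∀ q, colCount mu' q + (if q = x then 1 else 0) = colCount mu q :=
        fun q => (hmvmu.colCount q).symm
      refine ⟨R.nu_eq, fun q => ?_, fun q => ?_, fun q => ?_, R.a_le, fun q => ?_, fun q => ?_,
        fun q => ?_, fun q => (hall q).1, ?_, ?_⟩
      · have h1 := hmu'col q
        have h2 := R.mu_eq q
        by_cases hq : q = x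
        · subst hq; rw [if_pos rfl] at h1 ⊢; omega
        · rw [if_neg hq] at h1 ⊢; omega
      · have h1 := hrho'col q
        have h2 := R.rho_eq q
        have h3 := hmu'col q
        have h4 := (hall q).2.1
        split_ifs at * <;> omega
      · have h1 := hrho'col q
        have h2 := R.rho_eq' q
        by_cases hq : q = e
        · subst hq; rw [if_pos rfl] at h1 ⊢; omega
        · rw [if_neg hq] at h1 ⊢; omega
      · have := R.b_le q
        split_ifs <;> omega
      · have h1 := R.a'_le q
        have h2 := (hall q).2.2
        split_ifs <;> omega
      · have := R.b'_le q
        split_ifs <;> omega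
      · obtain ⟨B, hB⟩ := R.bot
        refine ⟨B, fun q hq => ?_⟩
        have := hB q hq
        split_ifs <;> omega
      · obtain ⟨B, hB⟩ := R.top
        refine ⟨B, fun q hq => ?_⟩
        have := hB q hq
        split_ifs <;> omega
    obtain ⟨m, n, L, h, v, H⟩ := ih hmu' hrho' R' fun q => by
      have := hb q
      simp only [Finset.mem_insert] at this
      by_cases hq : q = x
      · subst hq; rw [if_pos rfl, if_neg hxT]
      · simp only [hq, false_or, if_false] at this ⊢
        exact this
    have hA : ∀ q, hCount m h n q = if q = e then (if q = x then a' q else a' q - 1)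
          else if q = x then a' q + 1 else a' q := fun q => by
      have h1 := H.colCount_h le_rfl le_rfl q
      rw [H.ne, H.nw, R'.rho_eq] at h1
      omega
    have hx : ∀ j < n, v 0 j < x := fun j hj => by
      have h1 := H.colCount_v (Nat.zero_le m) le_rfl (v 0 j)
      have h2 := vCount_self_pos (v := v) (i := 0) hj
      rw [H.nw, H.sw, R'.mu_eq] at h1
      have h3 := hbgt (v 0 j)
      by_contra hc
      split_ifs at h1 <;> omega
    have hev : ∀ j < n, v m j < e := fun j hj => by
      have h1 := H.colCount_v le_rfl le_rfl (v m j)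
      have h2 := vCount_self_pos (v := v) (i := m) hj
      rw [H.ne, H.se, R'.rho_eq'] at h1
      have h3 := hb'gt (v m j)
      by_contra hc
      split_ifs at h1 <;> omega
    refine ⟨m, n + 1, H.exists_succ hmu hrho hxe hmvmu.colCount hmvrho.colCount hx hev ?_ ?_⟩
    · intro q hq hqe
      rw [← hCount_pos, hA, if_neg (by omega)]
      by_cases hqx : q = x
      · rw [if_pos hqx]; omega
      · rw [if_neg hqx]
        obtain ⟨h1, h2, h3⟩ := R.step q
        have h4 := hspos q (by omega) (by omega)
        have h5 := hspos (q + 1) (by omega) (by omega)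
        have h6 := hbgt q (by omega)
        have := R.a'_le q
        omega
    · intro hlt i hi heq
      have h1 := hCount_pos.2 ⟨i, hi, heq.symm⟩
      have h2 := R.a'_le e
      rw [hA, if_pos rfl, if_neg (by omega)] at h1
      omega

end IsCarryRun

theorem IsAdmissible.sum_nu {N m n : ℕ} {lam mu nu rho : Fin N → ℤ}
    {L : ℕ → ℕ → Fin N → ℤ} {h v : ℕ → ℕ → ℤ} (H : IsAdmissible m n lam mu nu rho L h v) :
    (∑ c, nu c - ∑ c, lam c).toNat = m := by
  suffices ∀ i ≤ m, ∑ c, L i 0 c = ∑ c, lam c + i by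
    rw [← H.se, this m le_rfl]; omega
  intro i hi
  induction i with
  | zero => simp [H.sw]
  | succ i ih =>
    rw [(H.moves_h i hi 0 (Nat.zero_le n)).sum, ih (by omega), Nat.cast_succ, add_assoc]

theorem IsAdmissible.sum_mu {N m n : ℕ} {lam mu nu rho : Fin N → ℤ}
    {L : ℕ → ℕ → Fin N → ℤ} {h v : ℕ → ℕ → ℤ} (H : IsAdmissible m n lam mu nu rho L h v) :
    (∑ c, mu c - ∑ c, lam c).toNat = n := by
  suffices ∀ j ≤ n, ∑ c, L 0 j c = ∑ c, lam c + j by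
    rw [← H.nw, this n le_rfl]; omega
  intro j hj
  induction j with
  | zero => simp [H.sw]
  | succ j ih =>
    rw [(H.moves_v 0 (Nat.zero_le m) j hj).sum, ih (by omega), Nat.cast_succ, add_assoc]

/-- If the coefficient is not zero, the column-by-column algorithm has a valid run. -/
theorem exists_isCarryRun_of_rskU_ne_zero {N : ℕ} {t : ℝ} {lam mu nu rho : Fin N → ℤ}
    (h : rskU t lam mu nu rho ≠ 0) : ∃ a b a' b' s, IsCarryRun lam mu nu rho a b a' b' s := by
  rw [rskU] at h
  split_ifs at h with hex
  · obtain ⟨⟨L, hh, v⟩, H⟩ := hex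
    generalize (∑ c, nu c - ∑ c, lam c).toNat = m at H
    generalize (∑ c, mu c - ∑ c, lam c).toNat = n at H
    simp only at H
    have G := H.isLabelling
    refine ⟨hCount m hh 0, vCount n v 0, hCount m hh n, vCount n v m, labelCarry m n v,
      fun q => ?_, fun q => ?_, fun q => ?_, fun q => ?_, G.hCount_le (Nat.zero_le _),
      G.vCount_le (Nat.zero_le _), G.hCount_le le_rfl, G.vCount_le le_rfl, G.carryStep, ?_, ?_⟩
    · rw [← H.se, ← H.sw, H.colCount_h le_rfl (Nat.zero_le _)]
    · rw [← H.nw, ← H.sw, H.colCount_v (Nat.zero_le _) le_rfl]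
    · rw [← H.ne, ← H.nw, H.colCount_h le_rfl le_rfl]
    · rw [← H.ne, ← H.se, H.colCount_v le_rfl le_rfl]
    · refine ⟨-∑ j ∈ Finset.range n, |v 0 j|, fun q hq => ?_⟩
      by_contra hc
      obtain ⟨j, hj, h1, -⟩ := labelCarry_pos.1 (Nat.pos_of_ne_zero hc)
      have := Finset.single_le_sum (f := fun j => |v 0 j|) (fun _ _ => abs_nonneg _)
        (Finset.mem_range.2 hj)
      have := neg_abs_le (v 0 j)
      omega
    · refine ⟨∑ j ∈ Finset.range n, |v m j| + 1, fun q hq => ?_⟩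
      by_contra hc
      obtain ⟨j, hj, -, h1⟩ := labelCarry_pos.1 (Nat.pos_of_ne_zero hc)
      have := Finset.single_le_sum (f := fun j => |v m j|) (fun _ _ => abs_nonneg _)
        (Finset.mem_range.2 hj)
      have := le_abs_self (v m j)
      omega
  · exact absurd rfl h

/-- The coefficient of a valid run of the column-by-column algorithm is the product of its column
weights. -/
theorem IsCarryRun.rskU_eq {N : ℕ} (t : ℝ) {lam mu nu rho : Fin N → ℤ} {a b a' b' s : ℤ → ℕ}
    (hlam : Antitone lam) (hmu : Antitone mu) (hnu : Antitone nu) (hrho : Antitone rho)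
    (R : IsCarryRun lam mu nu rho a b a' b' s) (T : Finset ℤ) (hT : ∀ q, b q = 1 → q ∈ T) :
    rskU t lam mu nu rho = ∏ q ∈ T, colWt t (a' (q - 1)) (b' (q - 1)) (s (q - 1)) (multAt lam q)
      (a q) (b q) (s q) (a' q) := by
  obtain ⟨S, hS⟩ := IsCarryRun.exists_finset R.b_le R.mu_eq
  obtain ⟨m, n, L, h, v, H⟩ := IsCarryRun.exists_isAdmissible hlam hnu S hmu hrho R hS
  have hex : ∃ A : (ℕ → ℕ → Fin N → ℤ) × (ℕ → ℕ → ℤ) × (ℕ → ℕ → ℤ),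
      IsAdmissible (∑ c, nu c - ∑ c, lam c).toNat (∑ c, mu c - ∑ c, lam c).toNat
        lam mu nu rho A.1 A.2.1 A.2.2 := by
    rw [H.sum_nu, H.sum_mu]
    exact ⟨⟨L, h, v⟩, H⟩
  rw [rskU]
  rw [dif_pos hex]
  have H' := hex.choose_spec
  generalize hex.choose = A at H'
  obtain ⟨L', h', v'⟩ := A
  simp only at H' ⊢
  rw [H'.prod_boxWeight t]
  generalize (∑ c, nu c - ∑ c, lam c).toNat = m' at H'
  generalize (∑ c, mu c - ∑ c, lam c).toNat = n' at H'
  have G := H'.isLabelling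
  have ea : ∀ q, hCount m' h' 0 q = a q := fun q => by
    have h1 := H'.colCount_h le_rfl (Nat.zero_le _) q
    rw [H'.se, H'.sw, R.nu_eq] at h1
    omega
  have eb : ∀ q, vCount n' v' 0 q = b q := fun q => by
    have h1 := H'.colCount_v (Nat.zero_le _) le_rfl q
    rw [H'.nw, H'.sw, R.mu_eq] at h1
    omega
  have ea' : ∀ q, hCount m' h' n' q = a' q := fun q => by
    have h1 := H'.colCount_h le_rfl le_rfl q
    rw [H'.ne, H'.nw, R.rho_eq] at h1
    omega
  have eb' : ∀ q, vCount n' v' m' q = b' q := fun q => by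
    have h1 := H'.colCount_v le_rfl le_rfl q
    rw [H'.ne, H'.se, R.rho_eq'] at h1
    omega
  -- the carries agree, since both vanish far to the left and satisfy the same recursion
  have es : ∀ q, labelCarry m' n' v' q = s q := by
    obtain ⟨B, hB⟩ := R.bot
    set B' := min B (-∑ j ∈ Finset.range n', |v' 0 j|) with hB'
    have h0 : ∀ q ≤ B', labelCarry m' n' v' q = s q := by
      intro q hq
      rw [hB q (hq.trans (min_le_left _ _))]
      by_contra hc
      obtain ⟨j, hj, h1, -⟩ := labelCarry_pos.1 (Nat.pos_of_ne_zero hc)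
      have := Finset.single_le_sum (f := fun j => |v' 0 j|) (fun _ _ => abs_nonneg _)
        (Finset.mem_range.2 hj)
      have := neg_abs_le (v' 0 j)
      omega
    intro q
    by_cases hq : q ≤ B'
    · exact h0 q hq
    suffices ∀ k : ℕ, labelCarry m' n' v' (B' + k) = s (B' + k) by
      have := this (q - B').toNat
      rwa [show B' + ((q - B').toNat : ℤ) = q by omega] at this
    intro k
    induction k with
    | zero => simpa using h0 B' le_rfl
    | succ k ih =>
      have h1 := (G.carryStep (B' + k)).1
      have h2 := (R.step (B' + k)).1
      rw [ea, ea', ih] at h1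
      rw [Nat.cast_succ, ← add_assoc]
      omega
  have hinj : Set.InjOn (v' 0) (Finset.range n' : Set ℕ) := by
    intro j hj j' hj' heq
    rw [Finset.coe_range, Set.mem_Iio] at hj hj'
    exact G.v_inj hj hj' (Nat.zero_le _) heq
  -- columns without a box of `μ/λ` have weight `1`
  rw [← Finset.prod_image (f := fun q => labelWt t m' n' lam h' v' q) hinj]
  have hcongr : ∀ q, labelWt t m' n' lam h' v' q = colWt t (a' (q - 1)) (b' (q - 1)) (s (q - 1))
      (multAt lam q) (a q) (b q) (s q) (a' q) := fun q => by
    rw [labelWt, ea', eb', es, ea, eb, es, ea']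
  simp only [hcongr]
  refine Finset.prod_subset (fun q hq => ?_) fun q _ hq => colWt_eq_one fun hc => hq ?_
  · obtain ⟨j, hj, rfl⟩ := Finset.mem_image.1 hq
    have h1 := vCount_self_pos (v := v') (i := 0) (Finset.mem_range.1 hj)
    have h2 := R.b_le (v' 0 j)
    rw [eb] at h1
    exact hT _ (by omega)
  · obtain ⟨j, hj, hj'⟩ := vCount_pos.1 (show 0 < vCount n' v' 0 q by rw [eb]; omega)
    exact Finset.mem_image.2 ⟨j, Finset.mem_range.2 hj, hj'.symm⟩

/-! ### The column weights: stochasticity and reversal -/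

instance (s a b a' b' s' : ℕ) : Decidable (CarryStep s a b a' b' s') :=
  inferInstanceAs (Decidable (_ ∧ _ ∧ _))

theorem CarryStep.symm {s a b a' b' s' : ℕ} (h : CarryStep s a b a' b' s') (_ : a ≤ 1)
    (_ : a' ≤ 1) : CarryStep s' a' b' a b s := by
  obtain ⟨h1, h2, h3⟩ := h
  refine ⟨h1.symm, h2.symm, fun h4 h5 => ?_⟩
  omega

theorem colWt_nonneg {t : ℝ} (ht0 : 0 ≤ t) (ht1 : t < 1) (pa pb ps n a b s a' : ℕ) :
    0 ≤ colWt t pa pb ps n a b s a' := by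
  have h1 : t ^ n ≤ 1 := pow_le_one₀ ht0 ht1.le
  rw [colWt]
  split_ifs
  · exact zero_le_one
  · exact le_rfl
  · exact ht0
  · linarith
  · rcases Nat.eq_zero_or_pos n with rfl | hn
    · simp
    · have h2 : t ^ n ≤ t := pow_le_of_le_one ht0 ht1.le hn.ne'
      exact div_nonneg (by linarith) (by linarith)
  · exact div_nonneg (by linarith) (by linarith)
  · exact zero_le_one

theorem one_sub_pow_ne_zero {t : ℝ} (ht0 : 0 ≤ t) (ht1 : t < 1) {n : ℕ} (hn : 1 ≤ n) :
    1 - t ^ n ≠ 0 := by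
  have := pow_lt_one₀ ht0 ht1 (show n ≠ 0 by omega)
  linarith

/-- Two neighbouring columns with nonzero weight: the length of the second column of `ρ` does not
exceed that of the first. The critical case, where `t ^ n = t`, has weight zero. -/
theorem le_of_colWt_ne_zero {t : ℝ} {s a b a' b' s₁ a₁ b₁ a₁' b₁' s₂ n : ℕ}
    (h : CarryStep s a b a' b' s₁) (h₁ : CarryStep s₁ a₁ b₁ a₁' b₁' s₂)
    (ha : a ≤ 1) (hb : b ≤ 1) (ha' : a' ≤ 1) (hb' : b' ≤ 1)
    (ha₁ : a₁ ≤ 1) (hb₁ : b₁ ≤ 1) (ha₁' : a₁' ≤ 1) (hb₁' : b₁' ≤ 1)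
    (hna : a₁ ≤ n + a) (hnb : b₁ ≤ n + b) (hw : colWt t a' b' s n a₁ b₁ s₁ a₁' ≠ 0) :
    b₁ + a₁' ≤ n + b + a' := by
  obtain ⟨e1, e2, e3⟩ := h
  obtain ⟨f1, f2, f3⟩ := h₁
  by_contra hc
  have hn : n = 1 := by omega
  have : a₁ = 1 ∧ b₁ = 1 ∧ s₁ = 0 ∧ a' = 0 ∧ b' = 0 ∧ a₁' = 1 := by omega
  obtain ⟨rfl, rfl, rfl, rfl, rfl, rfl⟩ := this
  apply hw
  rw [colWt_choice, hn]
  simp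

/-- The probability that a column has output `x` in the first output diagram; the other output
data are determined by the conservation of boxes. -/
def stepProb (t : ℝ) (pa pb ps n a b s x : ℕ) : ℝ :=
  if CarryStep s a b x (b + s - (a + s - x)) (a + s - x) ∧ b + s - (a + s - x) ≤ 1 then
    colWt t pa pb ps n a b s x else 0

/-- The two possible outputs of a column have total probability `1`. -/
theorem stepProb_sum {t : ℝ} (ht0 : 0 ≤ t) (ht1 : t < 1) {pa pb ps n a b s : ℕ} (ha : a ≤ 1)
    (hb : b ≤ 1) (hn : a = 1 → b = 1 → s = 0 → pa ≠ 1 → pb ≠ 1 → 1 ≤ n) :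
    stepProb t pa pb ps n a b s 0 + stepProb t pa pb ps n a b s 1 = 1 := by
  by_cases hch : a = 1 ∧ b = 1 ∧ s = 0
  · obtain ⟨rfl, rfl, rfl⟩ := hch
    rw [stepProb, stepProb, if_pos (by simp [CarryStep]), if_pos (by simp [CarryStep]),
      colWt_choice, colWt_choice]
    by_cases h1 : pa = 1 ∧ pb = 1
    · rw [if_pos h1, if_pos h1]
      by_cases h2 : ps = 0 <;> simp [h2]
    · rw [if_neg h1, if_neg h1]
      by_cases h2 : pa = 1 ∨ pb = 1
      · rw [if_pos h2, if_pos h2]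
        simp
      · rw [if_neg h2, if_neg h2]
        have := one_sub_pow_ne_zero ht0 ht1 (hn rfl rfl rfl (fun h => h2 (Or.inl h))
          (fun h => h2 (Or.inr h)))
        simp only [zero_ne_one, if_false, if_true]
        field_simp
        ring
  · rw [stepProb, stepProb, colWt_eq_one hch, colWt_eq_one hch]
    by_cases h0 : CarryStep s a b 0 (b + s - (a + s - 0)) (a + s - 0) ∧ b + s - (a + s - 0) ≤ 1
    · rw [if_pos h0, if_neg, add_zero]
      simp only [CarryStep] at h0 ⊢
      omega
    · rw [if_neg h0, if_pos, zero_add]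
      simp only [CarryStep] at h0 ⊢
      omega

/-- The carry of the run with inputs `a` whose output has a box in the columns in `S`. -/
def scanCarry (r : ℕ) (a : ℕ → ℕ) (S : Finset ℕ) : ℕ → ℕ
  | 0 => r
  | c + 1 => a c + scanCarry r a S c - (if c ∈ S then 1 else 0)

/-- The column probabilities of the run with inputs `a`, `b` whose output has a box in the columns
in `S`, where `pa`, `pb`, `ps` are the data of the column before the first one. -/
def scanProb (t : ℝ) (pa pb ps r : ℕ) (n a b : ℕ → ℕ) (S : Finset ℕ) : ℕ → ℝ
  | 0 => stepProb t pa pb ps (n 0) (a 0) (b 0) r (if 0 ∈ S then 1 else 0)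
  | c + 1 => stepProb t (if c ∈ S then 1 else 0)
      (b c + scanCarry r a S c - scanCarry r a S (c + 1)) (scanCarry r a S c) (n (c + 1))
      (a (c + 1)) (b (c + 1)) (scanCarry r a S (c + 1)) (if c + 1 ∈ S then 1 else 0)

theorem scanCarry_congr {r : ℕ} {a : ℕ → ℕ} {S S' : Finset ℕ} :
    ∀ {c : ℕ}, (∀ d < c, d ∈ S ↔ d ∈ S') → scanCarry r a S c = scanCarry r a S' c
  | 0, _ => rfl
  | c + 1, h => by
    rw [scanCarry, scanCarry, scanCarry_congr fun d hd => h d (by omega)]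
    simp only [h c (by omega)]

theorem scanProb_congr {t : ℝ} {pa pb ps r : ℕ} {n a b : ℕ → ℕ} {S S' : Finset ℕ} :
    ∀ {c : ℕ}, (∀ d ≤ c, d ∈ S ↔ d ∈ S') →
      scanProb t pa pb ps r n a b S c = scanProb t pa pb ps r n a b S' c
  | 0, h => by simp only [scanProb, h 0 le_rfl]
  | c + 1, h => by
    simp only [scanProb]
    rw [scanCarry_congr (S' := S') (c := c) fun d hd => h d (by omega),
      scanCarry_congr (S' := S') (c := c + 1) fun d hd => h d (by omega)]
    simp only [h c (by omega), h (c + 1) le_rfl]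

theorem carryStep_of_scanProb_ne_zero {t : ℝ} {pa pb ps r : ℕ} {n a b : ℕ → ℕ} {S : Finset ℕ}
    {c : ℕ} (h : scanProb t pa pb ps r n a b S c ≠ 0) :
    CarryStep (scanCarry r a S c) (a c) (b c) (if c ∈ S then 1 else 0)
      (b c + scanCarry r a S c - scanCarry r a S (c + 1)) (scanCarry r a S (c + 1)) ∧
    b c + scanCarry r a S c - scanCarry r a S (c + 1) ≤ 1 := by
  cases c with
  | zero =>
    simp only [scanProb, stepProb, scanCarry] at h ⊢
    by_contra hc
    exact h (if_neg hc)
  | succ c =>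
    simp only [scanProb, stepProb] at h
    rw [scanCarry]
    by_contra hc
    exact h (if_neg hc)

/-- The total weight of all outputs, refined by the output in the first column. -/
theorem sum_scanProb_mul {t : ℝ} (ht0 : 0 ≤ t) (ht1 : t < 1) {pa pb ps r : ℕ} {n a b : ℕ → ℕ}
    (ha : ∀ c, a c ≤ 1) (hb : ∀ c, b c ≤ 1) (hn : ∀ c, b (c + 1) ≤ n (c + 1) + b c)
    (f : Prop → ℝ) (M : ℕ) :
    ∑ S ∈ (Finset.range (M + 1)).powerset,
        f (0 ∈ S) * ∏ c ∈ Finset.range (M + 1), scanProb t pa pb ps r n a b S c =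
      f False * stepProb t pa pb ps (n 0) (a 0) (b 0) r 0 +
        f True * stepProb t pa pb ps (n 0) (a 0) (b 0) r 1 := by
  induction M with
  | zero =>
    rw [zero_add, Finset.range_one, show ({0} : Finset ℕ) = insert 0 ∅ from rfl,
      Finset.sum_powerset_insert (Finset.notMem_empty 0)]
    simp [scanProb]
  | succ M ih =>
    rw [Finset.range_add_one (n := M + 1), Finset.sum_powerset_insert (by simp),
      ← Finset.sum_add_distrib, ← ih]
    apply Finset.sum_congr rfl
    intro S hS
    rw [Finset.mem_powerset] at hS
    have hMS : M + 1 ∉ S := fun h => by simpa using hS h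
    rw [Finset.prod_insert (by simp), Finset.prod_insert (by simp)]
    have h1 : ∏ c ∈ Finset.range (M + 1), scanProb t pa pb ps r n a b (insert (M + 1) S) c =
        ∏ c ∈ Finset.range (M + 1), scanProb t pa pb ps r n a b S c := by
      apply Finset.prod_congr rfl
      intro c hc
      rw [Finset.mem_range] at hc
      apply scanProb_congr
      intro d hd
      rw [Finset.mem_insert]
      exact ⟨fun h => h.resolve_left (by omega), Or.inr⟩
    have h2 : (0 ∈ insert (M + 1) S) = (0 ∈ S) := by
      rw [Finset.mem_insert]
      simp
    rw [h1, h2]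
    by_cases hz : scanProb t pa pb ps r n a b S M = 0
    · rw [Finset.prod_eq_zero (Finset.self_mem_range_succ M) hz]
      simp
    -- summing out the last column, whose two outputs have total probability `1`
    · obtain ⟨⟨e1, e2, e3⟩, e4⟩ := carryStep_of_scanProb_ne_zero hz
      have hadd : scanProb t pa pb ps r n a b S (M + 1) +
          scanProb t pa pb ps r n a b (insert (M + 1) S) (M + 1) = 1 := by
        have hc1 := scanCarry_congr (r := r) (a := a) (S := insert (M + 1) S) (S' := S) (c := M + 1)
          (fun d hd => by
            rw [Finset.mem_insert]
            exact ⟨fun h => h.resolve_left (by omega), Or.inr⟩)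
        have hc2 := scanCarry_congr (r := r) (a := a) (S := insert (M + 1) S) (S' := S) (c := M)
          (fun d hd => by
            rw [Finset.mem_insert]
            exact ⟨fun h => h.resolve_left (by omega), Or.inr⟩)
        simp only [scanProb, hc1, hc2, Finset.mem_insert, hMS, true_or, if_true, if_false,
          Nat.ne_of_lt (Nat.lt_succ_self M), false_or]
        refine stepProb_sum ht0 ht1 (ha _) (hb _) fun h3 h4 h5 h6 h7 => ?_
        have := hn M
        have := ha M
        have := hb M
        split_ifs at * <;> omega
      rw [← mul_add, ← add_mul, hadd, one_mul]

theorem sum_scanProb {t : ℝ} (ht0 : 0 ≤ t) (ht1 : t < 1) {pa pb ps r : ℕ} {n a b : ℕ → ℕ}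
    (ha : ∀ c, a c ≤ 1) (hb : ∀ c, b c ≤ 1) (hn : ∀ c, b (c + 1) ≤ n (c + 1) + b c)
    (h0 : a 0 = 1 → b 0 = 1 → pa ≠ 1 → pb ≠ 1 → 1 ≤ n 0) (M : ℕ) :
    ∑ S ∈ (Finset.range M).powerset, ∏ c ∈ Finset.range M, scanProb t pa pb ps r n a b S c = 1 := by
  cases M with
  | zero => simp
  | succ M =>
    have h1 := sum_scanProb_mul ht0 ht1 (pa := pa) (pb := pb) (ps := ps) (r := r) ha hb hn
      (fun _ => 1) M
    simp only [one_mul] at h1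
    rw [h1, stepProb_sum ht0 ht1 (ha 0) (hb 0) fun h2 h3 _ => h0 h2 h3]

/-- The factor by which the two sides of the reversal identity differ at a cut after a column; it is
`t` if a decision was made in this column and the pair of boxes stayed there, `1` if nothing was
carried into or out of it, and `1 - t` otherwise. -/
def cutFactor (t : ℝ) (a b s a' s' : ℕ) : ℝ :=
  if a = 1 ∧ b = 1 ∧ s = 0 ∧ a' = 1 then t else if s = 0 ∧ s' = 0 then 1 else 1 - t

/-- The factor of `φ` or, with the arguments exchanged, of `ψ` for two neighbouring columns, of
which `x` and `y` tell whether they contain boxes of the skew diagram. -/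
def turnFactor (t : ℝ) (x y n : ℕ) : ℝ := if x = 1 ∧ y = 0 then 1 - t ^ n else 1

/-- The local identity at the border of two neighbouring columns behind the reversibility of the
algorithm: `n` and `p` are the multiplicities of the position in `λ` and in `ρ`, so `n + a - a₁` is
that in `ν`. On the right the column weight is that of the algorithm running from right to
left. -/
theorem colWt_reversal {t : ℝ} (ht0 : 0 ≤ t) (ht1 : t < 1)
    {s a b a' b' s₁ a₁ b₁ a₁' b₁' s₂ n p : ℕ}
    (h : CarryStep s a b a' b' s₁) (h₁ : CarryStep s₁ a₁ b₁ a₁' b₁' s₂)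
    (ha : a ≤ 1) (hb : b ≤ 1) (ha' : a' ≤ 1) (hb' : b' ≤ 1)
    (ha₁ : a₁ ≤ 1) (hb₁ : b₁ ≤ 1) (ha₁' : a₁' ≤ 1) (hb₁' : b₁' ≤ 1)
    (hp : p + a₁ + b₁' = n + a + b') (hnb : b₁ ≤ n + b) (hna : a₁ ≤ n + a) :
    cutFactor t a b s a' s₁ * (turnFactor t a a₁ (n + a - a₁) * turnFactor t b₁ b n) *
        colWt t a' b' s n a₁ b₁ s₁ a₁' =
      turnFactor t a' a₁' p * turnFactor t b₁' b' (n + a - a₁) *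
        colWt t a₁ b₁ s₂ p a' b' s₁ a * cutFactor t a₁ b₁ s₁ a₁' s₂ := by
  obtain ⟨e1, e2, e3⟩ := h
  obtain ⟨f1, f2, f3⟩ := h₁
  have hn : ∀ {k : ℕ}, 1 ≤ k → 1 - t ^ k ≠ 0 := fun hk => one_sub_pow_ne_zero ht0 ht1 hk
  -- a finite case analysis: in each surviving case `n` and `p` differ by at most two, and both
  -- sides agree after a denominator `1 - t ^ n` is cancelled
  interval_cases a <;> interval_cases b <;> interval_cases a' <;> interval_cases b' <;>
    (try (exfalso; omega)) <;>
    interval_cases a₁ <;> interval_cases b₁ <;> interval_cases a₁' <;> interval_cases b₁' <;>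
    (try (exfalso; omega)) <;>
    rcases eq_or_ne s 0 with hs | hs <;> (try (exfalso; omega)) <;>
    rcases eq_or_ne s₁ 0 with hs₁ | hs₁ <;> (try (exfalso; omega)) <;>
    rcases eq_or_ne s₂ 0 with hs₂ | hs₂ <;> (try (exfalso; omega)) <;>
    simp only [colWt, cutFactor, turnFactor, hs, hs₁, hs₂, zero_ne_one, one_ne_zero,
      and_true, and_false, if_true, if_false, or_true, or_false, mul_one, one_mul, mul_zero,
      zero_mul, iff_true, iff_false, not_true, and_self, or_self, iff_self] <;>
    (try (rcases (by omega : n = p ∨ n = p + 1 ∨ n = p + 2 ∨ p = n + 1 ∨ p = n + 2) with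
      rfl | rfl | rfl | rfl | rfl)) <;> (try (exfalso; omega)) <;>
    (try simp only [add_zero, tsub_zero, Nat.add_sub_cancel, Nat.reduceSubDiff]) <;>
    first
      | done
      | ring1
      | (rw [mul_div_cancel₀]; exact hn (by omega))
      | (rw [mul_div_cancel₀]; · ring1
         exact hn (by omega))

/-! ### Young diagrams and their columns -/

/-- The number of boxes of the skew diagram `mu / lam` in column `c`; `0` or `1` for a horizontal
strip. -/
def skewInd (mu lam : YoungDiagram) (c : ℕ) : ℕ := mu.colLen c - lam.colLen c

theorem colLen_le_of_le {lam mu : YoungDiagram} (h : lam ≤ mu) (c : ℕ) :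
    lam.colLen c ≤ mu.colLen c := by
  by_contra hc
  have h1 : (mu.colLen c, c) ∈ lam := YoungDiagram.mem_iff_lt_colLen.2 (not_le.1 hc)
  exact lt_irrefl _ (YoungDiagram.mem_iff_lt_colLen.1 (h h1))

theorem YoungDiagram.ext_colLen {lam mu : YoungDiagram} (h : ∀ c, lam.colLen c = mu.colLen c) :
    lam = mu := by
  ext ⟨i, j⟩
  rw [YoungDiagram.mem_cells, YoungDiagram.mem_cells, YoungDiagram.mem_iff_lt_colLen,
    YoungDiagram.mem_iff_lt_colLen, h]

theorem isHorizontalStrip_iff {lam mu : YoungDiagram} :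
    IsHorizontalStrip mu lam ↔
      ∀ c, lam.colLen c ≤ mu.colLen c ∧ mu.colLen c ≤ lam.colLen c + 1 := by
  refine ⟨fun h c => ⟨colLen_le_of_le h.1 c, h.2 c⟩, fun h => ⟨?_, fun c => (h c).2⟩⟩
  rintro ⟨i, j⟩ hij
  exact YoungDiagram.mem_iff_lt_colLen.2 <|
    (YoungDiagram.mem_iff_lt_colLen.1 hij).trans_le (h j).1

theorem IsHorizontalStrip.colLen_eq {lam mu : YoungDiagram} (h : IsHorizontalStrip mu lam) (c : ℕ) :
    mu.colLen c = lam.colLen c + skewInd mu lam c := by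
  have := (isHorizontalStrip_iff.1 h c).1
  rw [skewInd]
  omega

theorem IsHorizontalStrip.skewInd_le {lam mu : YoungDiagram} (h : IsHorizontalStrip mu lam)
    (c : ℕ) : skewInd mu lam c ≤ 1 := by
  have := (isHorizontalStrip_iff.1 h c).2
  rw [skewInd]
  omega

theorem isHorizontalStrip_of_colLen {lam mu : YoungDiagram} {f : ℕ → ℕ}
    (h : ∀ c, mu.colLen c = lam.colLen c + f c) (hf : ∀ c, f c ≤ 1) :
    IsHorizontalStrip mu lam ∧ ∀ c, skewInd mu lam c = f c := by
  refine ⟨isHorizontalStrip_iff.2 fun c => ?_, fun c => ?_⟩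
  · have := h c; have := hf c; omega
  · rw [skewInd, h]; omega

theorem colLen_eq_zero_of_rowLen_le {lam : YoungDiagram} {c : ℕ} (h : lam.rowLen 0 ≤ c) :
    lam.colLen c = 0 := by
  by_contra hc
  have h1 : (0, c) ∈ lam := YoungDiagram.mem_iff_lt_colLen.2 (Nat.pos_of_ne_zero hc)
  have := YoungDiagram.mem_iff_lt_rowLen.1 h1
  omega

theorem rowLen_le_of_colLen_eq_zero {lam : YoungDiagram} {c : ℕ} (h : lam.colLen c = 0) :
    lam.rowLen 0 ≤ c := by
  by_contra hc
  have h1 : (0, c) ∈ lam := YoungDiagram.mem_iff_lt_rowLen.2 (not_le.1 hc)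
  have := YoungDiagram.mem_iff_lt_colLen.1 h1
  omega

theorem YoungDiagram.card_eq_sum_colLen (lam : YoungDiagram) {M : ℕ} (hM : lam.rowLen 0 ≤ M) :
    lam.card = ∑ c ∈ Finset.range M, lam.colLen c := by
  rw [YoungDiagram.card, Finset.card_eq_sum_card_fiberwise (f := fun x : ℕ × ℕ => x.2)
    (t := Finset.range M)]
  · apply Finset.sum_congr rfl
    intro c _
    rw [YoungDiagram.colLen_eq_card, YoungDiagram.col]
  · rintro ⟨i, j⟩ hij
    have h1 := YoungDiagram.mem_iff_lt_rowLen.1 ((YoungDiagram.mem_cells (μ := lam) (i, j)).1 hij)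
    have h2 := lam.rowLen_anti 0 i (Nat.zero_le i)
    simp only [Finset.coe_range, Set.mem_Iio]
    omega

/-- The Young diagram whose columns have the lengths `f 0, …, f (M - 1)`; if these do not decrease,
the largest Young diagram contained in them. -/
def diagramOfCols (M : ℕ) (f : ℕ → ℕ) : YoungDiagram where
  cells := (((Finset.range ((Finset.range (M + 1)).sup f)) ×ˢ Finset.range M).filter
    fun x => ∀ j ≤ x.2, x.1 < f j)
  isLowerSet := by
    rintro ⟨i, j⟩ ⟨i', j'⟩ ⟨h1, h2⟩ h
    simp only [Finset.coe_filter, Finset.mem_product, Finset.mem_range, Set.mem_ofPred_eq] at *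
    exact ⟨⟨by omega, by omega⟩, fun k hk => h1.trans_lt (h.2 k (hk.trans h2))⟩

theorem colLen_diagramOfCols {M : ℕ} {f : ℕ → ℕ} (hf : Antitone f) (hM : ∀ c, M ≤ c → f c = 0)
    (c : ℕ) : (diagramOfCols M f).colLen c = f c := by
  apply eq_of_forall_lt_iff
  intro i
  rw [← YoungDiagram.mem_iff_lt_colLen, ← YoungDiagram.mem_cells]
  simp only [diagramOfCols, Finset.mem_filter, Finset.mem_product, Finset.mem_range]
  refine ⟨fun h => h.2 c le_rfl, fun h => ⟨⟨?_, ?_⟩, fun k hk => h.trans_le (hf hk)⟩⟩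
  · exact h.trans_le (by
      by_cases hc : c < M + 1
      · exact Finset.le_sup (f := f) (Finset.mem_range.2 hc)
      · rw [hM c (by omega)]; exact Nat.zero_le _)
  · by_contra hc
    rw [hM c (by omega)] at h
    omega

/-! ### The algorithm column by column -/

/-- The algorithm takes `mu` to `rho` for the input `lam → nu`, all of them Young diagrams, by a
valid column by column run in which `s c` particles are pushed into column `c`. -/
structure IsColumnRun (lam mu nu rho : YoungDiagram) (s : ℕ → ℕ) : Prop where
  mu_strip : IsHorizontalStrip mu lam
  nu_strip : IsHorizontalStrip nu lam
  rho_strip : IsHorizontalStrip rho mu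
  rho_strip' : IsHorizontalStrip rho nu
  step : ∀ c, CarryStep (s c) (skewInd nu lam c) (skewInd mu lam c) (skewInd rho mu c)
    (skewInd rho nu c) (s (c + 1))

/-- The number of particles pushed into column `c`. By conservation of boxes it is the number of
boxes of `rho / mu` in this and all later columns, minus that of `nu / lam`. -/
def colCarry (lam mu nu rho : YoungDiagram) (c : ℕ) : ℕ :=
  ∑ d ∈ Finset.Ico c (rho.rowLen 0), skewInd rho mu d -
    ∑ d ∈ Finset.Ico c (rho.rowLen 0), skewInd nu lam d

namespace IsColumnRun

variable {lam mu nu rho : YoungDiagram} {s : ℕ → ℕ}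

theorem ind_eq_zero (R : IsColumnRun lam mu nu rho s) {c : ℕ} (hc : rho.rowLen 0 ≤ c) :
    skewInd nu lam c = 0 ∧ skewInd mu lam c = 0 ∧ skewInd rho mu c = 0 ∧ skewInd rho nu c = 0 ∧
      s c = 0 := by
  have h0 := colLen_eq_zero_of_rowLen_le hc
  have h1 := R.rho_strip.colLen_eq c
  have h2 := R.rho_strip'.colLen_eq c
  have h3 := R.mu_strip.colLen_eq c
  have h4 := R.nu_strip.colLen_eq c
  have h5 := R.step c
  simp only [CarryStep] at h5
  omega

theorem eq_colCarry (R : IsColumnRun lam mu nu rho s) (c : ℕ) :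
    s c = colCarry lam mu nu rho c := by
  have key : ∀ k c, c + k = rho.rowLen 0 →
      s c + ∑ d ∈ Finset.Ico c (rho.rowLen 0), skewInd nu lam d =
        ∑ d ∈ Finset.Ico c (rho.rowLen 0), skewInd rho mu d := by
    intro k
    induction k with
    | zero =>
      intro c hc
      rw [← hc, add_zero, Finset.Ico_self]
      simp only [Finset.sum_empty, add_zero]
      exact (R.ind_eq_zero hc.ge).2.2.2.2
    | succ k ih =>
      intro c hc
      have h1 := ih (c + 1) (by omega)
      have h2 := (R.step c).1
      have hlt : c < rho.rowLen 0 := by omega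
      rw [Finset.sum_eq_sum_Ico_succ_bot hlt, Finset.sum_eq_sum_Ico_succ_bot hlt]
      omega
  rw [colCarry]
  by_cases hc : c ≤ rho.rowLen 0
  · have := key (rho.rowLen 0 - c) c (by omega)
    omega
  · rw [(R.ind_eq_zero (by omega)).2.2.2.2, Finset.Ico_eq_empty (by omega)]
    simp

theorem congr (R : IsColumnRun lam mu nu rho s) {s' : ℕ → ℕ} (h : ∀ c, s c = s' c) :
    IsColumnRun lam mu nu rho s' := by
  rwa [show s' = s from funext fun c => (h c).symm]

theorem self (R : IsColumnRun lam mu nu rho s) :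
    IsColumnRun lam mu nu rho (colCarry lam mu nu rho) := R.congr R.eq_colCarry

/-- Conservation of boxes: the input `s 0` is the number of boxes that `ρ` has beyond those of
`μ/λ` and `ν/λ` added to `λ`. -/
theorem card_eq (R : IsColumnRun lam mu nu rho s) :
    rho.card = mu.card + (nu.card - lam.card) + s 0 ∧
      rho.card = nu.card + (mu.card - lam.card) + s 0 ∧ lam.card ≤ mu.card ∧
      lam.card ≤ nu.card ∧ mu.card ≤ rho.card ∧ nu.card ≤ rho.card := by
  have e : ∀ κ : YoungDiagram, κ.rowLen 0 ≤ rho.rowLen 0 → κ.card =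
      ∑ c ∈ Finset.range (rho.rowLen 0), κ.colLen c := fun κ h => κ.card_eq_sum_colLen h
  have hz := R.ind_eq_zero le_rfl
  have z0 := colLen_eq_zero_of_rowLen_le (le_refl (rho.rowLen 0))
  have z1 := R.rho_strip.colLen_eq (rho.rowLen 0)
  have z2 := R.rho_strip'.colLen_eq (rho.rowLen 0)
  have z3 := R.mu_strip.colLen_eq (rho.rowLen 0)
  rw [e rho le_rfl, e mu (rowLen_le_of_colLen_eq_zero (by omega)),
    e nu (rowLen_le_of_colLen_eq_zero (by omega)), e lam (rowLen_le_of_colLen_eq_zero (by omega))]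
  have key : ∀ M, ∑ c ∈ Finset.range M, rho.colLen c + s M + ∑ c ∈ Finset.range M, lam.colLen c =
      ∑ c ∈ Finset.range M, mu.colLen c + ∑ c ∈ Finset.range M, nu.colLen c + s 0 := by
    intro M
    induction M with
    | zero => simp
    | succ M ih =>
      simp only [Finset.sum_range_succ]
      have h1 := R.rho_strip.colLen_eq M
      have h2 := R.rho_strip'.colLen_eq M
      have h3 := R.mu_strip.colLen_eq M
      have h4 := R.nu_strip.colLen_eq M
      have h5 := (R.step M).1
      omega
  have := key (rho.rowLen 0)
  have h1 := Finset.sum_le_sum (s := Finset.range (rho.rowLen 0))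
    fun c _ => colLen_le_of_le R.mu_strip.1 c
  have h2 := Finset.sum_le_sum (s := Finset.range (rho.rowLen 0))
    fun c _ => colLen_le_of_le R.nu_strip.1 c
  have h3 := Finset.sum_le_sum (s := Finset.range (rho.rowLen 0))
    fun c _ => colLen_le_of_le R.rho_strip.1 c
  have h4 := Finset.sum_le_sum (s := Finset.range (rho.rowLen 0))
    fun c _ => colLen_le_of_le R.rho_strip'.1 c
  omega

end IsColumnRun

/-- The weight of column `c` in the run of the algorithm on Young diagrams. The column before the
first one has outputs `0` and `1`, as the row that is appended to the input diagrams contributes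
there. -/
def columnWt (t : ℝ) (lam mu nu rho : YoungDiagram) (s : ℕ → ℕ) : ℕ → ℝ
  | 0 => colWt t 0 1 0 0 (skewInd nu lam 0) (skewInd mu lam 0) (s 0) (skewInd rho mu 0)
  | c + 1 => colWt t (skewInd rho mu c) (skewInd rho nu c) (s c)
      (lam.colLen c - lam.colLen (c + 1)) (skewInd nu lam (c + 1)) (skewInd mu lam (c + 1))
      (s (c + 1)) (skewInd rho mu (c + 1))

/-- The weight of column `c` in the run of the reversed algorithm, which proceeds from right to left
and finds `lam` from `mu`, `nu`, `rho`. -/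
def revColumnWt (t : ℝ) (lam mu nu rho : YoungDiagram) (s : ℕ → ℕ) (c : ℕ) : ℝ :=
  colWt t (skewInd nu lam (c + 1)) (skewInd mu lam (c + 1)) (s (c + 2))
    (rho.colLen c - rho.colLen (c + 1)) (skewInd rho mu c) (skewInd rho nu c) (s (c + 1))
    (skewInd nu lam c)

open Classical in
/-- The coefficient of the algorithm on Young diagrams, for the input that is determined by the
numbers of boxes. -/
def diagramU (t : ℝ) (lam mu nu rho : YoungDiagram) : ℝ :=
  if IsColumnRun lam mu nu rho (colCarry lam mu nu rho) then
    ∏ c ∈ Finset.range (rho.rowLen 0), columnWt t lam mu nu rho (colCarry lam mu nu rho) c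
  else 0

open Classical in
/-- The coefficient of the reversed algorithm. The column `rho.rowLen 0`, where nothing happens,
is included to start the run from the right. -/
def revDiagramU (t : ℝ) (lam mu nu rho : YoungDiagram) : ℝ :=
  if IsColumnRun lam mu nu rho (colCarry lam mu nu rho) then
    ∏ c ∈ Finset.range (rho.rowLen 0 + 1),
      revColumnWt t lam mu nu rho (colCarry lam mu nu rho) c
  else 0

theorem IsColumnRun.diagramU_eq {t : ℝ} {lam mu nu rho : YoungDiagram} {s : ℕ → ℕ}
    (R : IsColumnRun lam mu nu rho s) {M : ℕ} (hM : rho.rowLen 0 ≤ M) :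
    diagramU t lam mu nu rho = ∏ c ∈ Finset.range M, columnWt t lam mu nu rho s c := by
  rw [diagramU, if_pos R.self, ← show s = _ from funext R.eq_colCarry]
  apply Finset.prod_subset (Finset.range_mono hM)
  intro c _ hc
  rw [Finset.mem_range, not_lt] at hc
  have := R.ind_eq_zero hc
  cases c with
  | zero => exact colWt_eq_one (by omega)
  | succ c => exact colWt_eq_one (by omega)

theorem diagramU_eq_zero {t : ℝ} {lam mu nu rho : YoungDiagram}
    (h : ¬ IsColumnRun lam mu nu rho (colCarry lam mu nu rho)) : diagramU t lam mu nu rho = 0 :=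
  if_neg h

theorem diagramU_nonneg {t : ℝ} (ht0 : 0 ≤ t) (ht1 : t < 1) (lam mu nu rho : YoungDiagram) :
    0 ≤ diagramU t lam mu nu rho := by
  rw [diagramU]
  split_ifs
  · apply Finset.prod_nonneg
    intro c _
    cases c <;> exact colWt_nonneg ht0 ht1 _ _ _ _ _ _ _ _
  · exact le_rfl

theorem hlPhi_eq {t : ℝ} {lam mu : YoungDiagram} (h : IsHorizontalStrip lam mu) {M : ℕ}
    (hM : lam.rowLen 0 ≤ M) :
    hlPhi t lam mu = ∏ c ∈ Finset.range M, turnFactor t (skewInd lam mu c) (skewInd lam mu (c + 1))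
      (lam.colLen c - lam.colLen (c + 1)) := by
  rw [hlPhi, if_pos h, ← Finset.prod_subset (Finset.range_mono hM)]
  · apply Finset.prod_congr rfl
    intro c _
    have h1 := h.colLen_eq c
    have h2 := h.colLen_eq (c + 1)
    have h3 := h.skewInd_le c
    rw [turnFactor]
    congr 1
    simp only [ne_eq, eq_iff_iff]
    omega
  · intro c _ hc
    rw [Finset.mem_range, not_lt] at hc
    have h1 := h.colLen_eq c
    have h2 := colLen_eq_zero_of_rowLen_le hc
    rw [turnFactor, if_neg (by omega)]

theorem hlPsi_eq {t : ℝ} {lam mu : YoungDiagram} (h : IsHorizontalStrip lam mu) {M : ℕ}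
    (hM : lam.rowLen 0 ≤ M) :
    hlPsi t lam mu = ∏ c ∈ Finset.range M, turnFactor t (skewInd lam mu (c + 1)) (skewInd lam mu c)
      (mu.colLen c - mu.colLen (c + 1)) := by
  rw [hlPsi, if_pos h, ← Finset.prod_subset (Finset.range_mono hM)]
  · apply Finset.prod_congr rfl
    intro c _
    have h1 := h.colLen_eq c
    have h2 := h.colLen_eq (c + 1)
    have h3 := h.skewInd_le (c + 1)
    rw [turnFactor]
    congr 1
    simp only [ne_eq, eq_iff_iff]
    omega
  · intro c _ hc
    rw [Finset.mem_range, not_lt] at hc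
    have h1 := h.colLen_eq (c + 1)
    have h2 := colLen_eq_zero_of_rowLen_le (show lam.rowLen 0 ≤ c + 1 by omega)
    rw [turnFactor, if_neg (by omega)]

/-- Reversibility of the algorithm: weighted by `ψ φ` of the lower left corner, the algorithm from
left to right has the same law as the reversed algorithm weighted by `φ ψ` of the upper right
corner. All factors are products over the columns, and the local identity `colWt_reversal` moves a
cut, with weight `cutFactor`, past the columns one by one. -/
theorem IsColumnRun.reversal {t : ℝ} (ht0 : 0 ≤ t) (ht1 : t < 1) {lam mu nu rho : YoungDiagram}
    {s : ℕ → ℕ} (R : IsColumnRun lam mu nu rho s) :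
    hlPsi t mu lam * hlPhi t nu lam * ((if s 0 = 0 then 1 else 1 - t) * diagramU t lam mu nu rho) =
      hlPhi t rho mu * hlPsi t rho nu * revDiagramU t lam mu nu rho := by
  have c1 := R.rho_strip.colLen_eq
  have c2 := R.rho_strip'.colLen_eq
  have c3 := R.mu_strip.colLen_eq
  have c4 := R.nu_strip.colLen_eq
  have l1 := R.rho_strip.skewInd_le
  have l2 := R.rho_strip'.skewInd_le
  have l3 := R.mu_strip.skewInd_le
  have l4 := R.nu_strip.skewInd_le
  set M := rho.rowLen 0 with hMdef
  have z0 := colLen_eq_zero_of_rowLen_le (le_refl M)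
  have hmu : mu.rowLen 0 ≤ M + 1 :=
    (rowLen_le_of_colLen_eq_zero (c := M) (by have := c1 M; omega)).trans (by omega)
  have hnu : nu.rowLen 0 ≤ M + 1 :=
    (rowLen_le_of_colLen_eq_zero (c := M) (by have := c2 M; omega)).trans (by omega)
  have hM : rho.rowLen 0 ≤ M + 1 := by omega
  rw [hlPsi_eq R.mu_strip hmu, hlPhi_eq R.nu_strip hnu, hlPhi_eq R.rho_strip hM,
    hlPsi_eq R.rho_strip' hM, R.diagramU_eq (M := M + 1 + 1) (by omega), revDiagramU,
    if_pos R.self, ← show s = _ from funext R.eq_colCarry]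
  -- the columns before the cut at `k` are already reversed
  have key : ∀ k, cutFactor t (skewInd nu lam 0) (skewInd mu lam 0) (s 0) (skewInd rho mu 0) (s 1) *
      ∏ c ∈ Finset.range k,
        (turnFactor t (skewInd mu lam (c + 1)) (skewInd mu lam c)
          (lam.colLen c - lam.colLen (c + 1)) *
        turnFactor t (skewInd nu lam c) (skewInd nu lam (c + 1))
          (nu.colLen c - nu.colLen (c + 1)) * columnWt t lam mu nu rho s (c + 1)) =
      (∏ c ∈ Finset.range k,
        (turnFactor t (skewInd rho mu c) (skewInd rho mu (c + 1))
          (rho.colLen c - rho.colLen (c + 1)) *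
        turnFactor t (skewInd rho nu (c + 1)) (skewInd rho nu c)
          (nu.colLen c - nu.colLen (c + 1)) * revColumnWt t lam mu nu rho s c)) *
      cutFactor t (skewInd nu lam k) (skewInd mu lam k) (s k) (skewInd rho mu k) (s (k + 1)) := by
    intro k
    induction k with
    | zero => simp
    | succ k ih =>
      rw [Finset.prod_range_succ, Finset.prod_range_succ, ← mul_assoc, ih]
      have a1 := lam.colLen_anti k (k + 1) (by omega)
      have a2 := mu.colLen_anti k (k + 1) (by omega)
      have a3 := nu.colLen_anti k (k + 1) (by omega)
      have a4 := rho.colLen_anti k (k + 1) (by omega)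
      have b1 := c1 k
      have b2 := c2 k
      have b3 := c3 k
      have b4 := c4 k
      have d1 := c1 (k + 1)
      have d2 := c2 (k + 1)
      have d3 := c3 (k + 1)
      have d4 := c4 (k + 1)
      have := colWt_reversal ht0 ht1 (R.step k) (R.step (k + 1)) (l4 k) (l3 k) (l1 k) (l2 k)
        (l4 (k + 1)) (l3 (k + 1)) (l1 (k + 1)) (l2 (k + 1))
        (n := lam.colLen k - lam.colLen (k + 1)) (p := rho.colLen k - rho.colLen (k + 1))
        (by omega) (by omega) (by omega)
      rw [show lam.colLen k - lam.colLen (k + 1) + skewInd nu lam k - skewInd nu lam (k + 1) =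
        nu.colLen k - nu.colLen (k + 1) by omega] at this
      rw [columnWt, revColumnWt]
      linear_combination (∏ c ∈ Finset.range k,
        (turnFactor t (skewInd rho mu c) (skewInd rho mu (c + 1))
          (rho.colLen c - rho.colLen (c + 1)) *
        turnFactor t (skewInd rho nu (c + 1)) (skewInd rho nu c)
          (nu.colLen c - nu.colLen (c + 1)) * revColumnWt t lam mu nu rho s c)) * this
  -- the cut disappears beyond the last column; before the first one it is the factor for the input
  have hend : cutFactor t (skewInd nu lam (M + 1)) (skewInd mu lam (M + 1)) (s (M + 1))
      (skewInd rho mu (M + 1)) (s (M + 1 + 1)) = 1 := by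
    have h1 := R.ind_eq_zero (c := M + 1) (by omega)
    have h2 := R.ind_eq_zero (c := M + 1 + 1) (by omega)
    rw [cutFactor, if_neg (by omega), if_pos (by omega)]
  have hstart : (if s 0 = 0 then 1 else 1 - t) * columnWt t lam mu nu rho s 0 =
      cutFactor t (skewInd nu lam 0) (skewInd mu lam 0) (s 0) (skewInd rho mu 0) (s 1) := by
    obtain ⟨e1, e2, e3⟩ := R.step 0
    rw [zero_add] at e1 e2
    have := l1 0
    have := l2 0
    have := l3 0
    have := l4 0
    rw [columnWt, colWt, cutFactor]
    simp only [zero_ne_one, false_and, if_false, false_or, if_true]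
    split_ifs <;> first | (exfalso; omega) | ring1
  have h1 := key (M + 1)
  rw [hend, mul_one, ← hstart] at h1
  simp only [Finset.prod_mul_distrib] at h1
  rw [Finset.prod_range_succ' _ (M + 1)]
  linear_combination h1

/-! ### Stochasticity of the algorithm and of its reverse -/

/-- Beyond the input, the carry drops by one in every column until it vanishes. -/
theorem carry_eq_zero {s a b a' b' : ℕ → ℕ} {r m0 M : ℕ} (h0 : s 0 = r)
    (hstep : ∀ c < M, CarryStep (s c) (a c) (b c) (a' c) (b' c) (s (c + 1)))
    (ha : ∀ c, a c ≤ 1) (ha' : ∀ c, a' c ≤ 1) (hab : ∀ c, m0 ≤ c → a c = 0 ∧ b c = 0) {c : ℕ}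
    (hc : 2 * m0 + r ≤ c) (hcM : c ≤ M) : s c = 0 := by
  have h1 : ∀ k ≤ M, s k ≤ r + min k m0 := by
    intro k hk
    induction k with
    | zero => omega
    | succ k ih =>
      have e := (hstep k (by omega)).1
      have := ih (by omega)
      have := ha k
      have := hab k
      omega
  have h2 : ∀ k, m0 + k ≤ M → s (m0 + k) ≤ r + m0 - k := by
    intro k hk
    induction k with
    | zero => have := h1 m0 (by omega); simpa using by omega
    | succ k ih =>
      obtain ⟨e1, e2, e3⟩ := hstep (m0 + k) (by omega)
      have := ih (by omega)
      have := ha' (m0 + k)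
      have := hab (m0 + k) (by omega)
      rw [← add_assoc]
      omega
  have := h2 (c - m0) (by omega)
  rw [show m0 + (c - m0) = c by omega] at this
  omega

/-- If the scan of the columns `0, …, M - 1` from left to right with input `r` and output columns
`S` has positive probability, its output is a Young diagram, obtained from `μ` by adding a box to
every column in `S`. That its columns decrease is `le_of_colWt_ne_zero`. The bound on `M` ensures
that the carry has vanished before the scan ends. -/
theorem exists_diagram_of_scanProb_ne_zero {t : ℝ} {lam mu nu : YoungDiagram}
    (hmu : IsHorizontalStrip mu lam) (hnu : IsHorizontalStrip nu lam) {r m0 M : ℕ}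
    (hm0 : ∀ c, m0 ≤ c → mu.colLen c = 0 ∧ nu.colLen c = 0) (hM : 2 * m0 + r + 1 ≤ M)
    {S : Finset ℕ} (hS : S ⊆ Finset.range M)
    (h : ∀ c < M, scanProb t 0 1 0 r (fun c => lam.colLen (c - 1) - lam.colLen c) (skewInd nu lam)
      (skewInd mu lam) S c ≠ 0) :
    ∃ rho : YoungDiagram, (∀ c, rho.colLen c = mu.colLen c + if c ∈ S then 1 else 0) ∧
      IsColumnRun lam mu nu rho (scanCarry r (skewInd nu lam) S) := by
  set s := scanCarry r (skewInd nu lam) S with hs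
  have cmu := hmu.colLen_eq
  have cnu := hnu.colLen_eq
  have lmu := hmu.skewInd_le
  have lnu := hnu.skewInd_le
  have hz : ∀ c, m0 ≤ c → skewInd nu lam c = 0 ∧ skewInd mu lam c = 0 ∧ lam.colLen c = 0 := by
    intro c hc
    have := hm0 c hc
    have := cmu c
    have := cnu c
    omega
  have hSle : ∀ c, (if c ∈ S then 1 else 0) ≤ 1 := fun c => by split_ifs <;> omega
  have hstep0 := fun c hc => carryStep_of_scanProb_ne_zero (h c hc)
  rw [← hs] at hstep0
  have hsz : ∀ c, 2 * m0 + r ≤ c → c ≤ M → s c = 0 := fun c hc hc' =>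
    carry_eq_zero rfl (fun c hc => (hstep0 c hc).1) lnu hSle
      (fun c hc => ⟨(hz c hc).1, (hz c hc).2.1⟩) hc hc'
  have hnot : ∀ c, 2 * m0 + r ≤ c → c ∉ S := by
    intro c hc hcS
    have h1 := Finset.mem_range.1 (hS hcS)
    have h2 := (hstep0 c h1).1.1
    rw [if_pos hcS, hsz c hc h1.le] at h2
    have := hz c (by omega)
    omega
  have hsz' : ∀ c, 2 * m0 + r ≤ c → s c = 0 := by
    intro c hc
    by_cases hcM : c ≤ M
    · exact hsz c hc hcM
    · obtain ⟨k, rfl⟩ : ∃ k, c = M + k := ⟨c - M, by omega⟩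
      clear hcM hc
      induction k with
      | zero => exact hsz _ (by omega) (by omega)
      | succ k ih =>
        rw [← add_assoc, hs, scanCarry, ← hs, ih, (hz _ (by omega)).1]
        simp
  -- the second output, forced by conservation of boxes
  set b' : ℕ → ℕ := fun c => skewInd mu lam c + s c - s (c + 1) with hb'
  have hstep : ∀ c, CarryStep (s c) (skewInd nu lam c) (skewInd mu lam c)
      (if c ∈ S then 1 else 0) (b' c) (s (c + 1)) ∧ b' c ≤ 1 := by
    intro c
    by_cases hc : c < M
    · exact hstep0 c hc
    · simp only [hb', hsz' c (by omega), hsz' (c + 1) (by omega), (hz c (by omega)).1,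
        (hz c (by omega)).2.1, hnot c (by omega), if_false]
      simp [CarryStep]
  have hanti : Antitone fun c => mu.colLen c + if c ∈ S then 1 else 0 := by
    apply antitone_nat_of_succ_le
    intro c
    have := mu.colLen_anti c (c + 1) (by omega)
    by_cases hc : c + 1 < M
    · have hw := h (c + 1) hc
      simp only [scanProb, stepProb] at hw
      have hw' := left_ne_zero_of_mul (a := colWt _ _ _ _ _ _ _ _ _) (b := 1)
        (by rw [mul_one]; exact fun hz => hw (by rw [hz, ite_self]))
      have h1 := lam.colLen_anti c (c + 1) (by omega)
      have h2 := nu.colLen_anti c (c + 1) (by omega)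
      have := cmu c
      have := cmu (c + 1)
      have := cnu c
      have := cnu (c + 1)
      simp only [Nat.add_sub_cancel] at hw'
      have := le_of_colWt_ne_zero (hstep c).1 (hstep (c + 1)).1 (lnu c) (lmu c) (hSle c)
        (hstep c).2 (lnu _) (lmu _) (hSle _) (hstep (c + 1)).2 (by omega) (by omega) hw'
      omega
    · have := hnot (c + 1) (by omega)
      rw [if_neg this]
      omega
  have hcol := colLen_diagramOfCols (M := M) hanti (fun c hc => by
    simp only [(hm0 c (by omega)).1, hnot c (by omega), if_false])
  generalize diagramOfCols M (fun c => mu.colLen c + if c ∈ S then 1 else 0) = rho at hcol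
  refine ⟨rho, hcol, ?_⟩
  obtain ⟨i1, i2⟩ := isHorizontalStrip_of_colLen hcol hSle
  obtain ⟨i3, i4⟩ := isHorizontalStrip_of_colLen (lam := nu) (mu := rho) (f := b') (fun c => by
    have e1 := hcol c
    have e2 := (hstep c).1.1
    have e3 := (hstep c).1.2.1
    have := cmu c
    have := cnu c
    omega) fun c => (hstep c).2
  exact ⟨hmu, hnu, i1, i3, fun c => by rw [i2, i4]; exact (hstep c).1⟩

/-- The column weights of a run are those of its scan. -/
theorem IsColumnRun.scan_eq {t : ℝ} {lam mu nu rho : YoungDiagram} {s : ℕ → ℕ}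
    (R : IsColumnRun lam mu nu rho s) {S : Finset ℕ}
    (hS : ∀ c, skewInd rho mu c = if c ∈ S then 1 else 0) (c : ℕ) :
    s c = scanCarry (s 0) (skewInd nu lam) S c ∧
    scanProb t 0 1 0 (s 0) (fun c => lam.colLen (c - 1) - lam.colLen c) (skewInd nu lam)
      (skewInd mu lam) S c = columnWt t lam mu nu rho s c := by
  have h1 : ∀ c, s c = scanCarry (s 0) (skewInd nu lam) S c := by
    intro c
    induction c with
    | zero => rfl
    | succ c ih =>
      have := (R.step c).1
      rw [hS] at this
      rw [scanCarry, ← ih]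
      omega
  refine ⟨h1 c, ?_⟩
  have h2 := R.step c
  have h3 := R.rho_strip'.skewInd_le c
  obtain ⟨e1, e2, e3⟩ := h2
  cases c with
  | zero =>
    simp only [scanProb, columnWt, ← hS]
    rw [stepProb, if_pos, colWt, colWt]
    · simp
    · rw [CarryStep]
      omega
  | succ c =>
    simp only [scanProb, columnWt, ← hS, ← h1]
    have e4 := (R.step c).2.1
    rw [stepProb, if_pos, show skewInd mu lam c + s c - s (c + 1) = skewInd rho nu c by omega]
    · simp
    · rw [CarryStep]
      omega

/-- A finite sum computes an infinite one if their nonzero terms correspond to each other under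
`φ`. -/
theorem hasSum_of_finset_sum {α β : Type*} {g : α → ℝ} {f : β → ℝ} (F : Finset β) (φ : α → β)
    (hinj : ∀ x y, g x ≠ 0 → g y ≠ 0 → φ x = φ y → x = y)
    (h1 : ∀ x, g x ≠ 0 → φ x ∈ F ∧ f (φ x) = g x)
    (h2 : ∀ y ∈ F, f y ≠ 0 → ∃ x, g x ≠ 0 ∧ φ x = y) : HasSum g (∑ y ∈ F, f y) := by
  classical
  have h3 : HasSum (fun y => if y ∈ F then f y else 0) (∑ y ∈ F, f y) := by
    have := hasSum_sum_of_ne_finset_zero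
      (L := SummationFilter.unconditional β) (f := fun y => if y ∈ F then f y else 0) (s := F)
      (fun y hy => if_neg hy)
    rwa [Finset.sum_congr rfl fun y hy => if_pos hy] at this
  refine (hasSum_iff_hasSum_of_ne_zero_bij (fun x => φ x.1)
    (fun x y hxy => Subtype.ext (hinj _ _ x.2 y.2 hxy)) ?_ ?_).1 h3
  · intro y hy
    rw [Function.mem_support] at hy
    have hyF : y ∈ F := by
      by_contra hc
      exact hy (if_neg hc)
    rw [if_pos hyF] at hy
    obtain ⟨x, hx, hxy⟩ := h2 y hyF hy
    exact ⟨⟨x, hx⟩, hxy⟩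
  · rintro ⟨x, hx⟩
    obtain ⟨h4, h5⟩ := h1 x hx
    rw [← h5]
    exact if_pos h4

open Classical in
/-- The algorithm is stochastic: for `f = 1` the total weight of all outputs is `1` by
`stepProb_sum`. The refinement by the output in the first column gives the law of the first
column. -/
theorem hasSum_diagramU_mul {t : ℝ} (ht0 : 0 ≤ t) (ht1 : t < 1) {lam mu nu : YoungDiagram}
    (hmu : IsHorizontalStrip mu lam) (hnu : IsHorizontalStrip nu lam) (r : ℕ) (f : Prop → ℝ) :
    HasSum (fun rho => f (skewInd rho mu 0 = 1) *
        if colCarry lam mu nu rho 0 = r then diagramU t lam mu nu rho else 0)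
      (f False * stepProb t 0 1 0 0 (skewInd nu lam 0) (skewInd mu lam 0) r 0 +
        f True * stepProb t 0 1 0 0 (skewInd nu lam 0) (skewInd mu lam 0) r 1) := by
  obtain ⟨m0, hm0⟩ : ∃ m0, ∀ c, m0 ≤ c → mu.colLen c = 0 ∧ nu.colLen c = 0 :=
    ⟨max (mu.rowLen 0) (nu.rowLen 0), fun c hc => ⟨colLen_eq_zero_of_rowLen_le (by omega),
      colLen_eq_zero_of_rowLen_le (by omega)⟩⟩
  set M := 2 * m0 + r with hM
  set w := scanProb t 0 1 0 r (fun c => lam.colLen (c - 1) - lam.colLen c) (skewInd nu lam)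
    (skewInd mu lam) with hw
  have hmain := sum_scanProb_mul ht0 ht1 (pa := 0) (pb := 1) (ps := 0) (r := r)
    (n := fun c => lam.colLen (c - 1) - lam.colLen c) hnu.skewInd_le hmu.skewInd_le
    (fun c => by
      have := hmu.colLen_eq c
      have := hmu.colLen_eq (c + 1)
      have := mu.colLen_anti c (c + 1) (by omega)
      simp only [Nat.add_sub_cancel]
      omega) f M
  simp only [← hw, zero_tsub, tsub_self] at hmain
  rw [← hmain]
  set g : YoungDiagram → ℝ := fun rho => f (skewInd rho mu 0 = 1) *
        if colCarry lam mu nu rho 0 = r then diagramU t lam mu nu rho else 0 with hg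
  set φ : YoungDiagram → Finset ℕ :=
    fun rho => (Finset.range (M + 1)).filter fun c => skewInd rho mu c = 1 with hφ
  -- a diagram that contributes is a run with input `r`, and the columns it adds are before `M`
  have hrun : ∀ rho, g rho ≠ 0 → IsColumnRun lam mu nu rho (colCarry lam mu nu rho) ∧
      colCarry lam mu nu rho 0 = r := by
    intro rho h
    have h1 : colCarry lam mu nu rho 0 = r := by
      by_contra hc
      exact h (by simp only [hg, if_neg hc, mul_zero])
    refine ⟨?_, h1⟩
    by_contra hc
    exact h (by simp only [hg, diagramU, if_neg hc, ite_self, mul_zero])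
  -- the weight of an output is that of the scan with its columns as output columns
  have key : ∀ rho s, IsColumnRun lam mu nu rho s → s 0 = r →
      (∀ c, skewInd rho mu c = if c ∈ φ rho then 1 else 0) ∧
        f (0 ∈ φ rho) * ∏ c ∈ Finset.range (M + 1), w (φ rho) c = g rho := by
    intro rho s R hr
    have hbig : ∀ c, M ≤ c → skewInd rho mu c = 0 := by
      intro c hc
      have hz : ∀ c, m0 ≤ c → skewInd nu lam c = 0 ∧ skewInd mu lam c = 0 := by
        intro c hc
        have := hm0 c hc
        have := hmu.colLen_eq c
        have := hnu.colLen_eq c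
        omega
      have h1 := carry_eq_zero hr (fun c _ => R.step c) hnu.skewInd_le R.rho_strip.skewInd_le hz
        hc (le_refl c)
      have h2 := (R.step c).1
      have := hz c (by omega)
      omega
    have hind : ∀ c, skewInd rho mu c = if c ∈ φ rho then 1 else 0 := by
      intro c
      simp only [hφ, Finset.mem_filter, Finset.mem_range]
      have := hbig c
      have := R.rho_strip.skewInd_le c
      split_ifs <;> omega
    refine ⟨hind, ?_⟩
    have hrow : rho.rowLen 0 ≤ M + 1 := by
      apply rowLen_le_of_colLen_eq_zero
      have := R.rho_strip.colLen_eq (M + 1)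
      have := hm0 (M + 1) (by omega)
      have := hbig (M + 1) (by omega)
      omega
    simp only [hg]
    rw [← R.eq_colCarry 0, if_pos hr, R.diagramU_eq hrow]
    congr 1
    · congr 1
      simp only [hφ, Finset.mem_filter, Finset.mem_range]
      simp
    · apply Finset.prod_congr rfl
      intro c _
      rw [← (R.scan_eq hind c).2, hr]
  apply hasSum_of_finset_sum _ φ
  · intro x y hx hy hxy
    obtain ⟨R, hr⟩ := hrun x hx
    obtain ⟨R', hr'⟩ := hrun y hy
    apply YoungDiagram.ext_colLen
    intro c
    rw [R.rho_strip.colLen_eq, R'.rho_strip.colLen_eq, (key x _ R hr).1, (key y _ R' hr').1, hxy]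
  · intro x hx
    obtain ⟨R, hr⟩ := hrun x hx
    exact ⟨Finset.mem_powerset.2 (Finset.filter_subset _ _), (key x _ R hr).2⟩
  · intro S hS hne
    rw [Finset.mem_powerset] at hS
    have hw0 : ∀ c < M + 1, w S c ≠ 0 := fun c hc =>
      Finset.prod_ne_zero_iff.1 (right_ne_zero_of_mul hne) c (Finset.mem_range.2 hc)
    obtain ⟨rho, hcol, R⟩ := exists_diagram_of_scanProb_ne_zero hmu hnu hm0 (by omega) hS hw0
    have hφS : φ rho = S := by
      ext c
      simp only [hφ, Finset.mem_filter, skewInd, hcol, add_tsub_cancel_left]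
      refine ⟨fun h => ?_, fun h => ⟨hS h, if_pos h⟩⟩
      by_contra hc
      rw [if_neg hc] at h
      omega
    refine ⟨rho, ?_, hφS⟩
    rw [← (key rho _ R rfl).2, hφS]
    exact hne

/-- If the scan from right to left that starts from `ρ` with output columns `S`, counted from the
right, has positive probability, it ends in a Young diagram `λ`, obtained from `ν` by removing the
boxes in these columns, and the reversed data are a run of the algorithm. -/
theorem exists_diagram_of_revScanProb_ne_zero {t : ℝ} {mu nu rho : YoungDiagram}
    (hmu : IsHorizontalStrip rho mu) (hnu : IsHorizontalStrip rho nu) {M : ℕ}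
    (hM : rho.rowLen 0 = M) {S : Finset ℕ} (hS : S ⊆ Finset.range (M + 1))
    (h : ∀ c < M + 1, scanProb t 0 0 0 0 (fun k => rho.colLen (M - k) - rho.colLen (M - k + 1))
      (fun k => skewInd rho mu (M - k)) (fun k => skewInd rho nu (M - k)) S c ≠ 0) :
    ∃ lam : YoungDiagram,
      (∀ c, nu.colLen c = lam.colLen c + if c ≤ M ∧ M - c ∈ S then 1 else 0) ∧
      IsColumnRun lam mu nu rho
        fun c => scanCarry 0 (fun k => skewInd rho mu (M - k)) S (M + 1 - c) := by
  set s := scanCarry 0 (fun k => skewInd rho mu (M - k)) S with hs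
  have cmu := hmu.colLen_eq
  have cnu := hnu.colLen_eq
  have lmu := hmu.skewInd_le
  have lnu := hnu.skewInd_le
  have hz : ∀ c, M ≤ c → skewInd rho mu c = 0 ∧ skewInd rho nu c = 0 ∧ rho.colLen c = 0 ∧
      mu.colLen c = 0 ∧ nu.colLen c = 0 := by
    intro c hc
    have := colLen_eq_zero_of_rowLen_le (hM.trans_le hc)
    have := cmu c
    have := cnu c
    omega
  -- the boxes of `ν/λ` and, by conservation of boxes, those of `μ/λ`
  set a : ℕ → ℕ := fun c => if c ≤ M ∧ M - c ∈ S then 1 else 0 with ha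
  set b : ℕ → ℕ := fun c => if c ≤ M then skewInd rho nu c + s (M - c) - s (M + 1 - c) else 0
    with hb
  have hale : ∀ c, a c ≤ 1 := fun c => by simp only [ha]; split_ifs <;> omega
  have hstep0 : ∀ c ≤ M, CarryStep (s (M - c)) (skewInd rho mu c) (skewInd rho nu c) (a c) (b c)
      (s (M + 1 - c)) ∧ b c ≤ 1 := by
    intro c hc
    have := carryStep_of_scanProb_ne_zero (h (M - c) (by omega))
    rw [← hs, show M - (M - c) = c by omega, show M - c + 1 = M + 1 - c by omega] at this
    simp only [ha, hb, hc, true_and, if_true]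
    exact this
  have hstep : ∀ c, CarryStep (s (M + 1 - (c + 1))) (skewInd rho mu c) (skewInd rho nu c) (a c)
      (b c) (s (M + 1 - c)) ∧ b c ≤ 1 := by
    intro c
    by_cases hc : c ≤ M
    · rw [show M + 1 - (c + 1) = M - c by omega]
      exact hstep0 c hc
    · simp only [ha, hb, hc, false_and, if_false, (hz c (by omega)).1, (hz c (by omega)).2.1]
      rw [show M + 1 - (c + 1) = 0 by omega, show M + 1 - c = 0 by omega]
      simp [CarryStep, hs, scanCarry]
  have h0 : a M = 0 ∧ b M = 0 := by
    have h1 := (hstep M).1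
    rw [show M + 1 - (M + 1) = 0 by omega, show s 0 = 0 from rfl, (hz M le_rfl).1,
      (hz M le_rfl).2.1] at h1
    have := h1.1
    have := h1.2.1
    omega
  -- the columns that `λ` has to have decrease
  have hdec : ∀ c, a c + skewInd rho nu c + rho.colLen (c + 1) ≤
      rho.colLen c + a (c + 1) + skewInd rho nu (c + 1) := by
    intro c
    have := rho.colLen_anti c (c + 1) (by omega)
    by_cases hc : c < M
    · have hw := h (M - c) (by omega)
      obtain ⟨k, hk⟩ : ∃ k, M - c = k + 1 := ⟨M - c - 1, by omega⟩
      have hkc : M - k = c + 1 := by omega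
      rw [hk] at hw
      simp only [scanProb, stepProb] at hw
      have hw' := left_ne_zero_of_mul (a := colWt _ _ _ _ _ _ _ _ _) (b := 1)
        (by rw [mul_one]; exact fun hz => hw (by rw [hz, ite_self]))
      rw [← hs, ← hk, show M - (M - c) = c by omega, hkc, hk, show k = M - (c + 1) by omega] at hw'
      have e1 := (hstep (c + 1)).1
      have e2 := (hstep c).1
      rw [show M + 1 - (c + 1 + 1) = M - (c + 1) by omega] at e1
      rw [show M + 1 - (c + 1) = M - (c + 1) + 1 by omega] at e1 e2
      have h1 := mu.colLen_anti c (c + 1) (by omega)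
      have h2 := nu.colLen_anti c (c + 1) (by omega)
      have := cmu c
      have := cmu (c + 1)
      have := cnu c
      have := cnu (c + 1)
      have := le_of_colWt_ne_zero (t := t) (n := rho.colLen c - rho.colLen (c + 1)) e1 e2 (lmu _)
        (lnu _) (hale _) (hstep _).2 (lmu _) (lnu _) (hale _) (hstep _).2 (by omega) (by omega) (by
          convert hw' using 2
          · simp only [ha, show c + 1 ≤ M by omega, true_and]
          · simp only [hb, if_pos (show c + 1 ≤ M by omega)]
            rw [show M + 1 - (c + 1) = M - (c + 1) + 1 by omega]
          · simp only [ha, hc.le, true_and, show M - c = M - (c + 1) + 1 by omega])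
      omega
    · have := hz c (by omega)
      have := hz (c + 1) (by omega)
      have : a c = 0 := by
        rcases (not_lt.1 hc).eq_or_lt with rfl | hlt
        · exact h0.1
        · simp only [ha]
          rw [if_neg (by omega)]
      omega
  -- they vanish in the end and decrease, so they are not negative
  have hnn : ∀ k c, c + k = M → a c + skewInd rho nu c ≤ rho.colLen c := by
    intro k
    induction k with
    | zero =>
      rintro c rfl
      have := hz _ (le_refl (c + 0))
      rw [add_zero] at *
      omega
    | succ k ih =>
      intro c hc
      have := ih (c + 1) (by omega)
      have := hdec c
      omega
  have hnn' : ∀ c, a c + skewInd rho nu c ≤ rho.colLen c := by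
    intro c
    by_cases hc : c ≤ M
    · exact hnn (M - c) c (by omega)
    · have := hz c (by omega)
      simp only [ha]
      rw [if_neg (by omega)]
      omega
  have hcol := colLen_diagramOfCols (M := M) (f := fun c => rho.colLen c - skewInd rho nu c - a c)
    (antitone_nat_of_succ_le fun c => by
      have := hdec c
      have := hnn' c
      have := hnn' (c + 1)
      omega)
    (fun c hc => by rw [(hz c hc).2.2.1]; omega)
  generalize diagramOfCols M (fun c => rho.colLen c - skewInd rho nu c - a c) = lam at hcol
  have hnul : ∀ c, nu.colLen c = lam.colLen c + a c := fun c => by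
    have := hcol c
    have := hnn' c
    have := cnu c
    omega
  refine ⟨lam, hnul, ?_⟩
  obtain ⟨i1, i2⟩ := isHorizontalStrip_of_colLen hnul hale
  obtain ⟨i3, i4⟩ := isHorizontalStrip_of_colLen (lam := lam) (mu := mu) (f := b) (fun c => by
    have := hcol c
    have := hnn' c
    have e2 := (hstep c).1.1
    have e3 := (hstep c).1.2.1
    have := cmu c
    have := cnu c
    omega) fun c => (hstep c).2
  exact ⟨i3, i1, hmu, hnu, fun c => by
    rw [i2, i4]; exact (hstep c).1.symm (lmu c) (hale c)⟩

/-- The reversed column weights of a run are those of its scan from right to left. -/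
theorem IsColumnRun.revScan_eq {t : ℝ} {lam mu nu rho : YoungDiagram} {s : ℕ → ℕ}
    (R : IsColumnRun lam mu nu rho s) {M : ℕ} (hM : rho.rowLen 0 = M) {S : Finset ℕ}
    (hS : ∀ c ≤ M, skewInd nu lam c = if M - c ∈ S then 1 else 0) {k : ℕ} (hk : k ≤ M) :
    s (M + 1 - k) = scanCarry 0 (fun k => skewInd rho mu (M - k)) S k ∧
    scanProb t 0 0 0 0 (fun k => rho.colLen (M - k) - rho.colLen (M - k + 1))
      (fun k => skewInd rho mu (M - k)) (fun k => skewInd rho nu (M - k)) S k =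
      revColumnWt t lam mu nu rho s (M - k) := by
  have hz : ∀ c, M ≤ c → _ := fun c hc => R.ind_eq_zero (hM.trans_le hc)
  have h1 : ∀ k ≤ M + 1, s (M + 1 - k) = scanCarry 0 (fun k => skewInd rho mu (M - k)) S k := by
    intro k hk
    induction k with
    | zero => exact (hz _ (by omega)).2.2.2.2
    | succ k ih =>
      have h2 := (R.step (M - k)).1
      have h3 := hS (M - k) (by omega)
      rw [show M - (M - k) = k by omega] at h3
      rw [h3, show M - k + 1 = M + 1 - k by omega] at h2
      rw [scanCarry, ← ih (by omega), show M + 1 - (k + 1) = M - k by omega]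
      omega
  refine ⟨h1 k (by omega), ?_⟩
  have e := (R.step (M - k)).symm (R.nu_strip.skewInd_le _) (R.rho_strip.skewInd_le _)
  have e4 := R.mu_strip.skewInd_le (M - k)
  obtain ⟨e1, e2, e3⟩ := e
  have hSk := hS (M - k) (by omega)
  rw [show M - (M - k) = k by omega] at hSk
  cases k with
  | zero =>
    simp only [scanProb, revColumnWt, tsub_zero] at *
    rw [← hSk, stepProb, if_pos]
    · have h2 := hz M le_rfl
      rw [colWt_eq_one (by omega), colWt_eq_one (by omega)]
    · have h2 := hz M le_rfl
      have h3 := hz (M + 1) (by omega)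
      rw [CarryStep]
      omega
  | succ k =>
    have hSk' := hS (M - k) (by omega)
    rw [show M - (M - k) = k by omega] at hSk'
    have e5 : skewInd rho nu (M - (k + 1) + 1) + s (M - (k + 1) + 2) =
      skewInd mu lam (M - (k + 1) + 1) + s (M - (k + 1) + 1) := (R.step (M - (k + 1) + 1)).2.1
    simp only [scanProb, revColumnWt]
    rw [← hSk, ← hSk', ← h1 k (by omega), ← h1 (k + 1) (by omega),
      show M - k = M - (k + 1) + 1 by omega] at *
    rw [show M + 1 - k = M - (k + 1) + 2 by omega, show M + 1 - (k + 1) = M - (k + 1) + 1 by omega]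
    rw [stepProb, if_pos]
    · congr 1
      have := R.mu_strip.skewInd_le (M - (k + 1) + 1)
      omega
    · rw [CarryStep]
      omega

/-- The reversed algorithm is stochastic, by the same argument with the columns read from right to
left. -/
theorem hasSum_revDiagramU {t : ℝ} (ht0 : 0 ≤ t) (ht1 : t < 1) {mu nu rho : YoungDiagram}
    (hmu : IsHorizontalStrip rho mu) (hnu : IsHorizontalStrip rho nu) :
    HasSum (fun lam => revDiagramU t lam mu nu rho) 1 := by
  obtain ⟨M, hM⟩ : ∃ M, rho.rowLen 0 = M := ⟨_, rfl⟩
  set w := scanProb t 0 0 0 0 (fun k => rho.colLen (M - k) - rho.colLen (M - k + 1))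
      (fun k => skewInd rho mu (M - k)) (fun k => skewInd rho nu (M - k)) with hw
  have hz := colLen_eq_zero_of_rowLen_le hM.le
  have hmain := sum_scanProb ht0 ht1 (pa := 0) (pb := 0) (ps := 0) (r := 0)
    (n := fun k => rho.colLen (M - k) - rho.colLen (M - k + 1))
    (a := fun k => skewInd rho mu (M - k)) (b := fun k => skewInd rho nu (M - k))
    (fun k => hmu.skewInd_le _) (fun k => hnu.skewInd_le _)
    (fun k => by
      have := hnu.colLen_eq (M - (k + 1))
      have := hnu.colLen_eq (M - (k + 1) + 1)
      have := nu.colLen_anti (M - (k + 1)) (M - (k + 1) + 1) (by omega)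
      by_cases hk : k < M
      · rw [show M - k = M - (k + 1) + 1 by omega]
        omega
      · rw [show M - k = M - (k + 1) by omega]
        omega)
    (fun h1 h2 => by
      simp only [tsub_zero] at h1
      have := hmu.colLen_eq M
      omega) (M + 1)
  rw [← hw] at hmain
  rw [← hmain]
  set φ : YoungDiagram → Finset ℕ :=
    fun lam => (Finset.range (M + 1)).filter fun k => skewInd nu lam (M - k) = 1 with hφ
  have hrun : ∀ lam, revDiagramU t lam mu nu rho ≠ 0 →
      IsColumnRun lam mu nu rho (colCarry lam mu nu rho) := by
    intro lam h
    by_contra hc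
    exact h (if_neg hc)
  have key : ∀ lam s, IsColumnRun lam mu nu rho s →
      (∀ c, skewInd nu lam c = if c ≤ M ∧ M - c ∈ φ lam then 1 else 0) ∧
        ∏ c ∈ Finset.range (M + 1), w (φ lam) c = revDiagramU t lam mu nu rho := by
    intro lam s R
    have hind : ∀ c, skewInd nu lam c = if c ≤ M ∧ M - c ∈ φ lam then 1 else 0 := by
      intro c
      simp only [hφ, Finset.mem_filter, Finset.mem_range]
      have := R.nu_strip.skewInd_le c
      by_cases hc : c ≤ M
      · rw [show M - (M - c) = c by omega]
        split_ifs <;> omega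
      · rw [if_neg (by omega)]
        exact (R.ind_eq_zero (by omega)).1
    refine ⟨hind, ?_⟩
    rw [revDiagramU, if_pos R.self, hM, ← Finset.prod_range_reflect]
    apply Finset.prod_congr rfl
    intro k hk
    rw [Finset.mem_range] at hk
    rw [show M + 1 - 1 - k = M - k by omega, hw,
      (R.self.revScan_eq hM (S := φ lam) (fun c hc => by rw [hind c]; simp only [hc, true_and])
        (Nat.sub_le M k)).2, show M - (M - k) = k by omega]
  apply hasSum_of_finset_sum _ φ
  · intro x y hx hy hxy
    have R := hrun x hx
    have R' := hrun y hy
    apply YoungDiagram.ext_colLen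
    intro c
    have h1 := R.nu_strip.colLen_eq c
    have h2 := R'.nu_strip.colLen_eq c
    rw [(key x _ R).1, hxy, ← (key y _ R').1] at h1
    omega
  · intro x hx
    exact ⟨Finset.mem_powerset.2 (Finset.filter_subset _ _), (key x _ (hrun x hx)).2⟩
  · intro S hS hne
    rw [Finset.mem_powerset] at hS
    have hw0 : ∀ c < M + 1, w S c ≠ 0 := fun c hc =>
      Finset.prod_ne_zero_iff.1 hne c (Finset.mem_range.2 hc)
    obtain ⟨lam, hcol, R⟩ := exists_diagram_of_revScanProb_ne_zero hmu hnu hM hS hw0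
    have hφS : φ lam = S := by
      ext k
      simp only [hφ, Finset.mem_filter, skewInd, hcol, add_tsub_cancel_left, Finset.mem_range]
      constructor
      · rintro ⟨h1, h2⟩
        by_contra hc
        rw [show M - (M - k) = k by omega, if_neg (fun h => hc h.2)] at h2
        omega
      · intro h
        have := Finset.mem_range.1 (hS h)
        rw [show M - (M - k) = k by omega, if_pos ⟨by omega, h⟩]
        exact ⟨this, rfl⟩
    refine ⟨lam, ?_, hφS⟩
    rw [← (key lam _ R).2, hφS]
    exact hne

/-- The Cauchy identity behind the algorithm: up to the factor for a positive input, the algorithm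
transports the weights `ψ φ` from the lower left to the upper right corner. After reversal only the
total weight of the reversed algorithm is left. -/
theorem hasSum_diagramU_cauchy {t : ℝ} (ht0 : 0 ≤ t) (ht1 : t < 1) (mu nu rho : YoungDiagram) :
    HasSum (fun lam => hlPsi t mu lam * hlPhi t nu lam *
        ((if colCarry lam mu nu rho 0 = 0 then 1 else 1 - t) * diagramU t lam mu nu rho))
      (hlPhi t rho mu * hlPsi t rho nu) := by
  by_cases h : IsHorizontalStrip rho mu ∧ IsHorizontalStrip rho nu
  · have h1 := (hasSum_revDiagramU ht0 ht1 h.1 h.2).mul_left (hlPhi t rho mu * hlPsi t rho nu)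
    rw [mul_one] at h1
    refine (congrArg (fun f => HasSum f _) (funext fun lam => ?_)).mpr h1
    by_cases R : IsColumnRun lam mu nu rho (colCarry lam mu nu rho)
    · exact R.reversal ht0 ht1
    · rw [diagramU, revDiagramU, if_neg R, if_neg R, mul_zero, mul_zero, mul_zero]
  · have h1 : hlPhi t rho mu * hlPsi t rho nu = 0 := by
      rw [hlPhi, hlPsi]
      split_ifs with h2 h3
      · exact absurd ⟨h2, h3⟩ h
      all_goals simp
    rw [h1]
    refine (congrArg (fun f => HasSum f _) (funext fun lam => ?_)).mpr hasSum_zero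
    rw [diagramU_eq_zero fun R => h ⟨R.rho_strip, R.rho_strip'⟩, mul_zero, mul_zero]

/-- The joint probability of the input and the output of a step of the algorithm, where the input
has parameter `u` and is determined by the numbers of boxes. -/
def stepLaw (t u : ℝ) (lam mu nu rho : YoungDiagram) : ℝ :=
  inputProb t u (colCarry lam mu nu rho 0) * diagramU t lam mu nu rho

/-- The Cauchy identity with the variables `x` of `ψ` and `y` of `φ`. -/
theorem hasSum_stepLaw_cauchy {t : ℝ} (ht0 : 0 ≤ t) (ht1 : t < 1) (x y : ℝ)
    (mu nu rho : YoungDiagram) :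
    HasSum (fun lam => (hlPsi t mu lam * x ^ (mu.card - lam.card)) *
        (hlPhi t nu lam * y ^ (nu.card - lam.card)) * stepLaw t (y * x) lam mu nu rho)
      ((1 - y * x) / (1 - t * (y * x)) * ((hlPhi t rho mu * y ^ (rho.card - mu.card)) *
        (hlPsi t rho nu * x ^ (rho.card - nu.card)))) := by
  have h1 := (hasSum_diagramU_cauchy ht0 ht1 mu nu rho).mul_left ((1 - y * x) / (1 - t * (y * x)) *
    (y ^ (rho.card - mu.card) * x ^ (rho.card - nu.card)))
  rw [show ∀ A B C D E : ℝ, A * ((C * D) * (E * B)) = A * (D * B) * (C * E) by intros; ring]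
  refine (congrArg (fun f => HasSum f _) (funext fun lam => ?_)).mpr h1
  by_cases R : IsColumnRun lam mu nu rho (colCarry lam mu nu rho)
  · obtain ⟨e1, e2, e3, e4, e5, e6⟩ := R.card_eq
    rw [stepLaw, inputProb, show rho.card - mu.card =
      (nu.card - lam.card) + colCarry lam mu nu rho 0 by omega, show rho.card - nu.card =
      (mu.card - lam.card) + colCarry lam mu nu rho 0 by omega, pow_add, pow_add, mul_pow]
    ring
  · rw [stepLaw, diagramU, if_neg R]
    ring

/-! ### Signatures and Young diagrams -/

/-- The signature of length `N` that represents a Young diagram with at most `N` rows. -/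
def diagramSig (N : ℕ) (lam : YoungDiagram) : Signature N :=
  ⟨fun c => lam.rowLen c, fun c d h => Nat.cast_le.2 (lam.rowLen_anti c d h)⟩

theorem Represents.eq_diagramSig {N : ℕ} {s : Signature N} {lam : YoungDiagram}
    (h : Represents s lam) : s = diagramSig N lam :=
  Subtype.ext (funext h.1)

theorem represents_diagramSig {N : ℕ} {lam : YoungDiagram} (h : lam.colLen 0 ≤ N) :
    Represents (diagramSig N lam) lam := ⟨fun _ => rfl, h⟩

theorem card_filter_fin_val_lt {N k : ℕ} (hk : k ≤ N) :
    (Finset.univ.filter fun c : Fin N => (c : ℕ) < k).card = k := by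
  rw [Fin.card_filter_val_lt]
  exact min_eq_right hk

theorem Represents.colCount_eq {N : ℕ} {s : Signature N} {lam : YoungDiagram}
    (h : Represents s lam) (q : ℤ) : colCount s.1 q = if q < 0 then N else lam.colLen q.toNat := by
  rw [h.eq_diagramSig, colCount]
  split_ifs with hq
  · rw [Finset.filter_true_of_mem]
    · simp
    · intro c _
      simp only [diagramSig]
      omega
  · obtain ⟨k, rfl⟩ := Int.eq_ofNat_of_zero_le (not_lt.1 hq)
    rw [Int.toNat_natCast]
    have h1 := lam.colLen_anti 0 k (Nat.zero_le k)
    refine Eq.trans ?_ (card_filter_fin_val_lt (h1.trans h.2))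
    congr 1
    ext c
    simp only [diagramSig, Finset.mem_filter, Finset.mem_univ, true_and, Nat.cast_lt]
    rw [← YoungDiagram.mem_iff_lt_rowLen, YoungDiagram.mem_iff_lt_colLen]

theorem represents_of_colCount_eq {N : ℕ} {s : Signature N} {lam : YoungDiagram}
    (h : ∀ q : ℤ, colCount s.1 q = if q < 0 then N else lam.colLen q.toNat) :
    Represents s lam := by
  have h1 : lam.colLen 0 ≤ N := by
    have := h 0
    have h2 := colCount_le s.1 0
    simp only [lt_irrefl, if_false, Int.toNat_zero] at this
    omega
  have h2 := represents_diagramSig h1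
  refine ⟨fun c => ?_, h1⟩
  rw [eq_of_colCount_eq s.2 (diagramSig N lam).2 fun q => by rw [h q, h2.colCount_eq]]
  rfl

theorem Represents.unique {N : ℕ} {s : Signature N} {lam lam' : YoungDiagram}
    (h : Represents s lam) (h' : Represents s lam') : lam = lam' := by
  apply YoungDiagram.ext_colLen
  intro c
  have h1 := h.colCount_eq c
  rw [h'.colCount_eq c] at h1
  rw [if_neg (by omega), if_neg (by omega), Int.toNat_natCast] at h1
  exact h1.symm

theorem exists_represents {N : ℕ} {s : Signature N} (h : ∀ q : ℤ, q < 0 → colCount s.1 q = N) :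
    ∃ lam, Represents s lam := by
  obtain ⟨B, hB, -⟩ := exists_colCount_bounds s.1
  have hcol := colLen_diagramOfCols (M := B.toNat) (f := fun c : ℕ => colCount s.1 c)
    (fun c d hcd => colCount_anti s.1 (by exact_mod_cast hcd)) (fun c hc => hB _ (by omega))
  refine ⟨diagramOfCols B.toNat fun c : ℕ => colCount s.1 c,
    represents_of_colCount_eq fun q => ?_⟩
  split_ifs with hq
  · exact h q hq
  · rw [hcol, Int.toNat_of_nonneg (not_lt.1 hq)]

theorem represents_zero (N : ℕ) : Represents (Signature.zero N) ⊥ := by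
  have h : ∀ i, (⊥ : YoungDiagram).rowLen i = 0 := fun i => by
    by_contra hc
    exact YoungDiagram.notMem_bot _ (YoungDiagram.mem_iff_lt_rowLen.2 (Nat.pos_of_ne_zero hc))
  have h' : (⊥ : YoungDiagram).colLen 0 = 0 := by
    by_contra hc
    exact YoungDiagram.notMem_bot _ (YoungDiagram.mem_iff_lt_colLen.2 (Nat.pos_of_ne_zero hc))
  exact ⟨fun c => by rw [h]; rfl, by omega⟩

theorem Represents.multAt_zero {N : ℕ} {s : Signature N} {lam : YoungDiagram}
    (h : Represents s lam) : multAt s.1 0 = N - lam.colLen 0 := by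
  have h1 := colCount_pred_eq s.1 0
  have h2 := h.colCount_eq 0
  have h3 := h.colCount_eq (0 - 1)
  rw [if_neg (by omega)] at h2
  rw [if_pos (by omega)] at h3
  simp only [Int.toNat_zero] at h2
  omega

theorem colCount_snoc {N : ℕ} (κ : Fin N → ℤ) (x q : ℤ) :
    colCount (Fin.snoc κ x : Fin (N + 1) → ℤ) q = colCount κ q + if q < x then 1 else 0 := by
  rw [colCount_eq_sum, colCount_eq_sum, Fin.sum_univ_castSucc]
  simp

theorem antitone_snoc {N : ℕ} {κ : Fin N → ℤ} {x : ℤ} (hκ : Antitone κ) (hx : ∀ c, x ≤ κ c) :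
    Antitone (Fin.snoc κ x : Fin (N + 1) → ℤ) := by
  intro c d hcd
  induction d using Fin.lastCases with
  | last =>
    induction c using Fin.lastCases with
    | last => exact le_rfl
    | cast c => simpa using hx c
  | cast d =>
    induction c using Fin.lastCases with
    | last => exact absurd (Fin.castSucc_lt_last d) (not_lt.2 hcd)
    | cast c => simpa using hκ (Fin.castSucc_le_castSucc_iff.1 hcd)

theorem colCount_eq_card_iff {N : ℕ} {κ : Fin N → ℤ} {q : ℤ} :
    colCount κ q = N ↔ ∀ c, q < κ c := by
  rw [colCount]
  conv_lhs => rhs; rw [← Fintype.card_fin N, ← Finset.card_univ]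
  rw [Finset.card_filter_eq_iff]
  simp

/-! ### The algorithm on signatures with nonnegative entries -/

/-- If exactly one of the two boxes is present in the previous column, the decision depends neither
on the multiplicity nor on the carry there. -/
theorem colWt_mixed (t : ℝ) (ps n a b s a' : ℕ) :
    colWt t 0 1 ps n a b s a' = colWt t 0 1 0 0 a b s a' := by
  simp [colWt]

/-- The numbers of particles in the input of the algorithm, where `z` is the new last coordinate
of `ν`, the largest integer below all entries of `μ`: the columns up to `z` are full. -/
theorem exists_last_coord {N : ℕ} {sl sn : Signature N} {sm : Signature (N + 1)}
    {lam mu nu : YoungDiagram} (hl : Represents sl lam) (hm : Represents sm mu)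
    (hn : Represents sn nu) (hmu : IsHorizontalStrip mu lam) (hnu : IsHorizontalStrip nu lam)
    {z : ℤ} (hz : z = sm.1 (Fin.last N) - 1) :
    -1 ≤ z ∧ (∀ q ≤ z, colCount sl.1 q = N ∧ colCount sn.1 q = N ∧ colCount sm.1 q = N + 1) ∧
      (∀ c, z < sl.1 c) ∧ ∀ c, z < sn.1 c := by
  have h0 : -1 ≤ z := by
    have := hm.1 (Fin.last N)
    omega
  have h1 : ∀ q ≤ z, colCount sm.1 q = N + 1 := by
    intro q hq
    rw [colCount_eq_card_iff]
    intro c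
    have := sm.2 (Fin.le_last c)
    omega
  have h2 : ∀ q ≤ z, colCount sl.1 q = N ∧ colCount sn.1 q = N := by
    intro q hq
    have e1 := h1 q hq
    rw [hl.colCount_eq, hn.colCount_eq]
    rw [hm.colCount_eq] at e1
    have e3 := hl.colCount_eq q
    have e4 := hn.colCount_eq q
    have e5 := colCount_le sl.1 q
    have e6 := colCount_le sn.1 q
    split_ifs at * with hq0
    · exact ⟨rfl, rfl⟩
    · have := hmu.2 q.toNat
      have := colLen_le_of_le hnu.1 q.toNat
      omega
  exact ⟨h0, fun q hq => ⟨(h2 q hq).1, (h2 q hq).2, h1 q hq⟩,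
    colCount_eq_card_iff.1 (h2 z le_rfl).1, colCount_eq_card_iff.1 (h2 z le_rfl).2⟩

/-- Outputs of positive probability are again Young diagrams, found column by column. -/
theorem exists_isColumnRun_of_rskUInput_ne_zero {N : ℕ} {t : ℝ} {r : ℕ} {sl sn : Signature N}
    {sm srho : Signature (N + 1)} {lam mu nu : YoungDiagram} (hl : Represents sl lam)
    (hm : Represents sm mu) (hn : Represents sn nu) (hmu : IsHorizontalStrip mu lam)
    (hnu : IsHorizontalStrip nu lam) (h : rskUInput t r sl sm sn srho ≠ 0) :
    ∃ rho s, Represents srho rho ∧ IsColumnRun lam mu nu rho s ∧ s 0 = r := by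
  obtain ⟨z, hz⟩ : ∃ z, z = sm.1 (Fin.last N) - 1 := ⟨_, rfl⟩
  obtain ⟨hz0, hlow, hzl, hzn⟩ := exists_last_coord hl hm hn hmu hnu hz
  rw [rskUInput] at h
  rw [← hz] at h
  obtain ⟨a, b, a', b', s, R⟩ := exists_isCarryRun_of_rskU_ne_zero h
  have rnu := R.nu_eq
  have rmu := R.mu_eq
  simp only [colCount_snoc] at rnu rmu
  have cr := fun q => colCount_le srho.1 q
  -- nothing happens below `z - r`; the new coordinate moves from `z - r` to `z` and is carried
  -- along, so that the carry at `z` is the input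
  have low1 : ∀ q < z - r, a q = 0 ∧ b q = 0 ∧ a' q = 0 ∧ b' q = 0 := by
    intro q hq
    have e1 := rnu q
    have e2 := rmu q
    have e3 := R.rho_eq q
    have e4 := R.rho_eq' q
    rw [colCount_snoc] at e4
    have := hlow q (by omega)
    have := cr q
    split_ifs at * <;> omega
  have low2 : ∀ q, z - r ≤ q → q < z → a q = 1 ∧ b q = 1 ∧ a' q = 0 ∧ b' q = 0 := by
    intro q hq hq'
    have e1 := rnu q
    have e2 := rmu q
    have e3 := R.rho_eq q
    have e4 := R.rho_eq' q
    rw [colCount_snoc] at e4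
    have := hlow q (by omega)
    have := cr q
    split_ifs at * <;> omega
  have s1 : s (z - r) = 0 := by
    obtain ⟨B, hB⟩ := R.bot
    by_cases hBz : z - r ≤ B
    · exact hB _ hBz
    · obtain ⟨k, hk⟩ : ∃ k : ℕ, z - r = B + k := ⟨(z - r - B).toNat, by omega⟩
      have : ∀ j : ℕ, j ≤ k → s (B + j) = 0 := by
        intro j
        induction j with
        | zero => intro _; exact hB _ (by simp)
        | succ j ih =>
          intro hj
          have e1 := (R.step (B + j)).1
          have e2 := low1 (B + j) (by omega)
          have e3 := ih (by omega)
          push_cast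
          rw [← add_assoc]
          omega
      rw [hk]
      exact this k le_rfl
  have s2 : ∀ k : ℕ, k ≤ r → s (z - r + k) = k := by
    intro k
    induction k with
    | zero => intro _; simpa using s1
    | succ k ih =>
      intro hk
      have e1 := (R.step (z - r + k)).1
      have e2 := low2 (z - r + k) (by omega) (by omega)
      have e3 := ih (by omega)
      push_cast
      rw [← add_assoc]
      omega
  have s3 : s z = r := by simpa using s2 r le_rfl
  have rho_low : ∀ q ≤ z, colCount srho.1 q = N + 1 := by
    intro q hq
    have e3 := R.rho_eq q
    have := hlow q hq
    have := cr q
    omega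
  obtain ⟨rho, hrho⟩ := exists_represents (s := srho) fun q hq => rho_low q (by omega)
  have s4 : s (z + 1) = r := by
    have e1 := (R.step z).1
    have e2 := R.rho_eq z
    have e3 := rnu z
    have := hlow z le_rfl
    have := cr z
    split_ifs at * <;> omega
  have conv : ∀ c : ℕ, colCount sl.1 c = lam.colLen c ∧ colCount sm.1 c = mu.colLen c ∧
      colCount sn.1 c = nu.colLen c ∧ colCount srho.1 c = rho.colLen c := by
    intro c
    rw [hl.colCount_eq, hm.colCount_eq, hn.colCount_eq, hrho.colCount_eq]
    simp
  have hrho_mu : IsHorizontalStrip rho mu ∧ ∀ c : ℕ, skewInd rho mu c = a' c :=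
    isHorizontalStrip_of_colLen (f := fun c : ℕ => a' c) (fun c => by
      have e := R.rho_eq c
      have := conv c
      omega) fun c => R.a'_le c
  have hrho_nu : IsHorizontalStrip rho nu ∧
      ∀ c : ℕ, skewInd rho nu c = if (c : ℤ) ≤ z then 1 else b' c :=
    isHorizontalStrip_of_colLen (fun c => by
      have e := R.rho_eq' c
      rw [colCount_snoc] at e
      have := conv c
      have := hlow c
      have := rho_low c
      split_ifs at * <;> omega) fun c => by
      have := R.b'_le c
      split_ifs <;> omega
  refine ⟨rho, fun c => s (max (c : ℤ) (z + 1)), hrho, ⟨hmu, hnu, hrho_mu.1, hrho_nu.1, ?_⟩, ?_⟩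
  · intro c
    rw [hrho_mu.2, hrho_nu.2]
    have e1 := hmu.colLen_eq c
    have e2 := hnu.colLen_eq c
    have := conv c
    have e3 := rmu c
    have e4 := rnu c
    by_cases hc : (c : ℤ) ≤ z
    · rw [if_pos hc, max_eq_right (by omega), max_eq_right (by push_cast; omega), s4, CarryStep]
      have := hlow c hc
      have := rho_low c hc
      have := R.rho_eq c
      omega
    · rw [if_neg hc, max_eq_left (by omega), max_eq_left (by push_cast; omega)]
      have h1 := R.step c
      rw [if_neg (by omega)] at e3 e4
      rw [if_neg (by omega)] at e4
      rw [show skewInd nu lam c = a c by omega, show skewInd mu lam c = b c by omega]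
      exact_mod_cast h1
  · change s (max ((0 : ℕ) : ℤ) (z + 1)) = r
    rw [max_eq_right (by push_cast; omega), s4]

/-- The coefficient of the algorithm on signatures with an appended coordinate is that on Young
diagrams. The move of the new coordinate through the columns up to `z` contributes weight one, and
at the first column beyond it the decision has exactly one neighbour, which is where the data `0`,
`1` in `columnWt` come from. -/
theorem IsColumnRun.rskUInput_eq {N : ℕ} {t : ℝ} (ht1 : t < 1) {r : ℕ}
    {sl sn : Signature N} {sm srho : Signature (N + 1)} {lam mu nu rho : YoungDiagram}
    {s : ℕ → ℕ} (hl : Represents sl lam) (hm : Represents sm mu) (hn : Represents sn nu)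
    (hr : Represents srho rho) (R : IsColumnRun lam mu nu rho s) (hs : s 0 = r) :
    rskUInput t r sl sm sn srho = diagramU t lam mu nu rho := by
  obtain ⟨z, hz⟩ : ∃ z, z = sm.1 (Fin.last N) - 1 := ⟨_, rfl⟩
  obtain ⟨hz0, hlow, hzl, hzn⟩ := exists_last_coord hl hm hn R.mu_strip R.nu_strip hz
  rw [rskUInput]
  rw [← hz]
  have conv : ∀ c : ℕ, colCount sl.1 c = lam.colLen c ∧ colCount sm.1 c = mu.colLen c ∧
      colCount sn.1 c = nu.colLen c ∧ colCount srho.1 c = rho.colLen c := by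
    intro c
    rw [hl.colCount_eq, hm.colCount_eq, hn.colCount_eq, hr.colCount_eq]
    simp
  have cr := fun q => colCount_le srho.1 q
  have rho_low : ∀ q ≤ z, colCount srho.1 q = N + 1 := by
    intro q hq
    have e1 := (hlow q hq).2.2
    rw [hm.colCount_eq] at e1
    rw [hr.colCount_eq]
    have e2 := hr.colCount_eq q
    have e3 := cr q
    have e4 := colLen_le_of_le R.rho_strip.1 q.toNat
    split_ifs at * with h0
    · rfl
    · omega
  have s_low : ∀ c : ℕ, (c : ℤ) ≤ z + 1 → s c = r := by
    intro c
    induction c with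
    | zero => intro _; exact hs
    | succ c ih =>
      intro hc
      have e1 := (R.step c).1
      have e2 := ih (by omega)
      have e3 := hlow c (by omega)
      have e4 := rho_low c (by omega)
      have e5 := conv c
      have e6 := R.nu_strip.colLen_eq c
      have e7 := R.rho_strip.colLen_eq c
      omega
  -- the run on signatures, with the move of the new coordinate on the left of the run on diagrams
  have run : IsCarryRun (Fin.snoc sl.1 (z - r)) sm.1 (Fin.snoc sn.1 z) srho.1
      (fun q => if q ≤ z then (if z - r ≤ q ∧ q < z then 1 else 0) else skewInd nu lam q.toNat)
      (fun q => if q ≤ z then (if z - r ≤ q then 1 else 0) else skewInd mu lam q.toNat)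
      (fun q => if q ≤ z then 0 else skewInd rho mu q.toNat)
      (fun q => if q ≤ z then (if q = z then 1 else 0) else skewInd rho nu q.toNat)
      (fun q => if q ≤ z then (q - z + r).toNat else s q.toNat) := by
    have nat_of : ∀ q, ¬ q ≤ z → ∃ c : ℕ, q = c := fun q hq =>
      ⟨q.toNat, by omega⟩
    constructor
    · intro q
      rw [colCount_snoc, colCount_snoc]
      by_cases hq : q ≤ z
      · have := hlow q hq
        rw [if_pos hq]
        split_ifs <;> omega
      · obtain ⟨c, rfl⟩ := nat_of q hq
        have := conv c
        have := R.nu_strip.colLen_eq c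
        rw [if_neg hq, Int.toNat_natCast]
        split_ifs <;> omega
    · intro q
      rw [colCount_snoc]
      by_cases hq : q ≤ z
      · have := hlow q hq
        rw [if_pos hq]
        split_ifs <;> omega
      · obtain ⟨c, rfl⟩ := nat_of q hq
        have := conv c
        have := R.mu_strip.colLen_eq c
        rw [if_neg hq, Int.toNat_natCast]
        split_ifs <;> omega
    · intro q
      by_cases hq : q ≤ z
      · have := hlow q hq
        have := rho_low q hq
        rw [if_pos hq]
        omega
      · obtain ⟨c, rfl⟩ := nat_of q hq
        have := conv c
        have := R.rho_strip.colLen_eq c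
        rw [if_neg hq, Int.toNat_natCast]
        omega
    · intro q
      rw [colCount_snoc]
      by_cases hq : q ≤ z
      · have := hlow q hq
        have := rho_low q hq
        rw [if_pos hq]
        split_ifs <;> omega
      · obtain ⟨c, rfl⟩ := nat_of q hq
        have := conv c
        have := R.rho_strip'.colLen_eq c
        rw [if_neg hq, Int.toNat_natCast]
        split_ifs <;> omega
    · intro q
      have := R.nu_strip.skewInd_le q.toNat
      split_ifs <;> omega
    · intro q
      have := R.mu_strip.skewInd_le q.toNat
      split_ifs <;> omega
    · intro q
      have := R.rho_strip.skewInd_le q.toNat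
      split_ifs <;> omega
    · intro q
      have := R.rho_strip'.skewInd_le q.toNat
      split_ifs <;> omega
    · intro q
      by_cases hq : q ≤ z
      · simp only [hq, if_true]
        by_cases hqz : q = z
        · have := s_low (q + 1).toNat (by omega)
          rw [if_neg (show ¬ q + 1 ≤ z by omega), this, if_neg (by omega), if_pos (by omega),
            if_pos hqz, show (q - z + r).toNat = r by omega, CarryStep]
          omega
        · rw [if_pos (show q + 1 ≤ z by omega), CarryStep]
          split_ifs <;> omega
      · obtain ⟨c, rfl⟩ := nat_of q hq
        have h1 := R.step c
        simp only [hq, if_false, if_neg (show ¬ (c : ℤ) + 1 ≤ z by omega), Int.toNat_natCast]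
        rw [show ((c : ℤ) + 1).toNat = c + 1 by omega]
        exact h1
    · refine ⟨min z (z - r), fun q hq => ?_⟩
      rw [if_pos (by omega)]
      omega
    · refine ⟨max (z + 1) (rho.rowLen 0), fun q hq => ?_⟩
      rw [if_neg (by omega)]
      exact (R.ind_eq_zero (by omega)).2.2.2.2
  set M := rho.rowLen 0 with hM
  have hlam' := antitone_snoc (x := z - r) sl.2 fun c => by have := hzl c; omega
  have hnu' := antitone_snoc (x := z) sn.2 fun c => (hzn c).le
  rw [run.rskU_eq t hlam' sm.2 hnu' srho.2 (Finset.Ico (min (z - r) 0) M)]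
  · rw [R.diagramU_eq le_rfl, ← hM]
    have hsub : (Finset.range M).map Nat.castEmbedding ⊆ Finset.Ico (min (z - r) 0) (M : ℤ) := by
      intro q hq
      rw [Finset.mem_map] at hq
      obtain ⟨c, hc, rfl⟩ := hq
      rw [Finset.mem_range] at hc
      rw [Finset.mem_Ico, Nat.castEmbedding_apply]
      omega
    -- the columns up to `z` have weight one; a decision occurs only in column `z - r`, where the
    -- new coordinate is alone and has to be pushed
    have hone : ∀ q ≤ z, colWt t (if q - 1 ≤ z then 0 else skewInd rho mu (q - 1).toNat)
        (if q - 1 ≤ z then (if q - 1 = z then 1 else 0) else skewInd rho nu (q - 1).toNat)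
        (if q - 1 ≤ z then (q - 1 - z + r).toNat else s (q - 1).toNat)
        (multAt (Fin.snoc sl.1 (z - r) : Fin (N + 1) → ℤ) q)
        (if q ≤ z then (if z - r ≤ q ∧ q < z then 1 else 0) else skewInd nu lam q.toNat)
        (if q ≤ z then (if z - r ≤ q then 1 else 0) else skewInd mu lam q.toNat)
        (if q ≤ z then (q - z + r).toNat else s q.toNat)
        (if q ≤ z then 0 else skewInd rho mu q.toNat) = 1 := by
      intro q hq
      simp only [hq, if_true, if_pos (show q - 1 ≤ z by omega),
        if_neg (show ¬ q - 1 = z by omega)]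
      by_cases hqr : q = z - r ∧ q < z
      · have e1 := colCount_pred_eq (Fin.snoc sl.1 (z - r) : Fin (N + 1) → ℤ) q
        rw [colCount_snoc, colCount_snoc, (hlow q hq).1, (hlow (q - 1) (by omega)).1,
          if_pos (by omega), if_neg (by omega)] at e1
        rw [if_pos (by omega), if_pos (by omega), show (q - z + r).toNat = 0 by omega, colWt_choice,
          show multAt (Fin.snoc sl.1 (z - r) : Fin (N + 1) → ℤ) q = 1 by omega]
        simp only [zero_ne_one, false_and, if_false, or_self, pow_one]
        exact div_self (by linarith)
      · apply colWt_eq_one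
        by_cases h1 : z - r ≤ q ∧ q < z
        · intro h
          have := h.2.2
          omega
        · rw [if_neg h1]
          exact fun h => absurd h.1 zero_ne_one
    rw [← Finset.prod_subset hsub, Finset.prod_map]
    · apply Finset.prod_congr rfl
      intro c _
      rw [Nat.castEmbedding_apply]
      by_cases hc : (c : ℤ) ≤ z
      · rw [hone c hc]
        have e3 := hlow c hc
        have e5 := conv c
        have e6 := R.nu_strip.colLen_eq c
        cases c with
        | zero => exact (colWt_eq_one (by omega)).symm
        | succ c => exact (colWt_eq_one (by omega)).symm
      · simp only [hc, if_false, Int.toNat_natCast]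
        have e1 := colCount_pred_eq (Fin.snoc sl.1 (z - r) : Fin (N + 1) → ℤ) c
        rw [colCount_snoc, colCount_snoc, if_neg (by omega), if_neg (by omega)] at e1
        by_cases hc' : (c : ℤ) - 1 ≤ z
        · have hcz : (c : ℤ) - 1 = z := by omega
          simp only [hcz, le_refl, if_true]
          cases c with
          | zero => rw [colWt_mixed]; rfl
          | succ c =>
            have e3 := hlow c (by omega)
            have e4 := rho_low c (by omega)
            have e5 := conv c
            have e6 := R.rho_strip.colLen_eq c
            have e7 := R.rho_strip'.colLen_eq c
            have e8 := conv (c + 1)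
            rw [show ((c + 1 : ℕ) : ℤ) - 1 = c by push_cast; ring] at e1
            rw [columnWt, show skewInd rho mu c = 0 by omega, show skewInd rho nu c = 1 by omega,
              show multAt (Fin.snoc sl.1 (z - r) : Fin (N + 1) → ℤ) ((c + 1 : ℕ) : ℤ) =
                lam.colLen c - lam.colLen (c + 1) by omega, colWt]
            simp [colWt]
        · obtain ⟨k, rfl⟩ : ∃ k, c = k + 1 := ⟨c - 1, by omega⟩
          have e5 := conv k
          have e8 := conv (k + 1)
          rw [show ((k + 1 : ℕ) : ℤ) - 1 = k by push_cast; ring] at *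
          simp only [hc', if_false, Int.toNat_natCast]
          rw [columnWt, show multAt (Fin.snoc sl.1 (z - r) : Fin (N + 1) → ℤ) ((k + 1 : ℕ) : ℤ) =
                lam.colLen k - lam.colLen (k + 1) by omega]
    · intro q hq hq'
      apply hone
      rw [Finset.mem_Ico] at hq
      by_contra hc
      apply hq'
      rw [Finset.mem_map]
      exact ⟨q.toNat, Finset.mem_range.2 (by omega), by rw [Nat.castEmbedding_apply]; omega⟩
  · intro q hq
    rw [Finset.mem_Ico]
    by_cases hqz : q ≤ z
    · rw [if_pos hqz] at hq
      have h1 : z < M := by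
        by_contra hc
        have e1 := rho_low M (by omega)
        have := conv M
        have := colLen_eq_zero_of_rowLen_le (le_refl (rho.rowLen 0))
        rw [← hM] at this
        omega
      constructor
      · by_contra hc
        rw [if_neg (by omega)] at hq
        omega
      · omega
    · rw [if_neg hqz] at hq
      have : q < M := by
        by_contra hc
        have := R.ind_eq_zero (c := q.toNat) (by omega)
        omega
      omega

/-! ### The Markov property of the field -/

instance : Countable YoungDiagram :=
  Function.Injective.countable (f := YoungDiagram.cells) fun _ _ h => YoungDiagram.ext h

/-- An event is decomposed according to the values of a discrete random variable. -/
theorem hasSum_measureReal_fiber {Ω β : Type*} [MeasurableSpace Ω] (P : Measure Ω)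
    [IsFiniteMeasure P] [Countable β] {Y : Ω → β} (hY : ∀ y, MeasurableSet {ω | Y ω = y})
    (A : Set Ω) : HasSum (fun y => P.real (A ∩ {ω | Y ω = y})) (P.real A) := by
  have h1 : P A = ∑' y, P (A ∩ {ω | Y ω = y}) := by
    have h2 := measure_iUnion (μ := P.restrict A) (f := fun y => {ω | Y ω = y})
      (fun y y' hne => Set.disjoint_left.2 fun ω h h' => hne (h.symm.trans h')) hY
    rw [show (⋃ y, {ω | Y ω = y}) = Set.univ from Set.eq_univ_of_forall fun ω =>
      Set.mem_iUnion.2 ⟨Y ω, rfl⟩, Measure.restrict_apply_univ] at h2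
    rw [h2]
    congr 1
    funext y
    rw [Measure.restrict_apply (hY y), Set.inter_comm]
  have h3 : ∑' y, P (A ∩ {ω | Y ω = y}) ≠ ⊤ := h1 ▸ measure_ne_top P A
  have h4 := ENNReal.hasSum_toReal h3
  rwa [← ENNReal.tsum_toReal_eq fun y => measure_ne_top P _, ← h1] at h4

/-- Two events have proportional probabilities if this holds conditionally on every value of a
discrete random variable. -/
theorem measureReal_eq_mul_of_fiber {Ω β : Type*} [MeasurableSpace Ω] (P : Measure Ω)
    [IsFiniteMeasure P] [Countable β] {Y : Ω → β} (hY : ∀ y, MeasurableSet {ω | Y ω = y})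
    {A B : Set Ω} {c : ℝ}
    (h : ∀ ω₀, P.real (B ∩ {ω | Y ω = Y ω₀}) = P.real (A ∩ {ω | Y ω = Y ω₀}) * c) :
    P.real B = P.real A * c := by
  refine (hasSum_measureReal_fiber P hY B).unique ?_
  have h2 := (hasSum_measureReal_fiber P hY A).mul_right c
  refine (congrArg (fun f => HasSum f _) (funext fun y => ?_)).mpr h2
  by_cases hy : ∃ ω₀, Y ω₀ = y
  · obtain ⟨ω₀, rfl⟩ := hy
    exact h ω₀
  · rw [show {ω | Y ω = y} = ∅ from Set.eq_empty_of_forall_notMem fun ω hω => hy ⟨ω, hω⟩]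
    simp

theorem hasSum_inputProb {t u : ℝ} (hu0 : 0 ≤ u) (hu1 : u < 1) (ht1 : t < 1) :
    HasSum (inputProb t u) 1 := by
  have h1 := ((hasSum_geometric_of_lt_one hu0 hu1).mul_left (1 - t)).add (hasSum_ite_eq 0 t)
  have h2 := h1.mul_right ((1 - u) / (1 - t * u))
  have h3 : 1 - t * u ≠ 0 := by nlinarith
  have h4 : 1 - u ≠ 0 := by linarith
  rw [show ((1 - t) * (1 - u)⁻¹ + t) * ((1 - u) / (1 - t * u)) = 1 by field_simp; ring] at h2
  refine (congrArg (fun f => HasSum f _) (funext fun d => ?_)).mpr h2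
  rw [inputProb]
  by_cases hd : d = 0
  · simp [hd]
  · simp [hd]

/-- The states at the vertex `(i, j)` and its left and lower neighbours are Young diagrams, which
differ by horizontal strips. -/
def IsGoodAt (lam : (i j : ℕ) → Signature j) (i j : ℕ) : Prop :=
  ∃ κ, Represents (lam i j) κ ∧
    (∀ i', i = i' + 1 → ∃ κ', Represents (lam i' j) κ' ∧ IsHorizontalStrip κ κ') ∧
    ∀ j', j = j' + 1 → ∃ κ', Represents (lam i j') κ' ∧ IsHorizontalStrip κ κ'

/-- The probability of the input and the output of the step at the box with south-western corner
`v`. -/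
def fieldWt (t : ℝ) (a b : ℕ → ℝ) (d : ℕ → ℕ → ℕ) (lam : (i j : ℕ) → Signature j) (v : ℕ × ℕ) : ℝ :=
  inputProb t (a (v.1 + 1) * b (v.2 + 1)) (d (v.1 + 1) (v.2 + 1)) *
    rskUInput t (d (v.1 + 1) (v.2 + 1)) (lam v.1 v.2) (lam v.1 (v.2 + 1)) (lam (v.1 + 1) v.2)
      (lam (v.1 + 1) (v.2 + 1))

theorem isHorizontalStrip_refl (κ : YoungDiagram) : IsHorizontalStrip κ κ :=
  ⟨le_rfl, fun _ => Nat.le_succ _⟩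

theorem represents_bot_of_length_zero (s : Signature 0) : Represents s ⊥ := by
  rw [show s = Signature.zero 0 from Subtype.ext (funext fun c => c.elim0)]
  exact represents_zero 0

/-- A configuration of positive probability on a lower set of boxes consists of Young diagrams that
differ by horizontal strips, since the algorithm preserves these. -/
theorem isGoodAt_of_prod_ne_zero {t : ℝ} {a b : ℕ → ℝ} {d : ℕ → ℕ → ℕ}
    {lam : (i j : ℕ) → Signature j} (h0 : ∀ j, lam 0 j = Signature.zero j) {D : Finset (ℕ × ℕ)}
    (hD : IsLowerSet (D : Set (ℕ × ℕ))) (h : ∀ v ∈ D, fieldWt t a b d lam v ≠ 0) :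
    ∀ i j, (∀ i' j', i = i' + 1 → j = j' + 1 → (i', j') ∈ D) → IsGoodAt lam i j
  | 0, j, _ => ⟨⊥, by rw [h0]; exact represents_zero j, fun i' hi => by omega, fun j' hj => by
      subst hj
      exact ⟨⊥, by rw [h0]; exact represents_zero j', isHorizontalStrip_refl _⟩⟩
  | i + 1, 0, _ => ⟨⊥, represents_bot_of_length_zero _, fun i' hi =>
      ⟨⊥, represents_bot_of_length_zero _, isHorizontalStrip_refl _⟩, fun j' hj => by omega⟩
  | i + 1, j + 1, hij => by
    have hmem : (i, j) ∈ D := hij i j rfl rfl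
    have h1 := isGoodAt_of_prod_ne_zero h0 hD h i (j + 1) fun i' j' hi' hj' =>
      hD (show ((i', j') : ℕ × ℕ) ≤ (i, j) from ⟨by simp only; omega, by simp only; omega⟩) hmem
    have h2 := isGoodAt_of_prod_ne_zero h0 hD h (i + 1) j fun i' j' hi' hj' =>
      hD (show ((i', j') : ℕ × ℕ) ≤ (i, j) from ⟨by simp only; omega, by simp only; omega⟩) hmem
    obtain ⟨μ, hμ, -, h1⟩ := h1
    obtain ⟨κ, hκ, hμκ⟩ := h1 j rfl
    obtain ⟨ν, hν, h2, -⟩ := h2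
    obtain ⟨κ', hκ', hνκ⟩ := h2 i rfl
    obtain rfl := hκ.unique hκ'
    obtain ⟨ρ, s, hρ, R, -⟩ := exists_isColumnRun_of_rskUInput_ne_zero hκ hμ hν hμκ hνκ
      (right_ne_zero_of_mul (h _ hmem))
    refine ⟨ρ, hρ, fun i' hi' => ?_, fun j' hj' => ?_⟩
    · obtain rfl : i' = i := by omega
      exact ⟨μ, hμ, R.rho_strip⟩
    · obtain rfl : j' = j := by omega
      exact ⟨ν, hν, R.rho_strip'⟩

/-- The algorithm is stochastic on legitimate inputs. -/
theorem hasSum_rskUInput {N : ℕ} {t : ℝ} (ht0 : 0 ≤ t) (ht1 : t < 1) (r : ℕ) {sl sn : Signature N}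
    {sm : Signature (N + 1)} {lam mu nu : YoungDiagram} (hl : Represents sl lam)
    (hm : Represents sm mu) (hn : Represents sn nu) (hmu : IsHorizontalStrip mu lam)
    (hnu : IsHorizontalStrip nu lam) : HasSum (fun srho => rskUInput t r sl sm sn srho) 1 := by
  have h1 := hasSum_diagramU_mul ht0 ht1 hmu hnu r fun _ => 1
  simp only [one_mul] at h1
  rw [stepProb_sum ht0 ht1 (hnu.skewInd_le 0) (hmu.skewInd_le 0)
    fun _ _ _ _ h => absurd rfl h] at h1
  have hrun : ∀ rho, (if colCarry lam mu nu rho 0 = r then diagramU t lam mu nu rho else 0) ≠ 0 →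
      IsColumnRun lam mu nu rho (colCarry lam mu nu rho) ∧ colCarry lam mu nu rho 0 = r := by
    intro rho h
    have h2 : colCarry lam mu nu rho 0 = r := by
      by_contra hc
      exact h (if_neg hc)
    rw [if_pos h2] at h
    refine ⟨?_, h2⟩
    by_contra hc
    exact h (diagramU_eq_zero hc)
  have hrep : ∀ rho, IsColumnRun lam mu nu rho (colCarry lam mu nu rho) →
      Represents (diagramSig (N + 1) rho) rho := by
    intro rho R
    apply represents_diagramSig
    have := R.rho_strip'.2 0
    have := hn.2
    omega
  refine (hasSum_iff_hasSum_of_ne_zero_bij (fun rho => diagramSig (N + 1) rho.1) ?_ ?_ ?_).2 h1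
  · rintro ⟨x, hx⟩ ⟨y, hy⟩ hxy
    simp only at hxy
    have h2 := hrep x (hrun x hx).1
    rw [hxy] at h2
    exact Subtype.ext (h2.unique (hrep y (hrun y hy).1))
  · intro srho h
    obtain ⟨rho, s, hr, R, hs⟩ := exists_isColumnRun_of_rskUInput_ne_zero hl hm hn hmu hnu h
    refine ⟨⟨rho, ?_⟩, hr.eq_diagramSig.symm⟩
    rw [Function.mem_support, ← R.eq_colCarry, if_pos hs, ← R.rskUInput_eq ht1 hl hm hn hr hs]
    exact h
  · rintro ⟨rho, hrho⟩
    obtain ⟨R, hr⟩ := hrun rho hrho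
    simp only
    rw [if_pos hr, R.rskUInput_eq ht1 hl hm hn (hrep rho R) hr]

/-- The parameters of the model are admissible. -/
structure IsParam (t : ℝ) (a b : ℕ → ℝ) : Prop where
  t_nonneg : 0 ≤ t
  t_lt : t < 1
  a_pos : ∀ i, 1 ≤ i → 0 < a i
  b_pos : ∀ j, 1 ≤ j → 0 < b j
  lt_one : ∀ i j, 1 ≤ i → 1 ≤ j → a i * b j < 1

theorem IsParam.hasSum_inputProb {t : ℝ} {a b : ℕ → ℝ} (hp : IsParam t a b) (i j : ℕ) :
    HasSum (inputProb t (a (i + 1) * b (j + 1))) 1 :=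
  _root_.hasSum_inputProb (mul_pos (hp.a_pos _ (by omega)) (hp.b_pos _ (by omega))).le
    (hp.lt_one _ _ (by omega) (by omega)) hp.t_lt

/-- The inputs and states at the boxes in `D` are `d` and `lam`. -/
def fieldEvent {Ω : Type*} (r : ℕ → ℕ → Ω → ℕ) (L : (i j : ℕ) → Ω → Signature j)
    (D : Finset (ℕ × ℕ)) (d : ℕ → ℕ → ℕ) (lam : (i j : ℕ) → Signature j) : Set Ω :=
  {ω | ∀ v ∈ D, r (v.1 + 1) (v.2 + 1) ω = d (v.1 + 1) (v.2 + 1) ∧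
    L (v.1 + 1) (v.2 + 1) ω = lam (v.1 + 1) (v.2 + 1)}

/-- The law at the boxes in `D` and one more box, which is not below any of them. -/
theorem measureReal_fieldEvent_inter {Ω : Type*} [MeasurableSpace Ω] {P : Measure Ω} {t : ℝ}
    {a b : ℕ → ℝ} {r : ℕ → ℕ → Ω → ℕ} {L : (i j : ℕ) → Ω → Signature j} {D : Finset (ℕ × ℕ)}
    {i j : ℕ} (hnot : ∀ x y : ℕ, i ≤ x → j ≤ y → (x, y) ∉ D)
    (hlaw : ∀ (d : ℕ → ℕ → ℕ) (lam : (i j : ℕ) → Signature j), (∀ j, lam 0 j = Signature.zero j) →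
      P.real (fieldEvent r L (insert (i, j) D) d lam) =
        ∏ v ∈ insert (i, j) D, fieldWt t a b d lam v)
    (d : ℕ → ℕ → ℕ) (lam : (i j : ℕ) → Signature j) (h0 : ∀ j, lam 0 j = Signature.zero j)
    (δ : ℕ) (σ : Signature (j + 1)) :
    P.real (fieldEvent r L D d lam ∩ {ω | r (i + 1) (j + 1) ω = δ} ∩
      {ω | L (i + 1) (j + 1) ω = σ}) = (∏ v ∈ D, fieldWt t a b d lam v) *
        inputProb t (a (i + 1) * b (j + 1)) δ *
          rskUInput t δ (lam i j) (lam i (j + 1)) (lam (i + 1) j) σ := by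
  have hvD : (i, j) ∉ D := hnot i j le_rfl le_rfl
  -- the law on `insert (i, j) D`, with the input and the state at the new box set to `δ` and `σ`
  have h1 := hlaw
    (Function.update d (i + 1) (Function.update (d (i + 1)) (j + 1) δ))
    (Function.update lam (i + 1) (Function.update (lam (i + 1)) (j + 1) σ))
    (fun j => by rw [Function.update_of_ne (by omega)]; exact h0 j)
  have hd : ∀ x y : ℕ, ¬ (x = i + 1 ∧ y = j + 1) →
      Function.update d (i + 1) (Function.update (d (i + 1)) (j + 1) δ) x y = d x y := by
    intro x y hxy
    by_cases hx : x = i + 1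
    · subst hx
      rw [Function.update_self, Function.update_of_ne (fun hy => hxy ⟨rfl, hy⟩)]
    · rw [Function.update_of_ne hx]
  have hlam : ∀ x y : ℕ, ¬ (x = i + 1 ∧ y = j + 1) →
      Function.update lam (i + 1) (Function.update (lam (i + 1)) (j + 1) σ) x y = lam x y := by
    intro x y hxy
    by_cases hx : x = i + 1
    · subst hx
      rw [Function.update_self, Function.update_of_ne (fun hy => hxy ⟨rfl, hy⟩)]
    · rw [Function.update_of_ne hx]
  rw [Finset.prod_insert hvD] at h1
  have h2 : ∏ v ∈ D, fieldWt t a b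
      (Function.update d (i + 1) (Function.update (d (i + 1)) (j + 1) δ))
      (Function.update lam (i + 1) (Function.update (lam (i + 1)) (j + 1) σ)) v =
      ∏ v ∈ D, fieldWt t a b d lam v := by
    apply Finset.prod_congr rfl
    rintro ⟨x, y⟩ hxy
    have hne : ¬ (i ≤ x ∧ j ≤ y) := fun h => hnot x y h.1 h.2 hxy
    simp only [fieldWt]
    rw [hd _ _ (by omega), hlam _ _ (by omega), hlam _ _ (by omega), hlam _ _ (by omega),
      hlam _ _ (by omega)]
  rw [h2] at h1
  rw [fieldWt] at h1
  simp only at h1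
  rw [hlam i j (by omega), hlam i (j + 1) (by omega), hlam (i + 1) j (by omega)] at h1
  simp only [Function.update_self] at h1
  rw [mul_assoc, mul_comm (∏ v ∈ D, fieldWt t a b d lam v), ← h1]
  have hmem : ∀ v ∈ D, ¬ (v.1 + 1 = i + 1 ∧ v.2 + 1 = j + 1) := by
    rintro ⟨x, y⟩ hv hxy
    exact hnot x y (by simp only at hxy; omega) (by simp only at hxy; omega) hv
  congr 1
  ext ω
  constructor
  · rintro ⟨⟨h3, h4⟩, h5⟩ v hv
    rcases Finset.mem_insert.1 hv with rfl | hv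
    · simp only [Function.update_self]
      exact ⟨h4, h5⟩
    · rw [hd _ _ (hmem v hv), hlam _ _ (hmem v hv)]
      exact h3 v hv
  · intro h3
    refine ⟨⟨fun v hv => ?_, ?_⟩, ?_⟩
    · have := h3 v (Finset.mem_insert_of_mem hv)
      rwa [hd _ _ (hmem v hv), hlam _ _ (hmem v hv)] at this
    · have := (h3 (i, j) (Finset.mem_insert_self _ _)).1
      simp only [Function.update_self] at this
      exact this
    · have := (h3 (i, j) (Finset.mem_insert_self _ _)).2
      simp only [Function.update_self] at this
      exact this

namespace IsHLRSKField

variable {Ω : Type*} [MeasurableSpace Ω] {P : Measure Ω} [IsProbabilityMeasure P] {t : ℝ}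
  {a b : ℕ → ℝ} {r : ℕ → ℕ → Ω → ℕ} {L : (i j : ℕ) → Ω → Signature j}

omit [IsProbabilityMeasure P] in
theorem measurableSet_r (hF : IsHLRSKField P t a b r L) (i j : ℕ) (y : ℕ) :
    MeasurableSet {ω | r i j ω = y} := hF.measurable_r i j (measurableSet_singleton y)

omit [IsProbabilityMeasure P] in
theorem measurableSet_L (hF : IsHLRSKField P t a b r L) (i j : ℕ) (s : Set (Signature j)) :
    MeasurableSet {ω | L i j ω ∈ s} := hF.measurable_L i j s.to_countable.measurableSet

/-- The joint law of the field on a finite lower set of boxes. -/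
theorem measureReal_fieldEvent (hF : IsHLRSKField P t a b r L) (hp : IsParam t a b)
    {D : Finset (ℕ × ℕ)} (hD : IsLowerSet (D : Set (ℕ × ℕ))) (d : ℕ → ℕ → ℕ)
    (lam : (i j : ℕ) → Signature j) (h0 : ∀ j, lam 0 j = Signature.zero j) :
    P.real (fieldEvent r L D d lam) = ∏ v ∈ D, fieldWt t a b d lam v := by
  obtain ⟨K, hK⟩ : ∃ K, D ⊆ Finset.range K ×ˢ Finset.range K := by
    obtain ⟨⟨m, n⟩, hmn⟩ := D.bddAbove
    refine ⟨m + n + 1, fun v hv => ?_⟩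
    have := hmn hv
    rw [Finset.mem_product, Finset.mem_range, Finset.mem_range]
    have h1 := this.1
    have h2 := this.2
    simp only at h1 h2
    omega
  -- remove the boxes outside `D` from a large square, always a maximal one
  obtain ⟨k, hk⟩ : ∃ k, ((Finset.range K ×ˢ Finset.range K) \ D).card = k := ⟨_, rfl⟩
  induction k generalizing D d lam with
  | zero =>
    rw [Finset.card_eq_zero, Finset.sdiff_eq_empty_iff_subset] at hk
    obtain rfl := Finset.Subset.antisymm hK hk
    have h1 := hF.law K K d lam h0
    rw [Finset.prod_product]
    refine Eq.trans (congrArg _ ?_) h1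
    ext ω
    exact ⟨fun h i hi j hj => h (i, j) (Finset.mem_product.2 ⟨Finset.mem_range.2 hi,
      Finset.mem_range.2 hj⟩), fun h v hv => h v.1 (Finset.mem_range.1 (Finset.mem_product.1 hv).1)
      v.2 (Finset.mem_range.1 (Finset.mem_product.1 hv).2)⟩
  | succ k ih =>
    obtain ⟨v, hv⟩ := ((Finset.range K ×ˢ Finset.range K) \ D).exists_minimal
      (Finset.card_pos.1 (by omega))
    have hvK := Finset.mem_product.1 (Finset.mem_sdiff.1 hv.1).1
    have hvD := (Finset.mem_sdiff.1 hv.1).2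
    have hbelow : ∀ w, w ≤ v → w ≠ v → w ∈ D := by
      intro w hw hne
      by_contra hc
      refine hne (le_antisymm hw (hv.2 (Finset.mem_sdiff.2 ⟨Finset.mem_product.2 ?_, hc⟩) hw))
      simp only [Finset.mem_range] at hvK ⊢
      exact ⟨hw.1.trans_lt hvK.1, hw.2.trans_lt hvK.2⟩
    have hlow : IsLowerSet ((insert v D : Finset (ℕ × ℕ)) : Set (ℕ × ℕ)) := by
      intro x y hyx hx
      simp only [Finset.coe_insert, Set.mem_insert_iff, Finset.mem_coe] at hx ⊢
      rcases hx with rfl | hx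
      · by_cases hy : y = x
        · exact Or.inl hy
        · exact Or.inr (hbelow y hyx hy)
      · exact Or.inr (hD hyx hx)
    obtain ⟨i, j⟩ := v
    have hsub : insert (i, j) D ⊆ Finset.range K ×ˢ Finset.range K :=
      Finset.insert_subset (Finset.mem_sdiff.1 hv.1).1 hK
    have hcard : ((Finset.range K ×ˢ Finset.range K) \ insert (i, j) D).card = k := by
      rw [Finset.sdiff_insert, Finset.card_erase_of_mem hv.1, hk]
      rfl
    have hstep := measureReal_fieldEvent_inter (P := P) (r := r) (L := L) (t := t) (a := a) (b := b)
      (fun x y hx hy hxy => hvD (hD (show ((i, j) : ℕ × ℕ) ≤ (x, y) from ⟨hx, hy⟩) hxy))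
      (fun d lam h0 => ih hlow d lam h0 hsub hcard) d lam h0
    -- sum over the state at the removed box, then over the input
    have hstep' : ∀ δ : ℕ, P.real (fieldEvent r L D d lam ∩ {ω | r (i + 1) (j + 1) ω = δ}) =
        (∏ v ∈ D, fieldWt t a b d lam v) * inputProb t (a (i + 1) * b (j + 1)) δ := by
      intro δ
      refine (hasSum_measureReal_fiber P (fun y => hF.measurableSet_L (i + 1) (j + 1) {y}) _).unique
        ((congrArg (fun f => HasSum f _) (funext fun y => hstep δ y)).mpr ?_)
      by_cases hz : ∏ v ∈ D, fieldWt t a b d lam v = 0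
      · simp only [hz, zero_mul]
        exact hasSum_zero
      · have hgood := isGoodAt_of_prod_ne_zero h0 hD (Finset.prod_ne_zero_iff.1 hz)
        obtain ⟨μ, hμ, -, h1⟩ := hgood i (j + 1) fun i' j' hi' hj' =>
          hbelow _ ⟨by simp only; omega, by simp only; omega⟩ fun h => by
            rw [Prod.mk.injEq] at h; omega
        obtain ⟨κ, hκ, hμκ⟩ := h1 j rfl
        obtain ⟨ν, hν, h2, -⟩ := hgood (i + 1) j fun i' j' hi' hj' =>
          hbelow _ ⟨by simp only; omega, by simp only; omega⟩ fun h => by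
            rw [Prod.mk.injEq] at h; omega
        obtain ⟨κ', hκ', hνκ⟩ := h2 i rfl
        obtain rfl := hκ.unique hκ'
        have := (hasSum_rskUInput hp.t_nonneg hp.t_lt δ hκ hμ hν hμκ hνκ).mul_left
          ((∏ v ∈ D, fieldWt t a b d lam v) * inputProb t (a (i + 1) * b (j + 1)) δ)
        rwa [mul_one] at this
    refine (hasSum_measureReal_fiber P (fun y => hF.measurableSet_r (i + 1) (j + 1) y) _).unique
        ((congrArg (fun f => HasSum f _) (funext fun y => hstep' y)).mpr ?_)
    have := (hp.hasSum_inputProb i j).mul_left (∏ v ∈ D, fieldWt t a b d lam v)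
    rwa [mul_one] at this

/-- The restriction of the field to the boxes in `D`, a discrete random variable. -/
def boxValues (r : ℕ → ℕ → Ω → ℕ) (L : (i j : ℕ) → Ω → Signature j) (D : Finset (ℕ × ℕ)) (ω : Ω)
    (v : D) : ℕ × Signature (v.1.2 + 1) :=
  (r (v.1.1 + 1) (v.1.2 + 1) ω, L (v.1.1 + 1) (v.1.2 + 1) ω)

omit [MeasurableSpace Ω] in
theorem boxValues_eq_iff {r : ℕ → ℕ → Ω → ℕ} {L : (i j : ℕ) → Ω → Signature j}
    {D : Finset (ℕ × ℕ)} {ω ω₀ : Ω} : boxValues r L D ω = boxValues r L D ω₀ ↔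
      ω ∈ fieldEvent r L D (fun i j => r i j ω₀) (fun i j => L i j ω₀) := by
  constructor
  · intro h v hv
    have := congrFun h ⟨v, hv⟩
    rw [boxValues, boxValues, Prod.mk.injEq] at this
    exact this
  · intro h
    funext v
    exact Prod.ext (h v.1 v.2).1 (h v.1 v.2).2

omit [IsProbabilityMeasure P] in
theorem measurableSet_boxValues (hF : IsHLRSKField P t a b r L) (D : Finset (ℕ × ℕ))
    (y : (v : D) → ℕ × Signature (v.1.2 + 1)) : MeasurableSet {ω | boxValues r L D ω = y} := by
  have : {ω | boxValues r L D ω = y} = ⋂ v : D, {ω | r (v.1.1 + 1) (v.1.2 + 1) ω = (y v).1} ∩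
      {ω | L (v.1.1 + 1) (v.1.2 + 1) ω ∈ ({(y v).2} : Set _)} := by
    ext ω
    rw [Set.mem_iInter]
    constructor
    · rintro h v
      have h' : boxValues r L D ω = y := h
      rw [← h']
      exact ⟨rfl, rfl⟩
    · intro h
      exact funext fun v => Prod.ext (h v).1 (h v).2
  rw [this]
  exact MeasurableSet.iInter fun v => (hF.measurableSet_r _ _ _).inter (hF.measurableSet_L _ _ _)

/-- Almost surely all states are Young diagrams, which differ by horizontal strips. -/
theorem ae_isGoodAt (hF : IsHLRSKField P t a b r L) (hp : IsParam t a b) :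
    ∀ᵐ ω ∂P, ∀ i j, IsGoodAt (fun i j => L i j ω) i j := by
  rw [ae_all_iff]
  intro i
  rw [ae_all_iff]
  intro j
  set D := Finset.range i ×ˢ Finset.range j with hDdef
  have hD : IsLowerSet (D : Set (ℕ × ℕ)) := by
    rintro ⟨x, y⟩ ⟨x', y'⟩ ⟨h1, h2⟩ h
    simp only [hDdef, Finset.coe_product, Finset.coe_range, Set.mem_prod, Set.mem_Iio] at *
    omega
  have h1 : P.real {ω | ¬ IsGoodAt (fun i j => L i j ω) i j} = P.real Set.univ * 0 := by
    apply measureReal_eq_mul_of_fiber P (hF.measurableSet_boxValues D)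
    intro ω₀
    rw [mul_zero]
    by_cases hz : IsGoodAt (fun i j => L i j ω₀) i j
    · convert measureReal_empty (μ := P)
      rw [Set.eq_empty_iff_forall_notMem]
      rintro ω ⟨hω, hω'⟩
      apply hω
      have h3 := boxValues_eq_iff.1 hω'
      have hL : ∀ x y, x ≤ i → y ≤ j → L x y ω = L x y ω₀ := by
        intro x y hx hy
        cases x with
        | zero => rw [hF.left, hF.left]
        | succ x =>
          cases y with
          | zero => exact Subtype.ext (funext fun c => c.elim0)
          | succ y => exact (h3 (x, y) (Finset.mem_product.2 ⟨Finset.mem_range.2 (by omega),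
              Finset.mem_range.2 (by omega)⟩)).2
      obtain ⟨κ, e1, e2, e3⟩ := hz
      refine ⟨κ, ?_, fun i' hi' => ?_, fun j' hj' => ?_⟩
      · change Represents (L i j ω) κ
        rw [hL _ _ le_rfl le_rfl]
        exact e1
      · change ∃ κ', Represents (L i' j ω) κ' ∧ IsHorizontalStrip κ κ'
        rw [hL i' j (by omega) le_rfl]
        exact e2 i' hi'
      · change ∃ κ', Represents (L i j' ω) κ' ∧ IsHorizontalStrip κ κ'
        rw [hL i j' le_rfl (by omega)]
        exact e3 j' hj'
    · have h2 := hF.measureReal_fieldEvent hp hD (fun i j => r i j ω₀) (fun i j => L i j ω₀)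
        fun j => hF.left j ω₀
      have h3 : ∏ v ∈ D, fieldWt t a b (fun i j => r i j ω₀) (fun i j => L i j ω₀) v = 0 := by
        by_contra hc
        refine hz (isGoodAt_of_prod_ne_zero (fun j => hF.left j ω₀) hD
          (Finset.prod_ne_zero_iff.1 hc) i j fun i' j' hi' hj' => ?_)
        exact Finset.mem_product.2 ⟨Finset.mem_range.2 (by omega), Finset.mem_range.2 (by omega)⟩
      rw [h3] at h2
      refine le_antisymm (le_trans (measureReal_mono ?_) h2.le) measureReal_nonneg
      rintro ω ⟨-, hω⟩
      exact boxValues_eq_iff.1 hω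
  rw [mul_zero, measureReal_eq_zero_iff] at h1
  exact h1

/-- The state at `(i, j)` is almost surely a Young diagram, so that events are decomposed
according to it. -/
theorem hasSum_represents (hF : IsHLRSKField P t a b r L) (hp : IsParam t a b) (i j : ℕ)
    (A : Set Ω) : HasSum (fun κ => P.real (A ∩ {ω | Represents (L i j ω) κ})) (P.real A) := by
  classical
  have h1 := hasSum_measureReal_fiber P
    (Y := fun ω => if h : ∃ κ, Represents (L i j ω) κ then h.choose else ⊥)
    (fun y => hF.measurableSet_L i j {s | (if h : ∃ κ, Represents s κ then h.choose else ⊥) = y}) A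
  refine (congrArg (fun f => HasSum f _) (funext fun κ => ?_)).mpr h1
  apply measureReal_congr
  filter_upwards [hF.ae_isGoodAt hp] with ω hω
  obtain ⟨κ', h2, -⟩ := hω i j
  have hex : ∃ κ, Represents (L i j ω) κ := ⟨κ', h2⟩
  apply propext
  apply and_congr_right
  intro _
  change Represents (L i j ω) κ ↔ (if h : ∃ κ, Represents (L i j ω) κ then h.choose else ⊥) = κ
  rw [dif_pos hex]
  exact ⟨fun h => hex.choose_spec.unique h, fun h => h ▸ hex.choose_spec⟩

open Classical in
/-- The Markov property: given the field outside of the quadrant above the box `(i, j)`, the input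
and the output at the box have the law of the algorithm. -/
theorem markov_input (hF : IsHLRSKField P t a b r L) (hp : IsParam t a b) (i j K : ℕ)
    {A : Set Ω} {lam mu nu : YoungDiagram}
    (hA : ∀ ω ω', (∀ x ≤ K, ∀ y ≤ K, ¬ (i < x ∧ j < y) → L x y ω = L x y ω') → ω ∈ A → ω' ∈ A)
    (hAl : ∀ ω ∈ A, Represents (L i j ω) lam) (hAm : ∀ ω ∈ A, Represents (L i (j + 1) ω) mu)
    (hAn : ∀ ω ∈ A, Represents (L (i + 1) j ω) nu) (δ : ℕ) (rho : YoungDiagram) :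
    P.real (A ∩ {ω | r (i + 1) (j + 1) ω = δ} ∩ {ω | Represents (L (i + 1) (j + 1) ω) rho}) =
      P.real A * (inputProb t (a (i + 1) * b (j + 1)) δ *
        if colCarry lam mu nu rho 0 = δ then diagramU t lam mu nu rho else 0) := by
  obtain ⟨K', hK'⟩ : ∃ K', K ≤ K' ∧ i < K' ∧ j < K' := ⟨K + i + j + 1, by omega⟩
  -- condition on the field at the boxes of a large square outside of the quadrant above `(i, j)`
  set D := (Finset.range K' ×ˢ Finset.range K').filter fun v => ¬ (i ≤ v.1 ∧ j ≤ v.2) with hDdef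
  have hmemD : ∀ x y, (x, y) ∈ D ↔ (x < K' ∧ y < K') ∧ ¬ (i ≤ x ∧ j ≤ y) := by
    intro x y
    simp only [hDdef, Finset.mem_filter, Finset.mem_product, Finset.mem_range]
  have hD : IsLowerSet (D : Set (ℕ × ℕ)) := by
    rintro ⟨x, y⟩ ⟨x', y'⟩ ⟨h1, h2⟩ h
    rw [Finset.mem_coe, hmemD] at *
    simp only at h1 h2
    omega
  have hvD : (i, j) ∉ D := by rw [hmemD]; omega
  have hlow : IsLowerSet ((insert (i, j) D : Finset (ℕ × ℕ)) : Set (ℕ × ℕ)) := by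
    rintro ⟨x, y⟩ ⟨x', y'⟩ ⟨h1, h2⟩ h
    rw [Finset.mem_coe, Finset.mem_insert, hmemD, Prod.mk.injEq] at *
    simp only at h1 h2
    omega
  apply measureReal_eq_mul_of_fiber P (hF.measurableSet_boxValues D)
  intro ω₀
  have hL : ∀ ω, boxValues r L D ω = boxValues r L D ω₀ →
      ∀ x ≤ K', ∀ y ≤ K', ¬ (i < x ∧ j < y) → L x y ω = L x y ω₀ := by
    intro ω hω x hx y hy hxy
    have h3 := boxValues_eq_iff.1 hω
    cases x with
    | zero => rw [hF.left, hF.left]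
    | succ x =>
      cases y with
      | zero => exact Subtype.ext (funext fun c => c.elim0)
      | succ y => exact (h3 (x, y) ((hmemD x y).2 (by omega))).2
  by_cases h0 : ω₀ ∈ A
  · have hset : A ∩ {ω | boxValues r L D ω = boxValues r L D ω₀} =
        fieldEvent r L D (fun i j => r i j ω₀) (fun i j => L i j ω₀) := by
      ext ω
      rw [← boxValues_eq_iff]
      refine ⟨fun h => h.2, fun h => ⟨hA ω₀ ω (fun x hx y hy hxy => ?_) h0, h⟩⟩
      exact (hL ω h x (by omega) y (by omega) hxy).symm
    have hset2 : A ∩ {ω | r (i + 1) (j + 1) ω = δ} ∩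
          {ω | Represents (L (i + 1) (j + 1) ω) rho} ∩
          {ω | boxValues r L D ω = boxValues r L D ω₀} =
        fieldEvent r L D (fun i j => r i j ω₀) (fun i j => L i j ω₀) ∩
          {ω | r (i + 1) (j + 1) ω = δ} ∩ {ω | Represents (L (i + 1) (j + 1) ω) rho} := by
      rw [← hset]
      ext ω
      simp only [Set.mem_inter_iff]
      tauto
    rw [hset, hset2]
    have hlaw := hF.measureReal_fieldEvent hp hD (fun i j => r i j ω₀) (fun i j => L i j ω₀)
      fun j => hF.left j ω₀
    by_cases hz : ∏ v ∈ D, fieldWt t a b (fun i j => r i j ω₀) (fun i j => L i j ω₀) v = 0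
    · rw [hlaw, hz, zero_mul]
      refine le_antisymm ?_ measureReal_nonneg
      rw [← hz, ← hlaw]
      exact measureReal_mono fun ω hω => hω.1.1
    · have hgood := isGoodAt_of_prod_ne_zero (fun j => hF.left j ω₀) hD
        (Finset.prod_ne_zero_iff.1 hz)
      have hl := hAl ω₀ h0
      have hm := hAm ω₀ h0
      have hn := hAn ω₀ h0
      obtain ⟨μ, hμ, -, h1⟩ := hgood i (j + 1) fun i' j' hi' hj' => (hmemD _ _).2 (by omega)
      obtain ⟨κ, hκ, hμκ⟩ := h1 j rfl
      obtain ⟨ν, hν, h2, -⟩ := hgood (i + 1) j fun i' j' hi' hj' => (hmemD _ _).2 (by omega)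
      obtain ⟨κ', hκ', hνκ⟩ := h2 i rfl
      obtain rfl := hl.unique hκ
      obtain rfl := hl.unique hκ'
      obtain rfl := hm.unique hμ
      obtain rfl := hn.unique hν
      rw [hlaw]
      by_cases hrow : rho.colLen 0 ≤ j + 1
      · have hrep := represents_diagramSig hrow
        rw [show {ω | Represents (L (i + 1) (j + 1) ω) rho} =
          {ω | L (i + 1) (j + 1) ω = diagramSig (j + 1) rho} from Set.ext fun ω =>
            ⟨fun h => h.eq_diagramSig, fun h => by
              change Represents _ _
              rw [show L (i + 1) (j + 1) ω = diagramSig (j + 1) rho from h]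
              exact hrep⟩,
          measureReal_fieldEvent_inter (P := P) (r := r) (L := L) (t := t) (a := a) (b := b)
            (fun x y hx hy hxy => hvD (hD (show ((i, j) : ℕ × ℕ) ≤ (x, y) from ⟨hx, hy⟩) hxy))
            (fun d lam h0 => hF.measureReal_fieldEvent hp hlow d lam h0) _ _
            (fun j => hF.left j ω₀), mul_assoc]
        congr 2
        by_cases hU : rskUInput t δ (L i j ω₀) (L i (j + 1) ω₀) (L (i + 1) j ω₀)
            (diagramSig (j + 1) rho) = 0
        · rw [hU]
          split_ifs with hc
          · by_cases R : IsColumnRun lam mu nu rho (colCarry lam mu nu rho)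
            · rw [← R.rskUInput_eq hp.t_lt hl hm hn hrep hc, hU]
            · exact (diagramU_eq_zero R).symm
          · rfl
        · obtain ⟨rho', s, hr', R, hs⟩ :=
            exists_isColumnRun_of_rskUInput_ne_zero hl hm hn hμκ hνκ hU
          obtain rfl := hr'.unique hrep
          rw [← R.eq_colCarry, if_pos hs, R.rskUInput_eq hp.t_lt hl hm hn hrep hs]
      · rw [show {ω | Represents (L (i + 1) (j + 1) ω) rho} = ∅ from
          Set.eq_empty_of_forall_notMem fun ω hω => hrow hω.2, Set.inter_empty, measureReal_empty,
          diagramU_eq_zero fun R => hrow (by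
            have := R.rho_strip'.2 0
            have := hn.2
            omega), ite_self, mul_zero, mul_zero]
  · have e1 : A ∩ {ω | boxValues r L D ω = boxValues r L D ω₀} = ∅ := by
      rw [Set.eq_empty_iff_forall_notMem]
      rintro ω ⟨h1, h2⟩
      exact h0 (hA ω ω₀ (fun x hx y hy hxy => hL ω h2 x (by omega) y (by omega) hxy) h1)
    have e2 : A ∩ {ω | r (i + 1) (j + 1) ω = δ} ∩
          {ω | Represents (L (i + 1) (j + 1) ω) rho} ∩
          {ω | boxValues r L D ω = boxValues r L D ω₀} = ∅ := by
      rw [← Set.subset_empty_iff, ← e1]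
      exact fun ω h => ⟨h.1.1.1, h.2⟩
    rw [e1, e2]
    simp

end IsHLRSKField

/-! ### The law of the field along a down-right path -/

open Classical in
/-- The indicator of the empty diagram. -/
def botInd (κ : YoungDiagram) : ℝ := if κ = ⊥ then 1 else 0

/-- The end of the step up (`true`) or to the left (`false`) from the vertex `p`. -/
def stepPos (s : Bool) (p : ℕ × ℕ) : ℕ × ℕ := bif s then (p.1, p.2 + 1) else (p.1 - 1, p.2)

/-- The weight of a step of a path from state `κ` to state `κ'`. -/
def stepWeight (t : ℝ) (a b : ℕ → ℝ) (s : Bool) (p : ℕ × ℕ) (κ κ' : YoungDiagram) : ℝ :=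
  bif s then hlPsi t κ' κ * b (p.2 + 1) ^ (κ'.card - κ.card)
  else hlPhi t κ κ' * a p.1 ^ (κ.card - κ'.card)

/-- The contribution of a step up to the normalization: the boxes to the left of the step. -/
def stepConst (t : ℝ) (a b : ℕ → ℝ) (s : Bool) (p : ℕ × ℕ) : ℝ :=
  bif s then ∏ x ∈ Finset.range p.1,
    (1 - a (x + 1) * b (p.2 + 1)) / (1 - t * (a (x + 1) * b (p.2 + 1)))
  else 1

/-- The last vertex of the path from `p`, given by its steps and the states after them. -/
def pathPos : List (Bool × YoungDiagram) → ℕ × ℕ → ℕ × ℕ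
  | [], p => p
  | e :: w, p => pathPos w (stepPos e.1 p)

/-- The last state of a path that starts in state `κ`. -/
def pathEnd : List (Bool × YoungDiagram) → YoungDiagram → YoungDiagram
  | [], κ => κ
  | e :: w, _ => pathEnd w e.2

/-- The field has the given states along the path. -/
def pathEvent {Ω : Type*} (L : (i j : ℕ) → Ω → Signature j) :
    List (Bool × YoungDiagram) → ℕ × ℕ → Set Ω
  | [], _ => Set.univ
  | e :: w, p => {ω | Represents (L (stepPos e.1 p).1 (stepPos e.1 p).2 ω) e.2} ∩
      pathEvent L w (stepPos e.1 p)

/-- The product of the weights of the steps of a path. -/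
def pathWeight (t : ℝ) (a b : ℕ → ℝ) :
    List (Bool × YoungDiagram) → ℕ × ℕ → YoungDiagram → ℝ
  | [], _, _ => 1
  | e :: w, p, κ => stepWeight t a b e.1 p κ e.2 * pathWeight t a b w (stepPos e.1 p) e.2

/-- The normalization of a path: the product over all boxes on its left. -/
def pathConst (t : ℝ) (a b : ℕ → ℝ) : List (Bool × YoungDiagram) → ℕ × ℕ → ℝ
  | [], _ => 1
  | e :: w, p => stepConst t a b e.1 p * pathConst t a b w (stepPos e.1 p)

/-- The number of steps to the left. -/
def leftSteps (w : List (Bool × YoungDiagram)) : ℕ := w.countP fun e => !e.1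

/-- The number of boxes between the path and the axes. -/
def pathArea : List (Bool × YoungDiagram) → ℕ
  | [] => 0
  | e :: w => (bif e.1 then leftSteps w else 0) + pathArea w

section Append

variable (v w : List (Bool × YoungDiagram)) (p : ℕ × ℕ) (κ : YoungDiagram)

theorem pathPos_append : pathPos (v ++ w) p = pathPos w (pathPos v p) := by
  induction v generalizing p with
  | nil => rfl
  | cons e v ih => exact ih _

theorem pathEnd_append : pathEnd (v ++ w) κ = pathEnd w (pathEnd v κ) := by
  induction v generalizing κ with
  | nil => rfl
  | cons e v ih => exact ih _

theorem pathEvent_append {Ω : Type*} (L : (i j : ℕ) → Ω → Signature j) :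
    pathEvent L (v ++ w) p = pathEvent L v p ∩ pathEvent L w (pathPos v p) := by
  induction v generalizing p with
  | nil => exact (Set.univ_inter _).symm
  | cons e v ih => rw [List.cons_append, pathEvent, pathEvent, ih, Set.inter_assoc]; rfl

theorem pathWeight_append (t : ℝ) (a b : ℕ → ℝ) : pathWeight t a b (v ++ w) p κ =
    pathWeight t a b v p κ * pathWeight t a b w (pathPos v p) (pathEnd v κ) := by
  induction v generalizing p κ with
  | nil => exact (one_mul _).symm
  | cons e v ih => rw [List.cons_append, pathWeight, pathWeight, ih, mul_assoc]; rfl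

theorem pathConst_append (t : ℝ) (a b : ℕ → ℝ) : pathConst t a b (v ++ w) p =
    pathConst t a b v p * pathConst t a b w (pathPos v p) := by
  induction v generalizing p with
  | nil => exact (one_mul _).symm
  | cons e v ih => rw [List.cons_append, pathConst, pathConst, ih, mul_assoc]; rfl

end Append

theorem pathPos_fst (w : List (Bool × YoungDiagram)) (p : ℕ × ℕ) :
    (pathPos w p).1 = p.1 - leftSteps w := by
  induction w generalizing p with
  | nil => rfl
  | cons e w ih =>
    obtain ⟨s, κ⟩ := e
    rw [pathPos, ih, leftSteps, leftSteps, List.countP_cons]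
    cases s
    · simp [stepPos]
      omega
    · simp [stepPos]

theorem le_pathPos_snd (w : List (Bool × YoungDiagram)) (p : ℕ × ℕ) : p.2 ≤ (pathPos w p).2 := by
  induction w generalizing p with
  | nil => exact le_rfl
  | cons e w ih =>
    refine le_trans ?_ (ih _)
    obtain ⟨s, κ⟩ := e
    cases s <;> simp [stepPos]

theorem pathEvent_congr {Ω : Type*} {L : (i j : ℕ) → Ω → Signature j} {ω ω' : Ω}
    (w : List (Bool × YoungDiagram)) (p : ℕ × ℕ)
    (h : ∀ x y, x ≤ p.1 → y ≤ (pathPos w p).2 → L x y ω = L x y ω') (hω : ω ∈ pathEvent L w p) :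
    ω' ∈ pathEvent L w p := by
  induction w generalizing p with
  | nil => trivial
  | cons e w ih =>
    have hle : (stepPos e.1 p).1 ≤ p.1 := by
      obtain ⟨s, κ⟩ := e
      cases s <;> simp [stepPos]
    obtain ⟨h1, h2⟩ := hω
    refine ⟨?_, ih _ (fun x y hx hy => h x y (hx.trans hle) hy) h2⟩
    change Represents _ _ at h1
    change Represents _ _
    rwa [← h _ _ hle (le_pathPos_snd w _)]

theorem represents_pathEnd {Ω : Type*} {L : (i j : ℕ) → Ω → Signature j} {ω : Ω}
    (w : List (Bool × YoungDiagram)) (p : ℕ × ℕ) (κ : YoungDiagram)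
    (h : Represents (L p.1 p.2 ω) κ) (hω : ω ∈ pathEvent L w p) :
    Represents (L (pathPos w p).1 (pathPos w p).2 ω) (pathEnd w κ) := by
  induction w generalizing p κ with
  | nil => exact h
  | cons e w ih => exact ih _ _ hω.1 hω.2

theorem leftSteps_append (v w : List (Bool × YoungDiagram)) :
    leftSteps (v ++ w) = leftSteps v + leftSteps w := List.countP_append

theorem pathArea_corner (v w : List (Bool × YoungDiagram)) (κ κ₁ κ₂ : YoungDiagram) :
    pathArea (v ++ (true, κ) :: (false, κ₂) :: w) =
      pathArea (v ++ (false, κ₁) :: (true, κ₂) :: w) + 1 := by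
  induction v with
  | nil => simp [pathArea, leftSteps]; omega
  | cons e v ih =>
    rw [List.cons_append, List.cons_append, pathArea, pathArea, ih, leftSteps_append,
      leftSteps_append]
    simp [leftSteps]
    omega

/-- A path turns from up to left somewhere, or first goes left and then up. -/
theorem exists_corner (w : List (Bool × YoungDiagram)) :
    (∃ v κ κ' u, w = v ++ (true, κ) :: (false, κ') :: u) ∨
      ∃ l u, w = l ++ u ∧ (∀ e ∈ l, e.1 = false) ∧ ∀ e ∈ u, e.1 = true := by
  induction w with
  | nil => exact Or.inr ⟨[], [], rfl, by simp, by simp⟩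
  | cons e w ih =>
    rcases ih with ⟨v, κ, κ', u, rfl⟩ | ⟨l, u, rfl, hl, hu⟩
    · exact Or.inl ⟨e :: v, κ, κ', u, rfl⟩
    · obtain ⟨s, κ⟩ := e
      cases s with
      | false => exact Or.inr ⟨(false, κ) :: l, u, rfl, by simpa using hl, hu⟩
      | true =>
        cases l with
        | nil => exact Or.inr ⟨[], (true, κ) :: u, rfl, by simp, by simpa using hu⟩
        | cons e' l =>
          obtain ⟨s', κ'⟩ := e'
          obtain rfl : s' = false := hl (s', κ') (by simp)
          exact Or.inl ⟨[], κ, κ', l ++ u, rfl⟩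

theorem hlPhi_self (t : ℝ) (κ : YoungDiagram) : hlPhi t κ κ = 1 := by
  rw [hlPhi_eq (isHorizontalStrip_refl κ) le_rfl]
  apply Finset.prod_eq_one
  intro c _
  rw [turnFactor, if_neg (by simp [skewInd])]

theorem hlPsi_self (t : ℝ) (κ : YoungDiagram) : hlPsi t κ κ = 1 := by
  rw [hlPsi_eq (isHorizontalStrip_refl κ) le_rfl]
  apply Finset.prod_eq_one
  intro c _
  rw [turnFactor, if_neg (by simp [skewInd])]

theorem le_of_hlPhi_ne_zero {t : ℝ} {κ κ' : YoungDiagram} (h : hlPhi t κ κ' ≠ 0) : κ' ≤ κ := by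
  by_contra hc
  exact h (if_neg fun hs => hc hs.1)

theorem le_of_hlPsi_ne_zero {t : ℝ} {κ κ' : YoungDiagram} (h : hlPsi t κ κ' ≠ 0) : κ' ≤ κ := by
  by_contra hc
  exact h (if_neg fun hs => hc hs.1)

theorem le_pathEnd_of_up {t : ℝ} {a b : ℕ → ℝ} (u : List (Bool × YoungDiagram))
    (hu : ∀ e ∈ u, e.1 = true) (p : ℕ × ℕ) (κ : YoungDiagram)
    (h : pathWeight t a b u p κ ≠ 0) : κ ≤ pathEnd u κ := by
  induction u generalizing p κ with
  | nil => exact le_rfl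
  | cons e u ih =>
    obtain ⟨s, κ'⟩ := e
    obtain rfl : s = true := hu (s, κ') (by simp)
    rw [pathWeight] at h
    have h1 := left_ne_zero_of_mul h
    exact (le_of_hlPsi_ne_zero (left_ne_zero_of_mul h1)).trans
      (ih (fun e he => hu e (by simp [he])) _ _ (right_ne_zero_of_mul h))

namespace IsHLRSKField

variable {Ω : Type*} [MeasurableSpace Ω] {P : Measure Ω} [IsProbabilityMeasure P] {t : ℝ}
  {a b : ℕ → ℝ} {r : ℕ → ℕ → Ω → ℕ} {L : (i j : ℕ) → Ω → Signature j}

/-- The Markov property, without the input. -/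
theorem markov (hF : IsHLRSKField P t a b r L) (hp : IsParam t a b) (i j K : ℕ)
    {A : Set Ω} {lam mu nu : YoungDiagram}
    (hA : ∀ ω ω', (∀ x ≤ K, ∀ y ≤ K, ¬ (i < x ∧ j < y) → L x y ω = L x y ω') → ω ∈ A → ω' ∈ A)
    (hAl : ∀ ω ∈ A, Represents (L i j ω) lam) (hAm : ∀ ω ∈ A, Represents (L i (j + 1) ω) mu)
    (hAn : ∀ ω ∈ A, Represents (L (i + 1) j ω) nu) (rho : YoungDiagram) :
    P.real (A ∩ {ω | Represents (L (i + 1) (j + 1) ω) rho}) =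
      P.real A * stepLaw t (a (i + 1) * b (j + 1)) lam mu nu rho := by
  have h1 := hasSum_measureReal_fiber P (fun y => hF.measurableSet_r (i + 1) (j + 1) y)
    (A ∩ {ω | Represents (L (i + 1) (j + 1) ω) rho})
  refine h1.unique ?_
  rw [show P.real A * stepLaw t (a (i + 1) * b (j + 1)) lam mu nu rho = P.real A *
    (inputProb t (a (i + 1) * b (j + 1)) (colCarry lam mu nu rho 0) *
      if colCarry lam mu nu rho 0 = colCarry lam mu nu rho 0 then
        diagramU t lam mu nu rho else 0) by
    rw [if_pos rfl, stepLaw]]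
  refine (congrArg (fun f => HasSum f _) (funext fun δ => by
    rw [Set.inter_right_comm A, hF.markov_input hp i j K hA hAl hAm hAn])).mpr
    (hasSum_single (f := fun δ => P.real A * (inputProb t (a (i + 1) * b (j + 1)) δ *
    if colCarry lam mu nu rho 0 = δ then diagramU t lam mu nu rho else 0))
    (colCarry lam mu nu rho 0) fun δ hδ => ?_)
  rw [if_neg (fun h => hδ h.symm), mul_zero, mul_zero]

/-- The law along a path on the axes, where all states are empty: it is the base case of
`measureReal_pathEvent`. -/
theorem measureReal_pathEvent_axes (hF : IsHLRSKField P t a b r L)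
    {l u : List (Bool × YoungDiagram)} (hl : ∀ e ∈ l, e.1 = false) (hu : ∀ e ∈ u, e.1 = true)
    {p : ℕ × ℕ} (hp : p.1 = l.length) (hp0 : p.1 = 0 ∨ p.2 = 0) :
    P.real (pathEvent L (l ++ u) p) = pathConst t a b (l ++ u) p *
      pathWeight t a b (l ++ u) p ⊥ * botInd (pathEnd (l ++ u) ⊥) := by
  have axis : ∀ x y ω, x = 0 ∨ y = 0 → Represents (L x y ω) ⊥ := by
    rintro x y ω (rfl | rfl)
    · rw [hF.left]
      exact represents_zero _
    · exact represents_bot_of_length_zero _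
  have empty : ∀ (e : Bool × YoungDiagram) (w : List (Bool × YoungDiagram)) (p : ℕ × ℕ),
      ((stepPos e.1 p).1 = 0 ∨ (stepPos e.1 p).2 = 0) → e.2 ≠ ⊥ → pathEvent L (e :: w) p = ∅ := by
    intro e w p h hne
    rw [Set.eq_empty_iff_forall_notMem]
    rintro ω ⟨h1, -⟩
    exact hne (h1.unique (axis _ _ ω h))
  have full : ∀ (s : Bool) (w : List (Bool × YoungDiagram)) (p : ℕ × ℕ),
      ((stepPos s p).1 = 0 ∨ (stepPos s p).2 = 0) →
      pathEvent L ((s, ⊥) :: w) p = pathEvent L w (stepPos s p) := by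
    intro s w p h
    rw [pathEvent, Set.inter_eq_right]
    exact fun ω _ => axis _ _ ω h
  induction l generalizing p with
  | nil =>
    simp only [List.length_nil] at hp
    simp only [List.nil_append] at *
    clear hp0 hl
    induction u generalizing p with
    | nil => simp [pathEvent, pathConst, pathWeight, pathEnd, botInd]
    | cons e u ih =>
      obtain ⟨s, κ⟩ := e
      obtain rfl : s = true := hu (s, κ) (by simp)
      have hp' : (stepPos true p).1 = 0 := hp
      have hu' : ∀ e ∈ u, e.1 = true := fun e he => hu e (by simp [he])
      by_cases hκ : κ = ⊥
      · subst hκ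
        rw [full _ _ _ (Or.inl hp'), ih hu' hp', pathConst, pathWeight, stepConst, stepWeight]
        simp [hp, hlPsi_self, pathEnd]
      · rw [empty _ _ _ (Or.inl hp') hκ, measureReal_empty]
        rw [botInd]
        split_ifs with hend
        · rw [mul_one, pathWeight]
          by_contra hne
          have h1 := right_ne_zero_of_mul (right_ne_zero_of_mul (Ne.symm hne))
          have h2 := le_pathEnd_of_up u hu' _ _ h1
          have h3 : pathEnd u κ = ⊥ := hend
          rw [h3] at h2
          exact hκ (le_bot_iff.1 h2)
        · rw [mul_zero]
  | cons e l ih =>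
    obtain ⟨s, κ⟩ := e
    obtain rfl : s = false := hl (s, κ) (by simp)
    simp only [List.length_cons] at hp
    have hp' : (stepPos false p).1 = l.length := by simp [stepPos, hp]
    have h0 : (stepPos false p).1 = 0 ∨ (stepPos false p).2 = 0 :=
      Or.inr (hp0.resolve_left (by omega))
    by_cases hκ : κ = ⊥
    · subst hκ
      rw [List.cons_append, full _ _ _ h0, ih (fun e he => hl e (by simp [he])) hp' h0, pathConst,
        pathWeight, stepConst, stepWeight]
      simp [hlPhi_self, pathEnd]
    · rw [List.cons_append, empty _ _ _ h0 hκ, measureReal_empty, pathWeight, stepWeight]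
      have : hlPhi t ⊥ κ = 0 := by
        by_contra hc
        exact hκ (le_bot_iff.1 (le_of_hlPhi_ne_zero hc))
      simp [this]

/-- The law of the field along a path from the horizontal to the vertical axis. It is found by
pushing the corners of the path across boxes, where the Cauchy identity applies. -/
theorem measureReal_pathEvent (hF : IsHLRSKField P t a b r L) (hp : IsParam t a b) (M : ℕ)
    (w : List (Bool × YoungDiagram)) (hw : leftSteps w = M) :
    P.real (pathEvent L w (M, 0)) = pathConst t a b w (M, 0) *
      pathWeight t a b w (M, 0) ⊥ * botInd (pathEnd w ⊥) := by
  obtain ⟨n, hn⟩ : ∃ n, pathArea w = n := ⟨_, rfl⟩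
  induction n using Nat.strong_induction_on generalizing w with
  | _ n ih =>
  rcases exists_corner w with ⟨v, rho, mu, u, rfl⟩ | ⟨l, u, rfl, hl, hu⟩
  · obtain ⟨nu, hnu⟩ : ∃ nu, pathEnd v ⊥ = nu := ⟨_, rfl⟩
    obtain ⟨I, J, hIJ⟩ : ∃ I J, pathPos v (M, 0) = (I, J) := ⟨_, _, rfl⟩
    have hI := pathPos_fst v (M, 0)
    rw [hIJ] at hI
    rw [leftSteps_append] at hw
    have hls : leftSteps ((true, rho) :: (false, mu) :: u) = leftSteps u + 1 := by
      simp [leftSteps]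
    obtain ⟨i, rfl⟩ : ∃ i, I = i + 1 := ⟨I - 1, by simp only at hI; omega⟩
    -- the path on the other side of the box below the corner, through `lam`
    set A : YoungDiagram → Set Ω := fun lam =>
      pathEvent L (v ++ (false, lam) :: (true, mu) :: u) (M, 0) with hAdef
    have hAeq : ∀ lam, A lam = pathEvent L v (M, 0) ∩ ({ω | Represents (L i J ω) lam} ∩
        ({ω | Represents (L i (J + 1) ω) mu} ∩ pathEvent L u (i, J + 1))) := by
      intro lam
      rw [hAdef]
      simp only
      rw [pathEvent_append, hIJ]
      rfl
    have hEeq : pathEvent L (v ++ (true, rho) :: (false, mu) :: u) (M, 0) =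
        pathEvent L v (M, 0) ∩ ({ω | Represents (L (i + 1) (J + 1) ω) rho} ∩
        ({ω | Represents (L i (J + 1) ω) mu} ∩ pathEvent L u (i, J + 1))) := by
      rw [pathEvent_append, hIJ]
      rfl
    obtain ⟨K, hK⟩ : ∃ K, K = M + J + 1 + (pathPos u (i, J + 1)).2 := ⟨_, rfl⟩
    have hmarkov : ∀ lam, P.real (A lam ∩ {ω | Represents (L (i + 1) (J + 1) ω) rho}) =
        P.real (A lam) * stepLaw t (a (i + 1) * b (J + 1)) lam mu nu rho := by
      intro lam
      apply hF.markov hp i J K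
      · rintro ω ω' hag hω
        rw [hAeq] at hω ⊢
        obtain ⟨h1, h2, h3, h4⟩ := hω
        have hi : i + 1 ≤ M := by simp only at hI; omega
        refine ⟨pathEvent_congr v _ (fun x y hx hy => ?_) h1, ?_, ?_,
          pathEvent_congr u _ (fun x y hx hy => ?_) h4⟩
        · rw [hIJ] at hy
          simp only at hx hy
          exact hag x (by omega) y (by omega) (by omega)
        · change Represents _ _ at h2
          rwa [hag i (by omega) J (by omega) (by omega)] at h2
        · change Represents _ _ at h3
          rwa [hag i (by omega) (J + 1) (by omega) (by omega)] at h3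
        · simp only at hx
          exact hag x (by omega) y (by omega) (by omega)
      · intro ω hω
        rw [hAeq] at hω
        exact hω.2.1
      · intro ω hω
        rw [hAeq] at hω
        exact hω.2.2.1
      · intro ω hω
        rw [hAeq] at hω
        have h1 := represents_pathEnd v (M, 0) ⊥ (represents_bot_of_length_zero _) hω.1
        rw [hnu, hIJ] at h1
        exact h1
    -- sum over the state below the corner
    have hsum := hF.hasSum_represents hp i J
      (pathEvent L (v ++ (true, rho) :: (false, mu) :: u) (M, 0))
    have hterm : ∀ lam, P.real (pathEvent L (v ++ (true, rho) :: (false, mu) :: u) (M, 0) ∩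
        {ω | Represents (L i J ω) lam}) = (pathConst t a b v (M, 0) *
          stepConst t a b true (i, J) * pathConst t a b u (i, J + 1) *
          pathWeight t a b v (M, 0) ⊥ * pathWeight t a b u (i, J + 1) mu *
          botInd (pathEnd u mu)) *
          ((hlPsi t mu lam * b (J + 1) ^ (mu.card - lam.card)) *
        (hlPhi t nu lam * a (i + 1) ^ (nu.card - lam.card)) *
          stepLaw t (a (i + 1) * b (J + 1)) lam mu nu rho) := by
      intro lam
      rw [show pathEvent L (v ++ (true, rho) :: (false, mu) :: u) (M, 0) ∩
        {ω | Represents (L i J ω) lam} = A lam ∩ {ω | Represents (L (i + 1) (J + 1) ω) rho} by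
          rw [hAeq, hEeq]; ext ω; simp only [Set.mem_inter_iff]; tauto, hmarkov]
      have hIH := ih _ (by rw [← hn, pathArea_corner v u rho lam mu]; exact Nat.lt_add_one _)
        (v ++ (false, lam) :: (true, mu) :: u)
        (by rw [leftSteps_append, ← hw, hls]; simp [leftSteps]) rfl
      rw [show A lam = pathEvent L (v ++ (false, lam) :: (true, mu) :: u) (M, 0) from rfl, hIH,
        pathConst_append, pathWeight_append, pathEnd_append, hIJ, hnu]
      simp only [pathConst, pathWeight, pathEnd]
      rw [show stepPos false (i + 1, J) = (i, J) from rfl,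
        show stepPos true (i, J) = (i, J + 1) from rfl]
      simp only [stepWeight, cond_true, cond_false]
      rw [show stepConst t a b false (i + 1, J) = 1 from rfl]
      ring
    rw [funext hterm] at hsum
    have hC := (hasSum_stepLaw_cauchy hp.t_nonneg hp.t_lt (b (J + 1)) (a (i + 1))
        mu nu rho).mul_left
      (pathConst t a b v (M, 0) *
          stepConst t a b true (i, J) * pathConst t a b u (i, J + 1) *
          pathWeight t a b v (M, 0) ⊥ * pathWeight t a b u (i, J + 1) mu *
          botInd (pathEnd u mu))
    rw [hsum.unique hC, pathConst_append, pathWeight_append, pathEnd_append, hIJ, hnu]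
    simp only [pathConst, pathWeight, pathEnd]
    rw [show stepPos true (i + 1, J) = (i + 1, J + 1) from rfl,
        show stepPos false (i + 1, J + 1) = (i, J + 1) from rfl]
    simp only [stepWeight, cond_true, cond_false]
    rw [show stepConst t a b false (i + 1, J + 1) = 1 from rfl,
      show stepConst t a b true (i + 1, J) = stepConst t a b true (i, J) *
        ((1 - a (i + 1) * b (J + 1)) / (1 - t * (a (i + 1) * b (J + 1)))) from
          Finset.prod_range_succ _ _]
    ring
  · apply hF.measureReal_pathEvent_axes hl hu _ (Or.inr rfl)
    rw [leftSteps_append] at hw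
    have h1 : leftSteps l = l.length := List.countP_eq_length.2 fun e he => by simp [hl e he]
    have h2 : leftSteps u = 0 := List.countP_eq_zero.2 fun e he => by simp [hu e he]
    simp only
    omega

end IsHLRSKField

/-! ### Hall-Littlewood functions as sums over chains -/

theorem finite_below (lam : YoungDiagram) : {κ : YoungDiagram | κ ≤ lam}.Finite := by
  refine Set.Finite.of_finite_image (f := YoungDiagram.cells)
    ((Finset.finite_toSet lam.cells.powerset).subset ?_) fun κ _ κ' _ h => YoungDiagram.ext h
  rintro _ ⟨κ, hκ, rfl⟩
  simpa using YoungDiagram.cells_subset_iff.2 hκ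

/-- The diagrams contained in `lam`. -/
def diagramsBelow (lam : YoungDiagram) : Finset YoungDiagram := (finite_below lam).toFinset

theorem mem_diagramsBelow {lam κ : YoungDiagram} : κ ∈ diagramsBelow lam ↔ κ ≤ lam := by
  rw [diagramsBelow, Set.Finite.mem_toFinset]
  exact Iff.rfl

theorem le_of_hlP_ne_zero {t : ℝ} {xs : List ℝ} {lam mu : YoungDiagram}
    (h : hlP t xs lam mu ≠ 0) : mu ≤ lam := by
  induction xs generalizing mu with
  | nil =>
    rw [hlP] at h
    by_contra hc
    exact h (if_neg fun he => hc he.ge)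
  | cons x xs ih =>
    rw [hlP] at h
    obtain ⟨κ, hκ⟩ := not_forall.1 (mt finsum_eq_zero_of_forall_eq_zero h)
    exact (le_of_hlPsi_ne_zero (left_ne_zero_of_mul (left_ne_zero_of_mul hκ))).trans
      (ih (right_ne_zero_of_mul hκ))

theorem le_of_hlQ_ne_zero {t : ℝ} {xs : List ℝ} {lam mu : YoungDiagram}
    (h : hlQ t xs lam mu ≠ 0) : mu ≤ lam := by
  induction xs generalizing mu with
  | nil =>
    rw [hlQ] at h
    by_contra hc
    exact h (if_neg fun he => hc he.ge)
  | cons x xs ih =>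
    rw [hlQ] at h
    obtain ⟨κ, hκ⟩ := not_forall.1 (mt finsum_eq_zero_of_forall_eq_zero h)
    exact (le_of_hlPhi_ne_zero (left_ne_zero_of_mul (left_ne_zero_of_mul hκ))).trans
      (ih (right_ne_zero_of_mul hκ))

theorem hlP_cons_eq_tsum (t x : ℝ) (xs : List ℝ) (lam mu : YoungDiagram) : hlP t (x :: xs) lam mu =
    ∑' κ, hlPsi t κ mu * x ^ (κ.card - mu.card) * hlP t xs lam κ := by
  rw [hlP, tsum_eq_finsum]
  exact (finite_below lam).subset fun κ hκ => le_of_hlP_ne_zero (right_ne_zero_of_mul hκ)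

theorem hlQ_cons_eq_sum (t x : ℝ) (xs : List ℝ) {lam mu : YoungDiagram} {S : Finset YoungDiagram}
    (hS : ∀ κ ≤ lam, κ ∈ S) : hlQ t (x :: xs) lam mu =
    ∑ κ ∈ S, hlPhi t κ mu * x ^ (κ.card - mu.card) * hlQ t xs lam κ := by
  rw [hlQ]
  exact finsum_eq_sum_of_support_subset _ fun κ hκ =>
    hS κ (le_of_hlQ_ne_zero (right_ne_zero_of_mul hκ))

/-- The branching of `Q` in its last variable, which changes the larger diagram. -/
theorem hlQ_concat (t x : ℝ) (xs : List ℝ) {lam mu : YoungDiagram} : hlQ t (xs ++ [x]) lam mu =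
    ∑ κ ∈ diagramsBelow lam, hlPhi t lam κ * x ^ (lam.card - κ.card) * hlQ t xs κ mu := by
  induction xs generalizing mu with
  | nil =>
    rw [List.nil_append, hlQ_cons_eq_sum t x [] fun κ hκ => mem_diagramsBelow.2 hκ,
      Finset.sum_eq_single lam, Finset.sum_eq_single mu]
    · simp [hlQ]
    · intro κ _ hκ
      rw [hlQ, if_neg hκ, mul_zero]
    · intro h
      have : hlPhi t lam mu = 0 := by
        by_contra hc
        exact h (mem_diagramsBelow.2 (le_of_hlPhi_ne_zero hc))
      rw [this, zero_mul, zero_mul]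
    · intro κ _ hκ
      rw [hlQ, if_neg hκ.symm, mul_zero]
    · intro h
      exact absurd (mem_diagramsBelow.2 le_rfl) h
  | cons y ys ih =>
    rw [List.cons_append, hlQ_cons_eq_sum t y _ fun κ hκ => mem_diagramsBelow.2 hκ]
    have h1 : ∀ κ ∈ diagramsBelow lam,
        hlPhi t lam κ * x ^ (lam.card - κ.card) * hlQ t (y :: ys) κ mu =
        ∑ κ' ∈ diagramsBelow lam, hlPhi t lam κ * x ^ (lam.card - κ.card) *
          (hlPhi t κ' mu * y ^ (κ'.card - mu.card) * hlQ t ys κ κ') := by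
      intro κ hκ
      rw [hlQ_cons_eq_sum t y ys fun κ' hκ' =>
        mem_diagramsBelow.2 (hκ'.trans (mem_diagramsBelow.1 hκ)), Finset.mul_sum]
    rw [Finset.sum_congr rfl h1, Finset.sum_comm]
    refine Finset.sum_congr rfl fun κ _ => ?_
    rw [ih, Finset.mul_sum]
    exact Finset.sum_congr rfl fun κ' _ => by ring

/-! ### Paths with tests -/

/-- A letter of a word that describes a path: a step up (`true`) or to the left (`false`), whose
states are summed over, or a test whether the current state belongs to a set. -/
inductive PathLetter : Type
  | step (s : Bool)
  | test (F : Set YoungDiagram)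

open Classical in
/-- The sum of the weights of the paths from the state `κ` at the vertex `p` to the empty state that
follow the word and pass its tests. -/
def wordSum (t : ℝ) (a b : ℕ → ℝ) : List PathLetter → ℕ × ℕ → YoungDiagram → ℝ
  | [], _, κ => botInd κ
  | .step s :: w, p, κ => ∑' κ', stepWeight t a b s p κ κ' * wordSum t a b w (stepPos s p) κ'
  | .test F :: w, p, κ => if κ ∈ F then wordSum t a b w p κ else 0

/-- The field passes the tests of the word. -/
def wordEvent {Ω : Type*} (L : (i j : ℕ) → Ω → Signature j) : List PathLetter → ℕ × ℕ → Set Ω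
  | [], _ => Set.univ
  | .step s :: w, p => wordEvent L w (stepPos s p)
  | .test F :: w, p => {ω | ∃ κ ∈ F, Represents (L p.1 p.2 ω) κ} ∩ wordEvent L w p

/-- The normalization of the paths that follow a word. -/
def wordConst (t : ℝ) (a b : ℕ → ℝ) : List PathLetter → ℕ × ℕ → ℝ
  | [], _ => 1
  | .step s :: w, p => stepConst t a b s p * wordConst t a b w (stepPos s p)
  | .test _ :: w, p => wordConst t a b w p

/-- The number of steps to the left in a word. -/
def wordLeft : List PathLetter → ℕ
  | [] => 0
  | .step s :: w => (bif s then 0 else 1) + wordLeft w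
  | .test _ :: w => wordLeft w

namespace IsHLRSKField

variable {Ω : Type*} [MeasurableSpace Ω] {P : Measure Ω} [IsProbabilityMeasure P] {t : ℝ}
  {a b : ℕ → ℝ} {r : ℕ → ℕ → Ω → ℕ} {L : (i j : ℕ) → Ω → Signature j}

/-- The law of a path whose beginning is given and whose continuation is summed over, subject to the
tests of a word. -/
theorem measureReal_pathEvent_inter_wordEvent (hF : IsHLRSKField P t a b r L)
    (hp : IsParam t a b) (M : ℕ) (w : List PathLetter) (v : List (Bool × YoungDiagram))
    (hw : leftSteps v + wordLeft w = M) :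
    P.real (pathEvent L v (M, 0) ∩ wordEvent L w (pathPos v (M, 0))) =
      pathConst t a b v (M, 0) * wordConst t a b w (pathPos v (M, 0)) *
        pathWeight t a b v (M, 0) ⊥ * wordSum t a b w (pathPos v (M, 0)) (pathEnd v ⊥) := by
  induction w generalizing v with
  | nil =>
    rw [wordEvent, Set.inter_univ, hF.measureReal_pathEvent hp M v hw, wordConst, wordSum, mul_one]
  | cons e w ih =>
    cases e with
    | step s =>
      have hpos : ∀ κ, pathPos (v ++ [(s, κ)]) (M, 0) = stepPos s (pathPos v (M, 0)) := fun κ => by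
        rw [pathPos_append]
        rfl
      have hsum := hF.hasSum_represents hp (stepPos s (pathPos v (M, 0))).1
        (stepPos s (pathPos v (M, 0))).2
        (pathEvent L v (M, 0) ∩ wordEvent L (.step s :: w) (pathPos v (M, 0)))
      have hterm : ∀ κ, P.real (pathEvent L v (M, 0) ∩
            wordEvent L (.step s :: w) (pathPos v (M, 0)) ∩
            {ω | Represents (L (stepPos s (pathPos v (M, 0))).1
              (stepPos s (pathPos v (M, 0))).2 ω) κ}) =
          pathConst t a b v (M, 0) * wordConst t a b (.step s :: w) (pathPos v (M, 0)) *
            pathWeight t a b v (M, 0) ⊥ *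
            (stepWeight t a b s (pathPos v (M, 0)) (pathEnd v ⊥) κ *
              wordSum t a b w (stepPos s (pathPos v (M, 0))) κ) := by
        intro κ
        have h1 := ih (v ++ [(s, κ)]) (by
          rw [leftSteps_append, ← hw, wordLeft, add_assoc]
          congr 2
          cases s <;> simp [leftSteps])
        rw [hpos, pathEvent_append, pathConst_append, pathWeight_append, pathEnd_append] at h1
        simp only [pathEvent, pathConst, pathWeight, pathEnd, Set.inter_univ, mul_one] at h1
        rw [Set.inter_right_comm, wordEvent, h1, wordConst]
        ring
      rw [funext hterm] at hsum
      rw [← hsum.tsum_eq, tsum_mul_left, wordSum]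
    | test F =>
      rw [wordLeft] at hw
      have hrep : ∀ ω ∈ pathEvent L v (M, 0),
          Represents (L (pathPos v (M, 0)).1 (pathPos v (M, 0)).2 ω) (pathEnd v ⊥) := fun ω hω =>
        represents_pathEnd v (M, 0) ⊥ (represents_bot_of_length_zero _) hω
      rw [wordConst, wordSum, wordEvent]
      split_ifs with h
      · rw [← ih v hw, ← Set.inter_assoc]
        congr 2
        exact Set.inter_eq_left.2 fun ω hω => ⟨_, h, hrep ω hω⟩
      · rw [mul_zero]
        convert measureReal_empty (μ := P) using 2
        rw [Set.eq_empty_iff_forall_notMem]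
        rintro ω ⟨h1, ⟨κ, hκ, h2⟩, -⟩
        exact h ((hrep ω h1).unique h2 ▸ hκ)

theorem measureReal_wordEvent (hF : IsHLRSKField P t a b r L) (hp : IsParam t a b)
    (w : List PathLetter) : P.real (wordEvent L w (wordLeft w, 0)) =
      wordConst t a b w (wordLeft w, 0) * wordSum t a b w (wordLeft w, 0) ⊥ := by
  have h := hF.measureReal_pathEvent_inter_wordEvent hp (wordLeft w) w []
    (by simp [leftSteps])
  simpa [pathEvent, pathPos, pathConst, pathWeight, pathEnd] using h

end IsHLRSKField

/-! ### Straight pieces of a path -/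

section Blocks

open PathLetter

variable (t : ℝ) (a b : ℕ → ℝ)

theorem wordSum_replicate_up (w : List PathLetter) (lam : YoungDiagram) (n i j : ℕ)
    (κ : YoungDiagram) :
    wordSum t a b (List.replicate n (step true) ++ test {lam} :: w) (i, j) κ =
      hlP t ((List.range' (j + 1) n).map b) lam κ * wordSum t a b w (i, j + n) lam := by
  induction n generalizing j κ with
  | zero =>
    rw [List.replicate_zero, List.nil_append, wordSum, List.range'_zero, List.map_nil, hlP]
    by_cases h : κ = lam
    · subst h
      simp
    · rw [if_neg (Ne.symm h), zero_mul]
      exact if_neg h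
  | succ n ih =>
    rw [List.replicate_succ, List.cons_append, wordSum, List.range'_succ, List.map_cons,
      hlP_cons_eq_tsum, ← tsum_mul_right]
    refine tsum_congr fun κ' => ?_
    rw [show stepPos true (i, j) = (i, j + 1) from rfl, ih, stepWeight, cond_true, mul_assoc,
      show j + 1 + n = j + (n + 1) by omega]
    ring

theorem wordSum_replicate_left (w : List PathLetter) (n i j : ℕ) (lam : YoungDiagram) :
    wordSum t a b (List.replicate n (step false) ++ w) (i + n, j) lam =
      ∑ κ ∈ diagramsBelow lam,
        hlQ t ((List.range' (i + 1) n).map a) lam κ * wordSum t a b w (i, j) κ := by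
  induction n generalizing lam with
  | zero =>
    rw [List.replicate_zero, List.nil_append, List.range'_zero, List.map_nil,
      Finset.sum_eq_single lam]
    · simp [hlQ]
    · intro κ _ hκ
      rw [hlQ, if_neg hκ.symm, zero_mul]
    · intro h
      exact absurd (mem_diagramsBelow.2 le_rfl) h
  | succ n ih =>
    rw [List.replicate_succ, List.cons_append, wordSum, List.range'_1_concat, List.map_append,
      List.map_cons, List.map_nil, tsum_eq_sum (s := diagramsBelow lam)]
    · have h1 : ∀ κ' ∈ diagramsBelow lam,
          stepWeight t a b false (i + (n + 1), j) lam κ' *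
            wordSum t a b (List.replicate n (step false) ++ w)
              (stepPos false (i + (n + 1), j)) κ' =
          ∑ κ ∈ diagramsBelow lam, hlPhi t lam κ' * a (i + 1 + n) ^ (lam.card - κ'.card) *
            hlQ t ((List.range' (i + 1) n).map a) κ' κ * wordSum t a b w (i, j) κ := by
        intro κ' hκ'
        rw [show stepPos false (i + (n + 1), j) = (i + n, j) from rfl, ih, stepWeight, cond_false,
          Finset.mul_sum, show i + (n + 1) = i + 1 + n by omega]
        refine (Finset.sum_subset (fun κ hκ => mem_diagramsBelow.2
          ((mem_diagramsBelow.1 hκ).trans (mem_diagramsBelow.1 hκ'))) fun κ _ hκ => ?_).trans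
          (Finset.sum_congr rfl fun κ _ => ?_)
        · have : hlQ t ((List.range' (i + 1) n).map a) κ' κ = 0 := by
            by_contra hc
            exact hκ (mem_diagramsBelow.2 (le_of_hlQ_ne_zero hc))
          rw [this, zero_mul, mul_zero]
        · ring
      rw [Finset.sum_congr rfl h1, Finset.sum_comm]
      refine Finset.sum_congr rfl fun κ _ => ?_
      rw [hlQ_concat, Finset.sum_mul]
    · intro κ hκ
      have : hlPhi t lam κ = 0 := by
        by_contra hc
        exact hκ (mem_diagramsBelow.2 (le_of_hlPhi_ne_zero hc))
      rw [stepWeight, cond_false, this, zero_mul, zero_mul]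

theorem wordEvent_replicate_up {Ω : Type*} (L : (i j : ℕ) → Ω → Signature j)
    (w : List PathLetter) (n i j : ℕ) :
    wordEvent L (List.replicate n (step true) ++ w) (i, j) = wordEvent L w (i, j + n) := by
  induction n generalizing j with
  | zero => rfl
  | succ n ih =>
    rw [List.replicate_succ, List.cons_append, wordEvent]
    exact (ih (j + 1)).trans (by rw [show j + 1 + n = j + (n + 1) by omega])

theorem wordEvent_replicate_left {Ω : Type*} (L : (i j : ℕ) → Ω → Signature j)
    (w : List PathLetter) (n i j : ℕ) :
    wordEvent L (List.replicate n (step false) ++ w) (i + n, j) = wordEvent L w (i, j) := by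
  induction n with
  | zero => rfl
  | succ n ih =>
    rw [List.replicate_succ, List.cons_append, wordEvent]
    exact ih

theorem wordLeft_append (v w : List PathLetter) :
    wordLeft (v ++ w) = wordLeft v + wordLeft w := by
  induction v with
  | nil => exact (zero_add _).symm
  | cons e v ih =>
    cases e <;> simp only [List.cons_append, wordLeft, ih, add_assoc]

theorem wordLeft_replicate (s : Bool) (n : ℕ) :
    wordLeft (List.replicate n (step s)) = bif s then 0 else n := by
  induction n with
  | zero => cases s <;> rfl
  | succ n ih =>
    rw [List.replicate_succ, wordLeft, ih]
    cases s <;> simp [add_comm]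

theorem wordConst_replicate_left (w : List PathLetter) (n i j : ℕ) :
    wordConst t a b (List.replicate n (step false) ++ w) (i + n, j) = wordConst t a b w (i, j) := by
  induction n with
  | zero => rfl
  | succ n ih =>
    rw [List.replicate_succ, List.cons_append, wordConst, stepConst, cond_false, one_mul]
    exact ih

end Blocks

theorem hlKernel_append_right (t : ℝ) (xs ys ys' : List ℝ) :
    hlKernel t xs (ys ++ ys') = hlKernel t xs ys * hlKernel t xs ys' := by
  simp only [hlKernel, List.map_append, List.prod_append, List.prod_map_mul]

theorem hlKernel_cons_left (t x : ℝ) (xs ys : List ℝ) :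
    hlKernel t (x :: xs) ys = hlKernel t [x] ys * hlKernel t xs ys := by
  simp [hlKernel]

theorem paramBlock_append (c : ℕ → ℝ) {l m n : ℕ} (h1 : l ≤ m) (h2 : m ≤ n) :
    paramBlock c l m ++ paramBlock c m n = paramBlock c l n := by
  rw [paramBlock, paramBlock, paramBlock, ← List.map_append,
    show m + 1 = l + 1 + (m - l) by omega, List.range'_append_1,
    show m - l + (n - m) = n - l by omega]

/-- A step up contributes the inverse of the Cauchy kernel of its variable and the variables of the
columns on the left. -/
theorem stepConst_mul_hlKernel {t : ℝ} {a b : ℕ → ℝ} (hp : IsParam t a b) (i j : ℕ) :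
    stepConst t a b true (i, j) * hlKernel t [b (j + 1)] (paramBlock a 0 i) = 1 := by
  have h1 : hlKernel t [b (j + 1)] (paramBlock a 0 i) = ∏ x ∈ Finset.range i,
      (1 - t * (a (x + 1) * b (j + 1))) / (1 - a (x + 1) * b (j + 1)) := by
    rw [hlKernel, List.map_singleton, List.prod_singleton, paramBlock, Nat.sub_zero, zero_add,
      Finset.prod_range, List.map_map]
    rw [List.range'_eq_map_range, List.map_map, ← List.prod_ofFn]
    congr 1
    apply List.ext_getElem
    · simp
    · intro x _ _
      simp [mul_comm, add_comm]
  rw [h1, stepConst, cond_true, ← Finset.prod_mul_distrib]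
  apply Finset.prod_eq_one
  intro x _
  have h2 := hp.lt_one (x + 1) (j + 1) (by omega) (by omega)
  have h3 := mul_pos (hp.a_pos (x + 1) (by omega)) (hp.b_pos (j + 1) (by omega))
  have h4 : 1 - a (x + 1) * b (j + 1) ≠ 0 := by linarith
  have h5 : 1 - t * (a (x + 1) * b (j + 1)) ≠ 0 := by
    nlinarith [hp.t_nonneg, hp.t_lt]
  rw [div_mul_div_comm, mul_comm, div_self (mul_ne_zero h5 h4)]

theorem wordConst_replicate_up {t : ℝ} {a b : ℕ → ℝ} (hp : IsParam t a b) (w : List PathLetter)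
    (n i j : ℕ) :
    wordConst t a b (List.replicate n (.step true) ++ w) (i, j) *
      hlKernel t ((List.range' (j + 1) n).map b) (paramBlock a 0 i) =
        wordConst t a b w (i, j + n) := by
  induction n generalizing j with
  | zero => simp [hlKernel]
  | succ n ih =>
    rw [List.replicate_succ, List.cons_append, wordConst, List.range'_succ, List.map_cons,
      hlKernel_cons_left, mul_mul_mul_comm, stepConst_mul_hlKernel hp, one_mul]
    exact (ih (j + 1)).trans (by rw [show j + 1 + n = j + (n + 1) by omega])

/-! ### Down-right paths with given corners -/

/-- The word of the path with outer corners `(m i, n i)` and inner corners `(m (i + 1), n i)`, from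
`(m 0, n0)` to the vertical axis. It tests that the states at the outer corners are `lam i` and that
those at the inner corners belong to `F i`. -/
def cornerWord : (k n0 : ℕ) → (m n : Fin (k + 1) → ℕ) → (lam : Fin (k + 1) → YoungDiagram) →
    (F : Fin k → Set YoungDiagram) → List PathLetter
  | 0, n0, m, n, lam, _ => List.replicate (n 0 - n0) (.step true) ++ .test {lam 0} ::
      (List.replicate (m 0) (.step false) ++ [])
  | k + 1, n0, m, n, lam, F => List.replicate (n 0 - n0) (.step true) ++ .test {lam 0} ::
      (List.replicate (m 0 - m 1) (.step false) ++ .test (F 0) ::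
        cornerWord k (n 0) (Fin.tail m) (Fin.tail n) (Fin.tail lam) (Fin.tail F))

section Corners

variable {k : ℕ} {t : ℝ} {a b : ℕ → ℝ} {n0 : ℕ} {m n : Fin (k + 1) → ℕ}

theorem antitone_tail {m : Fin (k + 2) → ℕ} (hm : Antitone m) : Antitone (Fin.tail m) :=
  fun _ _ h => hm (Fin.succ_le_succ_iff.2 h)

theorem monotone_tail {n : Fin (k + 2) → ℕ} (hn : Monotone n) : Monotone (Fin.tail n) :=
  fun _ _ h => hn (Fin.succ_le_succ_iff.2 h)

theorem wordLeft_cornerWord (hm : Antitone m) (lam : Fin (k + 1) → YoungDiagram)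
    (F : Fin k → Set YoungDiagram) : wordLeft (cornerWord k n0 m n lam F) = m 0 := by
  induction k generalizing n0 with
  | zero =>
    simp [cornerWord, wordLeft_append, wordLeft_replicate, wordLeft]
  | succ k ih =>
    have h1 := ih (n0 := n 0) (n := Fin.tail n) (antitone_tail hm) (Fin.tail lam) (Fin.tail F)
    have h2 : m 1 ≤ m 0 := hm (Fin.zero_le _)
    have h3 : Fin.tail m 0 = m 1 := rfl
    simp [cornerWord, wordLeft_append, wordLeft_replicate, wordLeft, h1, h3, h2]

theorem wordEvent_cornerWord {Ω : Type*} (L : (i j : ℕ) → Ω → Signature j)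
    (hm : Antitone m) (hn : Monotone n) (hn0 : n0 ≤ n 0) (lam : Fin (k + 1) → YoungDiagram)
    (F : Fin k → Set YoungDiagram) : wordEvent L (cornerWord k n0 m n lam F) (m 0, n0) =
      {ω | (∀ i, Represents (L (m i) (n i) ω) (lam i)) ∧
        ∀ i : Fin k, ∃ κ ∈ F i, Represents (L (m i.succ) (n i.castSucc) ω) κ} := by
  induction k generalizing n0 with
  | zero =>
    rw [cornerWord, wordEvent_replicate_up, wordEvent, Nat.add_sub_cancel' hn0]
    have h := wordEvent_replicate_left L [] (m 0) 0 (n 0)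
    rw [zero_add (m 0)] at h
    rw [h]
    ext ω
    simp [wordEvent, Fin.forall_fin_one]
  | succ k ih =>
    have h2 : m 1 ≤ m 0 := hm (Fin.zero_le _)
    have h := wordEvent_replicate_left L (.test (F 0) ::
        cornerWord k (n 0) (Fin.tail m) (Fin.tail n) (Fin.tail lam) (Fin.tail F))
        (m 0 - m 1) (m 1) (n 0)
    have h1 := ih (n0 := n 0) (antitone_tail hm) (monotone_tail hn) (hn (Fin.zero_le _))
      (Fin.tail lam) (Fin.tail F)
    rw [Nat.add_sub_cancel' h2, wordEvent,
      show (m 1, n 0) = (Fin.tail m 0, n 0) from rfl, h1] at h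
    rw [cornerWord, wordEvent_replicate_up, wordEvent, Nat.add_sub_cancel' hn0, h]
    ext ω
    simp only [Set.mem_inter_iff, Set.mem_ofPred_eq, Fin.forall_fin_succ (n := k + 1),
      Fin.forall_fin_succ (n := k), Set.mem_singleton_iff, exists_eq_left]
    simp only [Fin.tail]
    tauto

open Classical in
theorem wordSum_cornerWord (hm : Antitone m) (hn : Monotone n) (hn0 : n0 ≤ n 0)
    (lam : Fin (k + 1) → YoungDiagram) (F : Fin k → Set YoungDiagram) (κ : YoungDiagram) :
    wordSum t a b (cornerWord k n0 m n lam F) (m 0, n0) κ =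
      hlP t (paramBlock b n0 (n 0)) (lam 0) κ *
        ((∏ i : Fin k, ∑ μ ∈ diagramsBelow (lam i.castSucc), if μ ∈ F i then
            hlQ t (paramBlock a (m i.succ) (m i.castSucc)) (lam i.castSucc) μ *
              hlP t (paramBlock b (n i.castSucc) (n i.succ)) (lam i.succ) μ else 0) *
        hlQ t (paramBlock a 0 (m (Fin.last k))) (lam (Fin.last k)) ⊥) := by
  induction k generalizing n0 κ with
  | zero =>
    have h := wordSum_replicate_left t a b [] (m 0) 0 (n 0) (lam 0)
    rw [zero_add (m 0), Finset.sum_eq_single ⊥] at h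
    · rw [cornerWord, wordSum_replicate_up, Nat.add_sub_cancel' hn0, h]
      simp [wordSum, botInd, paramBlock]
    · intro κ _ hκ
      rw [wordSum, botInd, if_neg hκ, mul_zero]
    · intro h
      exact absurd (mem_diagramsBelow.2 bot_le) h
  | succ k ih =>
    have h2 : m 1 ≤ m 0 := hm (Fin.zero_le _)
    have h := wordSum_replicate_left t a b (.test (F 0) ::
        cornerWord k (n 0) (Fin.tail m) (Fin.tail n) (Fin.tail lam) (Fin.tail F))
        (m 0 - m 1) (m 1) (n 0) (lam 0)
    have h1 := fun μ => ih (n0 := n 0) (antitone_tail hm) (monotone_tail hn) (hn (Fin.zero_le _))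
      (Fin.tail lam) (Fin.tail F) μ
    rw [Nat.add_sub_cancel' h2] at h
    rw [cornerWord, wordSum_replicate_up, Nat.add_sub_cancel' hn0, h, paramBlock,
      Fin.prod_univ_succ, mul_assoc (∑ μ ∈ _, _), Finset.sum_mul]
    congr 1
    refine Finset.sum_congr rfl fun μ _ => ?_
    rw [wordSum]
    change _ * (if μ ∈ F 0 then wordSum t a b _ (Fin.tail m 0, n 0) μ else 0) =
      (if μ ∈ F 0 then _ else 0) * _
    split_ifs
    · rw [h1, mul_assoc]
      rfl
    · rw [mul_zero, zero_mul]

/-- The normalization of a path is a product of Cauchy kernels, one for each vertical piece. -/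
theorem wordConst_cornerWord (hp : IsParam t a b) (hm : Antitone m) (hn : Monotone n)
    (hn0 : n0 ≤ n 0) (lam : Fin (k + 1) → YoungDiagram) (F : Fin k → Set YoungDiagram) :
    wordConst t a b (cornerWord k n0 m n lam F) (m 0, n0) *
      ∏ i : Fin (k + 1), hlKernel t (paramBlock b ((Fin.cons n0 n : Fin (k + 2) → ℕ) i.castSucc)
        (n i)) (paramBlock a 0 (m i)) = 1 := by
  induction k generalizing n0 with
  | zero =>
    have h := wordConst_replicate_left t a b [] (m 0) 0 (n 0)
    rw [zero_add (m 0)] at h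
    rw [Fin.prod_univ_one, cornerWord]
    exact (wordConst_replicate_up hp _ _ _ _).trans
      (by rw [wordConst, Nat.add_sub_cancel' hn0, h, wordConst])
  | succ k ih =>
    have h2 : m 1 ≤ m 0 := hm (Fin.zero_le _)
    have h := wordConst_replicate_left t a b (.test (F 0) ::
        cornerWord k (n 0) (Fin.tail m) (Fin.tail n) (Fin.tail lam) (Fin.tail F))
        (m 0 - m 1) (m 1) (n 0)
    rw [Nat.add_sub_cancel' h2, wordConst] at h
    have h1 := ih (n0 := n 0) (antitone_tail hm) (monotone_tail hn) (hn (Fin.zero_le _))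
      (Fin.tail lam) (Fin.tail F)
    rw [show n 0 = (n 0) from rfl, Fin.cons_self_tail n] at h1
    rw [Fin.prod_univ_succ, ← mul_assoc, cornerWord]
    have h3 := wordConst_replicate_up hp (.test {lam 0} ::
      (List.replicate (m 0 - m 1) (.step false) ++ .test (F 0) ::
        cornerWord k (n 0) (Fin.tail m) (Fin.tail n) (Fin.tail lam) (Fin.tail F)))
        (n 0 - n0) (m 0) n0
    rw [wordConst, Nat.add_sub_cancel' hn0, h] at h3
    refine Eq.trans ?_ h1
    congr 1

/-- The specializations `Y_i, …, Y_k` together consist of the first `m_i` parameters. -/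
theorem prod_hlKernel_minusBlock (hm : Antitone m) (xs : List ℝ) (i : Fin (k + 1)) :
    ∏ j ∈ Finset.Ici i, hlKernel t xs (minusBlock a m j) =
      hlKernel t xs (paramBlock a 0 (m i)) := by
  have hlast : minusBlock a m (Fin.last k) = paramBlock a 0 (m (Fin.last k)) := by
    rw [minusBlock, Fin.succ_last, Fin.snoc_last]
  have hcast : ∀ i : Fin k, ∀ (m : Fin (k + 1) → ℕ),
      (Fin.snoc m 0 : Fin (k + 2) → ℕ) i.castSucc.succ = m i.succ := fun i m => by
    rw [Fin.succ_castSucc, Fin.snoc_castSucc]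
  induction i using Fin.reverseInduction with
  | last =>
    rw [← hlast, show Finset.Ici (Fin.last k) = {Fin.last k} by
      ext j; simp [Fin.last_le_iff], Finset.prod_singleton]
  | cast i ih =>
    rw [show Finset.Ici i.castSucc = insert i.castSucc (Finset.Ici i.succ) by
      ext j; simp only [Finset.mem_Ici, Finset.mem_insert, Fin.le_def, Fin.ext_iff,
        Fin.val_castSucc, Fin.val_succ]; omega, Finset.prod_insert (by simp), ih, minusBlock, hcast,
      mul_comm, ← hlKernel_append_right, paramBlock_append a (Nat.zero_le _)
        (hm (Fin.castSucc_le_succ i))]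

/-- The normalization of a path is the inverse of that of the Hall-Littlewood process: both are
products over the boxes between the path and the axes. -/
theorem wordConst_mul_hlNorm (hp : IsParam t a b) (hm : Antitone m) (hn : Monotone n)
    (lam : Fin (k + 1) → YoungDiagram) (F : Fin k → Set YoungDiagram) :
    wordConst t a b (cornerWord k 0 m n lam F) (m 0, 0) *
      hlNorm t (plusBlock b n) (minusBlock a m) = 1 := by
  rw [hlNorm]
  simp_rw [prod_hlKernel_minusBlock hm]
  exact wordConst_cornerWord hp hm hn (Nat.zero_le _) lam F

end Corners

namespace IsHLRSKField

variable {Ω : Type*} [MeasurableSpace Ω] {P : Measure Ω} [IsProbabilityMeasure P] {t : ℝ}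
  {a b : ℕ → ℝ} {r : ℕ → ℕ → Ω → ℕ} {L : (i j : ℕ) → Ω → Signature j}
  {k : ℕ} {m n : Fin (k + 1) → ℕ}

open Classical in
/-- The law of the field at the outer corners of a down-right path, with the states at the inner
corners restricted to given sets. -/
theorem measureReal_corners (hF : IsHLRSKField P t a b r L) (hp : IsParam t a b)
    (hm : Antitone m) (hn : Monotone n) (lam : Fin (k + 1) → YoungDiagram)
    (F : Fin k → Set YoungDiagram) :
    P.real {ω | (∀ i, Represents (L (m i) (n i) ω) (lam i)) ∧
        ∀ i : Fin k, ∃ κ ∈ F i, Represents (L (m i.succ) (n i.castSucc) ω) κ} =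
      hlP t (plusBlock b n 0) (lam 0) ⊥ *
        (∏ i : Fin k, ∑ μ ∈ diagramsBelow (lam i.castSucc), if μ ∈ F i then
            hlQ t (minusBlock a m i.castSucc) (lam i.castSucc) μ *
              hlP t (plusBlock b n i.succ) (lam i.succ) μ else 0) *
        hlQ t (minusBlock a m (Fin.last k)) (lam (Fin.last k)) ⊥ /
          hlNorm t (plusBlock b n) (minusBlock a m) := by
  have h1 := hF.measureReal_wordEvent hp (cornerWord k 0 m n lam F)
  have h2 := wordConst_mul_hlNorm hp hm hn lam F
  rw [wordLeft_cornerWord hm, wordEvent_cornerWord L hm hn (Nat.zero_le _),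
    wordSum_cornerWord hm hn (Nat.zero_le _)] at h1
  have hlast : minusBlock a m (Fin.last k) = paramBlock a 0 (m (Fin.last k)) := by
    rw [minusBlock, Fin.succ_last, Fin.snoc_last]
  have hcast : ∀ i : Fin k, minusBlock a m i.castSucc = paramBlock a (m i.succ) (m i.castSucc) :=
    fun i => by rw [minusBlock, Fin.succ_castSucc, Fin.snoc_castSucc]
  have hsucc : ∀ i : Fin k, plusBlock b n i.succ = paramBlock b (n i.castSucc) (n i.succ) :=
    fun i => by rw [plusBlock, ← Fin.succ_castSucc, Fin.cons_succ]
  have hzero : plusBlock b n 0 = paramBlock b 0 (n 0) := rfl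
  rw [h1, hlast, hzero, eq_div_iff (right_ne_zero_of_mul_eq_one h2), mul_right_comm, h2, one_mul,
    mul_assoc]
  simp_rw [hcast, hsucc]

theorem measureReal_eq_hlProcessFull (hF : IsHLRSKField P t a b r L) (hp : IsParam t a b)
    (hm : Antitone m) (hn : Monotone n) (lam : Fin (k + 1) → YoungDiagram)
    (mu : Fin k → YoungDiagram) :
    P.real {ω | (∀ i, Represents (L (m i) (n i) ω) (lam i)) ∧
        ∀ i : Fin k, Represents (L (m i.succ) (n i.castSucc) ω) (mu i)} =
      hlProcessFull t (plusBlock b n) (minusBlock a m) lam mu := by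
  have h := hF.measureReal_corners hp hm hn lam fun i => {mu i}
  simp only [Set.mem_singleton_iff, exists_eq_left] at h
  rw [h, hlProcessFull]
  congr 4
  funext i
  rw [Finset.sum_eq_single (mu i)]
  · exact if_pos rfl
  · exact fun μ _ hμ => if_neg hμ
  · intro hμ
    refine (if_pos (Set.mem_singleton _)).trans ?_
    by_contra hc
    exact hμ (mem_diagramsBelow.2 (le_of_hlQ_ne_zero (left_ne_zero_of_mul hc)))

theorem measureReal_eq_hlProcess (hF : IsHLRSKField P t a b r L) (hp : IsParam t a b)
    (hm : Antitone m) (hn : Monotone n) (lam : Fin (k + 1) → YoungDiagram) :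
    P.real {ω | ∀ i, Represents (L (m i) (n i) ω) (lam i)} =
      hlProcess t (plusBlock b n) (minusBlock a m) lam := by
  have h := hF.measureReal_corners hp hm hn lam fun _ => Set.univ
  simp only [Set.mem_univ, true_and, if_true] at h
  have h1 : P.real {ω | ∀ i, Represents (L (m i) (n i) ω) (lam i)} =
      P.real {ω | (∀ i, Represents (L (m i) (n i) ω) (lam i)) ∧
        ∀ i : Fin k, ∃ κ, Represents (L (m i.succ) (n i.castSucc) ω) κ} := by
    apply measureReal_congr
    filter_upwards [hF.ae_isGoodAt hp] with ω hω
    apply propext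
    refine ⟨fun h => ⟨h, fun i => ?_⟩, fun h => h.1⟩
    obtain ⟨κ, hκ, -⟩ := hω (m i.succ) (n i.castSucc)
    exact ⟨κ, hκ⟩
  rw [h1, h, hlProcess]
  congr 4
  funext i
  rw [hlPsiKernel, finsum_eq_sum_of_support_subset (s := diagramsBelow (lam i.castSucc))]
  · exact Finset.sum_congr rfl fun μ _ => mul_comm _ _
  · exact fun κ hκ => mem_diagramsBelow.2 (le_of_hlQ_ne_zero (right_ne_zero_of_mul hκ))

end IsHLRSKField

/-! ### Existence of the field -/

/-- Every summable nonnegative family with sum `1` is the law of a discrete random variable. -/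
theorem exists_measure_of_hasSum {α : Type*} [MeasurableSpace α] [MeasurableSingletonClass α]
    {f : α → ℝ} (h0 : ∀ x, 0 ≤ f x) (hf : HasSum f 1) :
    ∃ p : Measure α, IsProbabilityMeasure p ∧ ∀ x, p.real {x} = f x := by
  have h1 : HasSum (fun x => ENNReal.ofReal (f x)) 1 := by
    rw [← ENNReal.ofReal_one, ← hf.tsum_eq, ENNReal.ofReal_tsum_of_nonneg h0 hf.summable]
    exact ENNReal.summable.hasSum
  set q : PMF α := ⟨fun x => ENNReal.ofReal (f x), h1⟩ with hq
  refine ⟨q.toMeasure, inferInstance, fun x => ?_⟩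
  rw [measureReal_def, PMF.toMeasure_apply_singleton _ _ (measurableSet_singleton x)]
  exact ENNReal.toReal_ofReal (h0 x)

theorem inputProb_nonneg {t u : ℝ} (hu0 : 0 ≤ u) (hu1 : u < 1) (ht1 : t < 1) (d : ℕ) :
    0 ≤ inputProb t u d := by
  have h1 : t * u ≤ 1 := by nlinarith
  rw [inputProb]
  refine mul_nonneg (mul_nonneg ?_ (pow_nonneg hu0 d)) (div_nonneg (by linarith) (by linarith))
  split_ifs
  · exact zero_le_one
  · linarith

/-- The three input signatures of the algorithm are Young diagrams which form horizontal strips. -/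
def IsLegitInput {N : ℕ} (sl : Signature N) (sm : Signature (N + 1)) (sn : Signature N) : Prop :=
  ∃ lam mu nu, Represents sl lam ∧ Represents sm mu ∧ Represents sn nu ∧
    IsHorizontalStrip mu lam ∧ IsHorizontalStrip nu lam

/-- The inputs of the algorithm at a vertex with second coordinate `N + 1`. -/
abbrev RSKInput (N : ℕ) : Type := Signature N × Signature (N + 1) × Signature N × ℕ

/-- The law of the output of the algorithm. For inputs that do not occur it is chosen
arbitrarily. -/
theorem exists_rskMeasure {t : ℝ} (ht0 : 0 ≤ t) (ht1 : t < 1) {N : ℕ} (σ : RSKInput N) :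
    ∃ p : Measure (Signature (N + 1)), IsProbabilityMeasure p ∧
      (IsLegitInput σ.1 σ.2.1 σ.2.2.1 →
        ∀ s, p.real {s} = rskUInput t σ.2.2.2 σ.1 σ.2.1 σ.2.2.1 s) := by
  by_cases h : IsLegitInput σ.1 σ.2.1 σ.2.2.1
  · obtain ⟨lam, mu, nu, hl, hm, hn, hmu, hnu⟩ := id h
    have hnonneg : ∀ s, 0 ≤ rskUInput t σ.2.2.2 σ.1 σ.2.1 σ.2.2.1 s := by
      intro s
      by_cases h0 : rskUInput t σ.2.2.2 σ.1 σ.2.1 σ.2.2.1 s = 0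
      · exact h0.ge
      · obtain ⟨rho, c, hr, R, hc⟩ := exists_isColumnRun_of_rskUInput_ne_zero hl hm hn hmu hnu h0
        rw [R.rskUInput_eq ht1 hl hm hn hr hc]
        exact diagramU_nonneg ht0 ht1 _ _ _ _
    obtain ⟨p, hp, hp'⟩ := exists_measure_of_hasSum hnonneg
      (hasSum_rskUInput ht0 ht1 σ.2.2.2 hl hm hn hmu hnu)
    exact ⟨p, hp, fun _ => hp'⟩
  · exact ⟨Measure.dirac σ.2.1, inferInstance, fun h' => absurd h' h⟩

/-- The noise at a box: the input variable, and the outputs of the algorithm for all inputs. -/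
abbrev BoxNoise (N : ℕ) : Type := ℕ × (RSKInput N → Signature (N + 1))

/-- The law of the noise at a box, where the outputs for different inputs are independent. -/
theorem exists_noiseMeasure {t : ℝ} {a b : ℕ → ℝ} (hp : IsParam t a b) (v : ℕ × ℕ) :
    ∃ p : Measure (BoxNoise v.2), IsProbabilityMeasure p ∧
      ∀ (σ : RSKInput v.2) (s : Signature (v.2 + 1)), IsLegitInput σ.1 σ.2.1 σ.2.2.1 →
        p.real {x | x.1 = σ.2.2.2 ∧ x.2 σ = s} =
          inputProb t (a (v.1 + 1) * b (v.2 + 1)) σ.2.2.2 *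
            rskUInput t σ.2.2.2 σ.1 σ.2.1 σ.2.2.1 s := by
  have hu0 := (mul_pos (hp.a_pos (v.1 + 1) (by omega)) (hp.b_pos (v.2 + 1) (by omega))).le
  have hu1 := hp.lt_one (v.1 + 1) (v.2 + 1) (by omega) (by omega)
  obtain ⟨q, hq, hq'⟩ := exists_measure_of_hasSum (inputProb_nonneg hu0 hu1 hp.t_lt)
    (hasSum_inputProb hu0 hu1 hp.t_lt)
  choose p hp1 hp2 using fun σ : RSKInput v.2 => exists_rskMeasure hp.t_nonneg hp.t_lt σ
  refine ⟨q.prod (Measure.infinitePi p), inferInstance, fun σ s hσ => ?_⟩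
  rw [show {x : BoxNoise v.2 | x.1 = σ.2.2.2 ∧ x.2 σ = s} =
    ({σ.2.2.2} : Set ℕ) ×ˢ {f : RSKInput v.2 → Signature (v.2 + 1) | f σ = s} from rfl,
    measureReal_prod_prod, hq', ← hp2 σ hσ s]
  congr 1
  exact (measurePreserving_eval_infinitePi p σ).measureReal_preimage (s := {s})
    (measurableSet_singleton s).nullMeasurableSet

/-- The field generated by the noise. -/
def noiseField (ω : (v : ℕ × ℕ) → BoxNoise v.2) : (i j : ℕ) → Signature j
  | 0, j => Signature.zero j
  | _ + 1, 0 => Signature.zero 0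
  | i + 1, j + 1 => (ω (i, j)).2 (noiseField ω i j, noiseField ω i (j + 1),
      noiseField ω (i + 1) j, (ω (i, j)).1)

theorem measurable_noiseField : ∀ i j, Measurable fun ω => noiseField ω i j
  | 0, j => by
    simp only [noiseField]
    exact measurable_const
  | _ + 1, 0 => by
    simp only [noiseField]
    exact measurable_const
  | i + 1, j + 1 => by
    simp only [noiseField]
    have h1 : Measurable fun x : (RSKInput j → Signature (j + 1)) × RSKInput j => x.1 x.2 :=
      measurable_from_prod_countable_left fun σ => measurable_pi_apply σ
    have h2 := measurable_noiseField i j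
    have h3 := measurable_noiseField i (j + 1)
    have h4 := measurable_noiseField (i + 1) j
    have h5 : Measurable fun ω : (v : ℕ × ℕ) → BoxNoise v.2 => ω (i, j) := measurable_pi_apply _
    exact h1.comp (h5.snd.prodMk (h2.prodMk (h3.prodMk (h4.prodMk h5.fst))))

/-- Once the values of the field in a rectangle are prescribed, every box is a condition on its own
noise only. -/
theorem noiseField_event (M N : ℕ) (d : ℕ → ℕ → ℕ) (lam : (i j : ℕ) → Signature j)
    (h0 : ∀ j, lam 0 j = Signature.zero j) (ω : (v : ℕ × ℕ) → BoxNoise v.2) :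
    (∀ i < M, ∀ j < N, (ω (i, j)).1 = d (i + 1) (j + 1) ∧
        noiseField ω (i + 1) (j + 1) = lam (i + 1) (j + 1)) ↔
      ∀ i < M, ∀ j < N, (ω (i, j)).1 = d (i + 1) (j + 1) ∧
        (ω (i, j)).2 (lam i j, lam i (j + 1), lam (i + 1) j, d (i + 1) (j + 1)) =
          lam (i + 1) (j + 1) := by
  have key : (∀ i ≤ M, ∀ j ≤ N, noiseField ω i j = lam i j) →
      ∀ i < M, ∀ j < N, (ω (i, j)).1 = d (i + 1) (j + 1) →
        noiseField ω (i + 1) (j + 1) =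
          (ω (i, j)).2 (lam i j, lam i (j + 1), lam (i + 1) j, d (i + 1) (j + 1)) := by
    intro h i hi j hj hd
    rw [noiseField, h i hi.le j hj.le, h i hi.le (j + 1) hj, h (i + 1) hi j hj.le, hd]
  have hbase : ∀ i, noiseField ω i 0 = lam i 0 := fun i =>
    Subtype.ext (funext fun c => c.elim0)
  constructor
  · intro h i hi j hj
    refine ⟨(h i hi j hj).1, ?_⟩
    rw [← (h i hi j hj).2]
    refine (key ?_ i hi j hj (h i hi j hj).1).symm
    rintro (_ | i) hi (_ | j) hj
    · exact hbase _
    · rw [h0, noiseField]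
    · exact hbase _
    · exact (h i hi j hj).2
  · intro h
    have hall : ∀ i ≤ M, ∀ j ≤ N, noiseField ω i j = lam i j := by
      intro i
      induction i with
      | zero =>
        intro _ j _
        rw [h0, noiseField]
      | succ i ih =>
        intro hi j
        induction j with
        | zero => exact fun _ => hbase _
        | succ j ihj =>
          intro hj
          rw [noiseField, ih (by omega) j (by omega), ih (by omega) (j + 1) hj, ihj (by omega),
            (h i hi j hj).1, (h i hi j hj).2]
    exact fun i hi j hj => ⟨(h i hi j hj).1, hall (i + 1) hi (j + 1) hj⟩

/-- The field exists: independent noise at the boxes generates it. -/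
theorem exists_isHLRSKField {t : ℝ} {a b : ℕ → ℝ} (hp : IsParam t a b) :
    ∃ (Ω : Type) (_ : MeasurableSpace Ω) (P : Measure Ω) (_ : IsProbabilityMeasure P)
      (r : ℕ → ℕ → Ω → ℕ) (L : (i j : ℕ) → Ω → Signature j), IsHLRSKField P t a b r L := by
  choose p hp1 hp2 using exists_noiseMeasure hp
  refine ⟨(v : ℕ × ℕ) → BoxNoise v.2, inferInstance, Measure.infinitePi p, inferInstance,
    fun i j ω => (ω (i - 1, j - 1)).1, fun i j ω => noiseField ω i j,
    ⟨fun i j => (measurable_pi_apply _).fst, measurable_noiseField, fun j ω => ?_, ?_⟩⟩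
  · rw [noiseField]
  intro M N d lam h0
  set D := Finset.range M ×ˢ Finset.range N with hD
  set σ : (v : ℕ × ℕ) → RSKInput v.2 := fun v => (lam v.1 v.2, lam v.1 (v.2 + 1),
    lam (v.1 + 1) v.2, d (v.1 + 1) (v.2 + 1)) with hσ
  set S : (v : ℕ × ℕ) → Set (BoxNoise v.2) := fun v =>
    {x | x.1 = d (v.1 + 1) (v.2 + 1) ∧ x.2 (σ v) = lam (v.1 + 1) (v.2 + 1)} with hS
  have hmS : ∀ v, MeasurableSet (S v) := fun v =>
    ((measurableSet_singleton (d (v.1 + 1) (v.2 + 1))).preimage measurable_fst).inter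
      ((measurableSet_singleton (lam (v.1 + 1) (v.2 + 1))).preimage
        ((measurable_pi_apply (σ v)).comp measurable_snd))
  have hev : {ω : (v : ℕ × ℕ) → BoxNoise v.2 | ∀ i < M, ∀ j < N,
      (ω (i + 1 - 1, j + 1 - 1)).1 = d (i + 1) (j + 1) ∧
        noiseField ω (i + 1) (j + 1) = lam (i + 1) (j + 1)} = Set.pi D S := by
    ext ω
    refine (noiseField_event M N d lam h0 ω).trans ?_
    simp only [hD, hS, hσ, Set.mem_pi, Finset.coe_product, Finset.coe_range, Set.mem_prod,
      Set.mem_Iio, Prod.forall]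
    exact ⟨fun h i j hij => h i hij.1 j hij.2, fun h i hi j hj => h i j ⟨hi, hj⟩⟩
  rw [hev, measureReal_def, Measure.infinitePi_pi _ fun v _ => hmS v, ENNReal.toReal_prod,
    ← Finset.prod_product']
  change ∏ v ∈ D, (p v).real (S v) = ∏ v ∈ D, fieldWt t a b d lam v
  -- a box whose inputs are Young diagrams contributes the same factor to both products
  have hlegit : ∀ i j, (∀ x y, x ≤ i → y ≤ j → (x, y) ≠ (i, j) → fieldWt t a b d lam (x, y) ≠ 0) →
      (p (i, j)).real (S (i, j)) = fieldWt t a b d lam (i, j) := by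
    intro i j hne
    set E := (Finset.range (i + 1) ×ˢ Finset.range (j + 1)).erase (i, j) with hE
    have hmem : ∀ x y, (x, y) ∈ E ↔ (x ≤ i ∧ y ≤ j) ∧ ¬ (x = i ∧ y = j) := by
      intro x y
      simp only [hE, Finset.mem_erase, Finset.mem_product, Finset.mem_range, ne_eq, Prod.mk.injEq]
      omega
    have hlow : IsLowerSet (E : Set (ℕ × ℕ)) := by
      rintro ⟨x, y⟩ ⟨x', y'⟩ ⟨h1, h2⟩ h
      rw [Finset.mem_coe, hmem] at h ⊢
      simp only at h1 h2
      omega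
    have hne' : ∀ v ∈ E, fieldWt t a b d lam v ≠ 0 := by
      rintro ⟨x, y⟩ h
      rw [hmem] at h
      exact hne x y h.1.1 h.1.2 (by simpa using h.2)
    obtain ⟨mu, hmu, -, h1⟩ := isGoodAt_of_prod_ne_zero h0 hlow hne' i (j + 1) fun i' j' hi hj =>
      (hmem _ _).2 (by omega)
    obtain ⟨nu, hnu, h2, -⟩ := isGoodAt_of_prod_ne_zero h0 hlow hne' (i + 1) j fun i' j' hi hj =>
      (hmem _ _).2 (by omega)
    obtain ⟨κ, hκ, hs⟩ := h1 j rfl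
    obtain ⟨κ', hκ', hs'⟩ := h2 i rfl
    obtain rfl := hκ.unique hκ'
    exact hp2 (i, j) (σ (i, j)) (lam (i + 1) (j + 1)) ⟨κ, mu, nu, hκ, hmu, hnu, hs, hs'⟩
  have hdown : ∀ i j x y, (i, j) ∈ D → x ≤ i → y ≤ j → (x, y) ∈ D := by
    intro i j x y h hx hy
    simp only [hD, Finset.mem_product, Finset.mem_range] at h ⊢
    omega
  by_cases hall : ∀ v ∈ D, fieldWt t a b d lam v ≠ 0
  · exact Finset.prod_congr rfl fun ⟨i, j⟩ hv =>
      hlegit i j fun x y hx hy _ => hall _ (hdown i j x y hv hx hy)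
  · have hzero : ∏ v ∈ D, fieldWt t a b d lam v = 0 := by
      push Not at hall
      obtain ⟨v, hv, h⟩ := hall
      exact Finset.prod_eq_zero hv h
    rw [hzero]
    by_contra hne
    replace hne := Finset.prod_ne_zero_iff.1 hne
    apply hall
    -- if the product on the left does not vanish, the weights of all boxes are shown to be nonzero
    -- in the order of the diagonals
    have hind : ∀ n i j, i + j = n → (i, j) ∈ D → fieldWt t a b d lam (i, j) ≠ 0 := by
      intro n
      induction n using Nat.strong_induction_on with
      | _ n ih =>
        intro i j hn hv
        rw [← hlegit i j fun x y hx hy hxy => ih (x + y) (by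
          simp only [ne_eq, Prod.mk.injEq] at hxy
          omega) x y rfl (hdown i j x y hv hx hy)]
        exact hne _ hv
    exact fun v hv => hind _ v.1 v.2 rfl hv

/-! ### The first column and the six vertex weights -/

/-- The output edges at a vertex, if the first column has input boxes `be` (horizontal), `al`
(vertical), and a box in the first output diagram iff `X`, are `eh` and `ev`. -/
def FlagMatch (be al : ℕ) (eh ev : Bool) (X : Prop) : Prop :=
  (ev = true ↔ X) ∧ (eh = true ↔ (X ∧ 1 + al = be) ∨ (¬ X ∧ al = be))

open Classical in
/-- Averaged over the input variable, the step in the first column is a vertex of the six vertex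
model. -/
theorem hasSum_firstColumn {t u : ℝ} (ht0 : 0 ≤ t) (ht1 : t < 1) (hu0 : 0 ≤ u) (hu1 : u < 1)
    {be al : ℕ} (hbe : be ≤ 1) (hal : al ≤ 1) (eh ev : Bool) :
    HasSum (fun δ => inputProb t u δ *
      ((if FlagMatch be al eh ev False then 1 else 0) * stepProb t 0 1 0 0 be al δ 0 +
        (if FlagMatch be al eh ev True then 1 else 0) * stepProb t 0 1 0 0 be al δ 1))
      (sixVertexWeight t u (decide (al = 0)) (decide (be = 1)) eh ev) := by
  set g : ℕ → ℝ := fun δ =>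
    (if FlagMatch be al eh ev False then 1 else 0) * stepProb t 0 1 0 0 be al δ 0 +
      (if FlagMatch be al eh ev True then 1 else 0) * stepProb t 0 1 0 0 be al δ 1 with hg
  -- the step depends on the input only through whether it is positive
  have hconst : ∀ δ, g (δ + 1) = g 1 := by
    intro δ
    simp only [hg]
    congr 2 <;>
    · interval_cases be <;> interval_cases al <;> simp [stepProb, CarryStep, colWt] <;> omega
  have h1 := ((hasSum_inputProb hu0 hu1 ht1).mul_right (g 1)).add
    (hasSum_ite_eq 0 (inputProb t u 0 * (g 0 - g 1)))
  have h2 : sixVertexWeight t u (decide (al = 0)) (decide (be = 1)) eh ev =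
      1 * g 1 + inputProb t u 0 * (g 0 - g 1) := by
    have h3 : 1 - t * u ≠ 0 := by nlinarith
    simp only [hg, inputProb]
    interval_cases be <;> interval_cases al <;> cases eh <;> cases ev <;>
      simp [stepProb, CarryStep, colWt, FlagMatch, sixVertexWeight] <;> field_simp <;> ring
  rw [h2]
  refine (congrArg (fun f => HasSum f _) (funext fun δ => ?_)).mpr h1
  change inputProb t u δ * g δ = _
  cases δ with
  | zero => simp; ring
  | succ δ => simp [hconst]

/-! ### The zeros of the field -/

namespace IsHLRSKField

variable {Ω : Type*} [MeasurableSpace Ω] {P : Measure Ω} [IsProbabilityMeasure P] {t : ℝ}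
  {a b : ℕ → ℝ} {r : ℕ → ℕ → Ω → ℕ} {L : (i j : ℕ) → Ω → Signature j}

/-- The edges which leave the vertex `(i + 1, j + 1)` are `eh` and `ev`. -/
def edgeEvent (L : (i j : ℕ) → Ω → Signature j) (i j : ℕ) (eh ev : Bool) : Set Ω :=
  {ω | decide (zeroCount L (i + 1) j ω ≠ zeroCount L (i + 1) (j + 1) ω) = eh ∧
    decide (zeroCount L i (j + 1) ω ≠ zeroCount L (i + 1) (j + 1) ω) = ev}

open Classical in
/-- The law of the edges at a vertex, given the three input diagrams. -/
theorem measureReal_inter_edgeEvent_of_represents (hF : IsHLRSKField P t a b r L)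
    (hp : IsParam t a b) (i j K : ℕ) {A : Set Ω} {lam mu nu : YoungDiagram}
    (hA : ∀ ω ω', (∀ x ≤ K, ∀ y ≤ K, ¬ (i < x ∧ j < y) → L x y ω = L x y ω') → ω ∈ A → ω' ∈ A)
    (hAl : ∀ ω ∈ A, Represents (L i j ω) lam) (hAm : ∀ ω ∈ A, Represents (L i (j + 1) ω) mu)
    (hAn : ∀ ω ∈ A, Represents (L (i + 1) j ω) nu) (hmu : IsHorizontalStrip mu lam)
    (hnu : IsHorizontalStrip nu lam) (eh ev : Bool) :
    P.real (A ∩ edgeEvent L i j eh ev) = P.real A *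
      sixVertexWeight t (a (i + 1) * b (j + 1)) (decide (skewInd mu lam 0 = 0))
        (decide (skewInd nu lam 0 = 1)) eh ev := by
  have hu0 := (mul_pos (hp.a_pos (i + 1) (by omega)) (hp.b_pos (j + 1) (by omega))).le
  have hu1 := hp.lt_one (i + 1) (j + 1) (by omega) (by omega)
  set f : Prop → ℝ := fun X =>
    if FlagMatch (skewInd nu lam 0) (skewInd mu lam 0) eh ev X then 1 else 0 with hf
  have h1 := ((hasSum_firstColumn hp.t_nonneg hp.t_lt hu0 hu1 (hnu.skewInd_le 0)
    (hmu.skewInd_le 0) eh ev).mul_left (P.real A))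
  refine (hasSum_measureReal_fiber P (fun y => hF.measurableSet_r (i + 1) (j + 1) y)
    (A ∩ edgeEvent L i j eh ev)).unique
    ((congrArg (fun f => HasSum f _) (funext fun δ => ?_)).mpr h1)
  have h2 := ((hasSum_diagramU_mul hp.t_nonneg hp.t_lt hmu hnu δ f).mul_left
    (P.real A * inputProb t (a (i + 1) * b (j + 1)) δ))
  rw [← mul_assoc]
  refine (hF.hasSum_represents hp (i + 1) (j + 1)
    (A ∩ edgeEvent L i j eh ev ∩ {ω | r (i + 1) (j + 1) ω = δ})).unique
    ((congrArg (fun f => HasSum f _) (funext fun rho => ?_)).mpr h2)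
  have hmar := hF.markov_input hp i j K hA hAl hAm hAn δ rho
  have hsub : A ∩ edgeEvent L i j eh ev ∩ {ω | r (i + 1) (j + 1) ω = δ} ∩
      {ω | Represents (L (i + 1) (j + 1) ω) rho} ⊆
      A ∩ {ω | r (i + 1) (j + 1) ω = δ} ∩ {ω | Represents (L (i + 1) (j + 1) ω) rho} :=
    fun ω h => ⟨⟨h.1.1.1, h.1.2⟩, h.2⟩
  by_cases hz : (if colCarry lam mu nu rho 0 = δ then diagramU t lam mu nu rho else 0) = 0
  · rw [hz, mul_zero, mul_zero]
    rw [hz, mul_zero, mul_zero] at hmar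
    exact measureReal_mono_null hsub hmar
  have R : IsColumnRun lam mu nu rho (colCarry lam mu nu rho) := by
    by_contra hc
    exact hz (by rw [diagramU_eq_zero hc, ite_self])
  -- all edges are functions of the first columns
  have hmatch : ∀ ω ∈ A, Represents (L (i + 1) (j + 1) ω) rho →
      (ω ∈ edgeEvent L i j eh ev ↔
        FlagMatch (skewInd nu lam 0) (skewInd mu lam 0) eh ev (skewInd rho mu 0 = 1)) := by
    intro ω hω hr
    have e1 := hmu.colLen_eq 0
    have e2 := hnu.colLen_eq 0
    have e3 := R.rho_strip.colLen_eq 0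
    have e4 := R.rho_strip'.colLen_eq 0
    have l1 := hmu.skewInd_le 0
    have l2 := hnu.skewInd_le 0
    have l3 := R.rho_strip.skewInd_le 0
    have l4 := R.rho_strip'.skewInd_le 0
    have b1 := (hAl ω hω).2
    have b2 := (hAm ω hω).2
    have b3 := (hAn ω hω).2
    have b4 := hr.2
    have z1 : zeroCount L (i + 1) j ω = j - nu.colLen 0 := (hAn ω hω).multAt_zero
    have z2 : zeroCount L (i + 1) (j + 1) ω = j + 1 - rho.colLen 0 := hr.multAt_zero
    have z3 : zeroCount L i (j + 1) ω = j + 1 - mu.colLen 0 := (hAm ω hω).multAt_zero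
    rw [edgeEvent]
    change (_ ∧ _) ↔ _
    rw [FlagMatch, z1, z2, z3, and_comm]
    apply and_congr
    · cases ev <;> simp only [decide_eq_true_eq, decide_eq_false_iff_not, Bool.false_eq_true,
        false_iff, true_iff] <;> omega
    · cases eh <;> simp only [decide_eq_true_eq, decide_eq_false_iff_not, Bool.false_eq_true,
        false_iff, true_iff] <;> omega
  by_cases hX : FlagMatch (skewInd nu lam 0) (skewInd mu lam 0) eh ev (skewInd rho mu 0 = 1)
  · rw [show f (skewInd rho mu 0 = 1) = 1 from if_pos hX, one_mul, mul_assoc, ← hmar]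
    congr 1
    exact hsub.antisymm fun ω h => ⟨⟨⟨h.1.1, (hmatch ω h.1.1 h.2).2 hX⟩, h.1.2⟩, h.2⟩
  · rw [show f (skewInd rho mu 0 = 1) = 0 from if_neg hX, zero_mul, mul_zero]
    convert measureReal_empty (μ := P) using 2
    rw [Set.eq_empty_iff_forall_notMem]
    exact fun ω h => hX ((hmatch ω h.1.1.1 h.2).1 h.1.1.2)

/-- The law of the edges at a vertex, given an event in their past on which the incoming edges are
known. -/
theorem measureReal_inter_edgeEvent (hF : IsHLRSKField P t a b r L) (hp : IsParam t a b)
    (i j K : ℕ) {A : Set Ω} {eh₀ ev₀ : Bool}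
    (hA : ∀ ω ω', (∀ x ≤ K, ∀ y ≤ K, ¬ (i < x ∧ j < y) → L x y ω = L x y ω') → ω ∈ A → ω' ∈ A)
    (hl : ∀ ω ∈ A, decide (zeroCount L i j ω ≠ zeroCount L i (j + 1) ω) = eh₀)
    (hb : ∀ ω ∈ A, decide (zeroCount L i j ω ≠ zeroCount L (i + 1) j ω) = ev₀) (eh ev : Bool) :
    P.real (A ∩ edgeEvent L i j eh ev) = P.real A *
      sixVertexWeight t (a (i + 1) * b (j + 1)) eh₀ ev₀ eh ev := by
  have hY : ∀ y : Signature j × Signature (j + 1) × Signature j,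
      MeasurableSet {ω | (L i j ω, L i (j + 1) ω, L (i + 1) j ω) = y} := fun y =>
    ((hF.measurable_L i j).prodMk ((hF.measurable_L i (j + 1)).prodMk
      (hF.measurable_L (i + 1) j))) (measurableSet_singleton y)
  apply measureReal_eq_mul_of_fiber P hY
  intro ω₀
  set A' := A ∩ {ω | (L i j ω, L i (j + 1) ω, L (i + 1) j ω) =
    (L i j ω₀, L i (j + 1) ω₀, L (i + 1) j ω₀)} with hA'
  have hmem : ∀ ω ∈ A', ω ∈ A ∧ L i j ω = L i j ω₀ ∧ L i (j + 1) ω = L i (j + 1) ω₀ ∧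
      L (i + 1) j ω = L (i + 1) j ω₀ := by
    rintro ω ⟨h1, h2⟩
    change (_, _, _) = (_, _, _) at h2
    simp only [Prod.mk.injEq] at h2
    exact ⟨h1, h2⟩
  rw [Set.inter_right_comm]
  by_cases hnull : P.real A' = 0
  · rw [hnull, zero_mul]
    exact measureReal_mono_null Set.inter_subset_left hnull
  -- an event of positive probability contains points where the inputs are Young diagrams
  obtain ⟨ω₁, h1, hg⟩ : ∃ ω ∈ A', ∀ i j, IsGoodAt (fun i j => L i j ω) i j := by
    by_contra hc
    push Not at hc
    apply hnull
    rw [measureReal_def, show P A' = 0 from ?_, ENNReal.toReal_zero]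
    refine measure_mono_null (fun ω hω => ?_) (ae_iff.1 (hF.ae_isGoodAt hp))
    obtain ⟨x, y, h⟩ := hc ω hω
    exact fun hall => h (hall x y)
  obtain ⟨mu, hmu, -, g1⟩ := hg i (j + 1)
  obtain ⟨nu, hnu, g2, -⟩ := hg (i + 1) j
  obtain ⟨lam, hlam, hs⟩ := g1 j rfl
  obtain ⟨lam', hlam', hs'⟩ := g2 i rfl
  obtain rfl := hlam.unique hlam'
  have h1' := hmem ω₁ h1
  have e1 := hs.colLen_eq 0
  have e2 := hs'.colLen_eq 0
  have l1 := hs.skewInd_le 0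
  have l2 := hs'.skewInd_le 0
  have b1 := hlam.2
  have b2 := hmu.2
  have b3 := hnu.2
  have z1 : zeroCount L i j ω₁ = j - lam.colLen 0 := hlam.multAt_zero
  have z2 : zeroCount L i (j + 1) ω₁ = j + 1 - mu.colLen 0 := hmu.multAt_zero
  have z3 : zeroCount L (i + 1) j ω₁ = j - nu.colLen 0 := hnu.multAt_zero
  have f1 : decide (skewInd mu lam 0 = 0) = eh₀ := by
    rw [← hl ω₁ h1'.1, decide_eq_decide, z1, z2]
    omega
  have f2 : decide (skewInd nu lam 0 = 1) = ev₀ := by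
    rw [← hb ω₁ h1'.1, decide_eq_decide, z1, z3]
    omega
  rw [← f1, ← f2]
  apply hF.measureReal_inter_edgeEvent_of_represents hp i j (K + i + j + 1) (A := A')
  · rintro ω ω' hag hω
    obtain ⟨k1, k2, k3, k4⟩ := hmem ω hω
    refine ⟨hA ω ω' (fun x hx y hy => hag x (by omega) y (by omega)) k1, ?_⟩
    change (_, _, _) = (_, _, _)
    rw [← k2, ← k3, ← k4, hag i (by omega) j (by omega) (by omega),
      hag i (by omega) (j + 1) (by omega) (by omega),
      hag (i + 1) (by omega) j (by omega) (by omega)]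
  · intro ω hω
    rw [(hmem ω hω).2.1, ← h1'.2.1]
    exact hlam
  · intro ω hω
    rw [(hmem ω hω).2.2.1, ← h1'.2.2.1]
    exact hmu
  · intro ω hω
    rw [(hmem ω hω).2.2.2, ← h1'.2.2.2]
    exact hnu
  · exact hs
  · exact hs'

omit [IsProbabilityMeasure P] in
theorem zeroCount_left (hF : IsHLRSKField P t a b r L) (j : ℕ) (ω : Ω) :
    zeroCount L 0 j ω = j := by
  rw [zeroCount, hF.left, multAt]
  simp [Signature.zero]

omit [MeasurableSpace Ω] in
theorem mem_edgeEvent_congr {L : (i j : ℕ) → Ω → Signature j} {i j : ℕ} {eh ev : Bool} {ω ω' : Ω}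
    (h1 : L (i + 1) j ω = L (i + 1) j ω') (h2 : L (i + 1) (j + 1) ω = L (i + 1) (j + 1) ω')
    (h3 : L i (j + 1) ω = L i (j + 1) ω') (h : ω ∈ edgeEvent L i j eh ev) :
    ω' ∈ edgeEvent L i j eh ev := by
  have z1 : zeroCount L (i + 1) j ω = zeroCount L (i + 1) j ω' := by rw [zeroCount, zeroCount, h1]
  have z2 : zeroCount L (i + 1) (j + 1) ω = zeroCount L (i + 1) (j + 1) ω' := by
    rw [zeroCount, zeroCount, h2]
  have z3 : zeroCount L i (j + 1) ω = zeroCount L i (j + 1) ω' := by rw [zeroCount, zeroCount, h3]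
  change _ ∧ _ at h
  change _ ∧ _
  rwa [← z1, ← z2, ← z3]

/-- The edges in the first `M` columns and at the first `n` vertices of the next column are as
given. -/
def edgesEvent (L : (i j : ℕ) → Ω → Signature j) (eH eV : ℕ → ℕ → Bool) (N M n : ℕ) : Set Ω :=
  {ω | (∀ i < M, ∀ j < N, ω ∈ edgeEvent L i j (eH (i + 1) (j + 1)) (eV (i + 1) (j + 1))) ∧
    ∀ j < n, ω ∈ edgeEvent L M j (eH (M + 1) (j + 1)) (eV (M + 1) (j + 1))}

/-- The vertices are added one by one, column by column. -/
theorem measureReal_edgesEvent_succ (hF : IsHLRSKField P t a b r L) (hp : IsParam t a b) {N : ℕ}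
    {eH eV : ℕ → ℕ → Bool} (hH : ∀ j, eH 0 (j + 1) = true) (hV : ∀ i, eV (i + 1) 0 = false)
    (M : ℕ) {n : ℕ} (hn : n < N) :
    P.real (edgesEvent L eH eV N M (n + 1)) = P.real (edgesEvent L eH eV N M n) *
      sixVertexWeight t (a (M + 1) * b (n + 1)) (eH M (n + 1)) (eV (M + 1) n)
          (eH (M + 1) (n + 1)) (eV (M + 1) (n + 1)) := by
  rw [show edgesEvent L eH eV N M (n + 1) = edgesEvent L eH eV N M n ∩
      edgeEvent L M n (eH (M + 1) (n + 1)) (eV (M + 1) (n + 1)) from Set.ext fun ω =>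
    ⟨fun h => ⟨⟨h.1, fun j hj => h.2 j (by omega)⟩, h.2 n (by omega)⟩, fun h =>
      ⟨h.1.1, fun j hj => by
      rcases Nat.lt_succ_iff_lt_or_eq.1 hj with hj | rfl
      · exact h.1.2 j hj
      · exact h.2⟩⟩]
  apply hF.measureReal_inter_edgeEvent hp M n (M + N + 1)
  · rintro ω ω' hag ⟨h1, h2⟩
    refine ⟨fun i hi j hj => mem_edgeEvent_congr ?_ ?_ ?_ (h1 i hi j hj),
      fun j hj => mem_edgeEvent_congr ?_ ?_ ?_ (h2 j hj)⟩
    all_goals exact hag _ (by omega) _ (by omega) (by omega)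
  · rintro ω ⟨h1, h2⟩
    cases M with
    | zero =>
      rw [hF.zeroCount_left, hF.zeroCount_left, hH]
      simp
    | succ M => exact (h1 M (by omega) n hn).1
  · rintro ω ⟨h1, h2⟩
    cases n with
    | zero =>
      rw [hV]
      simp [zeroCount, multAt]
    | succ n => exact (h2 n (by omega)).2

theorem measureReal_edgesEvent (hF : IsHLRSKField P t a b r L) (hp : IsParam t a b) {N : ℕ}
    {eH eV : ℕ → ℕ → Bool} (hH : ∀ j, eH 0 (j + 1) = true) (hV : ∀ i, eV (i + 1) 0 = false)
    (M : ℕ) : P.real (edgesEvent L eH eV N M 0) =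
      ∏ i ∈ Finset.range M, ∏ j ∈ Finset.range N,
        sixVertexWeight t (a (i + 1) * b (j + 1)) (eH i (j + 1)) (eV (i + 1) j)
          (eH (i + 1) (j + 1)) (eV (i + 1) (j + 1)) := by
  induction M with
  | zero =>
    rw [show edgesEvent L eH eV N 0 0 = Set.univ from Set.eq_univ_of_forall fun ω =>
      ⟨fun i hi => by omega, fun j hj => by omega⟩]
    simp
  | succ M ih =>
    have hcol : ∀ n ≤ N, P.real (edgesEvent L eH eV N M n) =
        P.real (edgesEvent L eH eV N M 0) * ∏ j ∈ Finset.range n,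
          sixVertexWeight t (a (M + 1) * b (j + 1)) (eH M (j + 1)) (eV (M + 1) j)
            (eH (M + 1) (j + 1)) (eV (M + 1) (j + 1)) := by
      intro n
      induction n with
      | zero => simp
      | succ n ihn =>
        intro hn
        rw [hF.measureReal_edgesEvent_succ hp hH hV M hn, ihn (by omega), Finset.prod_range_succ,
          mul_assoc]
    rw [Finset.prod_range_succ, ← ih, ← hcol N le_rfl]
    congr 1
    refine Set.ext fun ω => ⟨fun h => ⟨fun i hi => h.1 i (by omega), h.1 M (by omega)⟩,
      fun h => ⟨fun i hi => ?_, fun j hj => by omega⟩⟩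
    rcases Nat.lt_succ_iff_lt_or_eq.1 hi with hi | rfl
    · exact h.1 i hi
    · exact h.2

omit [IsProbabilityMeasure P] in
theorem measurable_zeroCount (hF : IsHLRSKField P t a b r L) (i j : ℕ) :
    Measurable (zeroCount L i j) :=
  (measurable_of_countable fun s : Signature j => multAt s.1 0).comp (hF.measurable_L i j)

/-- The edges at which the number of zeros changes form a stochastic six vertex model. -/
theorem isSixVertex (hF : IsHLRSKField P t a b r L) (hp : IsParam t a b) :
    IsSixVertex P t a b
      (fun i j ω => decide (zeroCount L i (j - 1) ω ≠ zeroCount L i j ω))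
      (fun i j ω => decide (zeroCount L (i - 1) j ω ≠ zeroCount L i j ω)) where
  measurable_H i j := (measurable_of_countable fun x : ℕ × ℕ => decide (x.1 ≠ x.2)).comp
    ((hF.measurable_zeroCount i (j - 1)).prodMk (hF.measurable_zeroCount i j))
  measurable_V i j := (measurable_of_countable fun x : ℕ × ℕ => decide (x.1 ≠ x.2)).comp
    ((hF.measurable_zeroCount (i - 1) j).prodMk (hF.measurable_zeroCount i j))
  left j ω := by
    rw [hF.zeroCount_left, hF.zeroCount_left]
    simp
  below i ω := by simp [zeroCount, multAt]
  law M N eH eV hH hV := by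
    rw [← hF.measureReal_edgesEvent hp hH hV M]
    congr 1
    exact Set.ext fun ω => ⟨fun h => ⟨h, fun j hj => by omega⟩, fun h => h.1⟩

/-- The number of zeros in a state is almost surely the height function: along a vertical line it
increases by at most one, as neighbouring states differ by a horizontal strip. -/
theorem ae_sixVertexHeight (hF : IsHLRSKField P t a b r L) (hp : IsParam t a b) :
    ∀ᵐ ω ∂P, ∀ i j, sixVertexHeight
      (fun i j ω => decide (zeroCount L i (j - 1) ω ≠ zeroCount L i j ω)) i j ω =
        zeroCount L i j ω := by
  filter_upwards [hF.ae_isGoodAt hp] with ω hω i j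
  induction j with
  | zero => simp [sixVertexHeight, zeroCount, multAt]
  | succ j ih =>
    obtain ⟨κ, hκ, -, h⟩ := hω i (j + 1)
    obtain ⟨κ', hκ', hs⟩ := h j rfl
    have z1 : zeroCount L i j ω = j - κ'.colLen 0 := hκ'.multAt_zero
    have z2 : zeroCount L i (j + 1) ω = j + 1 - κ.colLen 0 := hκ.multAt_zero
    have e1 := hs.colLen_eq 0
    have e2 := hs.skewInd_le 0
    have b1 := hκ.2
    have b2 := hκ'.2
    rw [sixVertexHeight] at ih ⊢
    rw [← Finset.insert_Icc_right_eq_Icc_add_one (by omega : 1 ≤ j + 1), Finset.filter_insert]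
    rw [Nat.add_sub_cancel]
    split_ifs with h
    · rw [Finset.card_insert_of_notMem (by simp), ih]
      rw [decide_eq_true_eq] at h
      omega
    · rw [ih]
      rw [decide_eq_true_eq] at h
      omega

end IsHLRSKField

/-! ### Uniqueness in law of the six vertex model -/

theorem preimage_inter_fiber {α β : Type*} {f : α → β} {S : Set β} {e : β} (he : e ∈ S) :
    {x | f x ∈ S} ∩ {x | f x = e} = {x | f x = e} :=
  Set.ext fun x => ⟨fun h => h.2, fun h => ⟨show f x ∈ S from (show f x = e from h) ▸ he, h⟩⟩

theorem preimage_inter_fiber_eq_empty {α β : Type*} {f : α → β} {S : Set β} {e : β} (he : e ∉ S) :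
    {x | f x ∈ S} ∩ {x | f x = e} = ∅ :=
  Set.eq_empty_of_forall_notMem fun x h => he ((show f x = e from h.2) ▸ show f x ∈ S from h.1)

/-- The edges leaving the vertices `(i, j)`, `1 ≤ i ≤ M`, `1 ≤ j ≤ N`. -/
def edgeConfig {Ω : Type*} (H V : ℕ → ℕ → Ω → Bool) (M N : ℕ) (ω : Ω) :
    Fin M → Fin N → Bool × Bool :=
  fun i j => (H (i + 1) (j + 1) ω, V (i + 1) (j + 1) ω)

/-- The horizontal edges of a configuration, with those entering the quadrant. -/
def configH {M N : ℕ} (e : Fin M → Fin N → Bool × Bool) (i j : ℕ) : Bool :=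
  if h : 0 < i ∧ i ≤ M ∧ 0 < j ∧ j ≤ N then (e ⟨i - 1, by omega⟩ ⟨j - 1, by omega⟩).1 else true

/-- The vertical edges of a configuration, with those entering the quadrant. -/
def configV {M N : ℕ} (e : Fin M → Fin N → Bool × Bool) (i j : ℕ) : Bool :=
  if h : 0 < i ∧ i ≤ M ∧ 0 < j ∧ j ≤ N then (e ⟨i - 1, by omega⟩ ⟨j - 1, by omega⟩).2 else false

namespace IsSixVertex

variable {Ω Ω' : Type*} [MeasurableSpace Ω] [MeasurableSpace Ω'] {P : Measure Ω} {P' : Measure Ω'}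
  [IsProbabilityMeasure P] [IsProbabilityMeasure P'] {t : ℝ} {a b : ℕ → ℝ}
  {H V : ℕ → ℕ → Ω → Bool} {H' V' : ℕ → ℕ → Ω' → Bool}

omit [IsProbabilityMeasure P] in
theorem measurable_edgeConfig (h : IsSixVertex P t a b H V) (M N : ℕ) :
    Measurable (edgeConfig H V M N) :=
  measurable_pi_lambda _ fun i => measurable_pi_lambda _ fun j =>
    (h.measurable_H (i + 1) (j + 1)).prodMk (h.measurable_V (i + 1) (j + 1))

omit [IsProbabilityMeasure P] in
theorem measureReal_edgeConfig (h : IsSixVertex P t a b H V) {M N : ℕ}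
    (e : Fin M → Fin N → Bool × Bool) : P.real {ω | edgeConfig H V M N ω = e} =
      ∏ i ∈ Finset.range M, ∏ j ∈ Finset.range N,
        sixVertexWeight t (a (i + 1) * b (j + 1)) (configH e i (j + 1)) (configV e (i + 1) j)
          (configH e (i + 1) (j + 1)) (configV e (i + 1) (j + 1)) := by
  rw [← h.law M N (configH e) (configV e) (fun j => by simp [configH])
    (fun i => by simp [configV])]
  congr 1
  ext ω
  change edgeConfig H V M N ω = e ↔ _
  have hin : ∀ i j (hi : i < M) (hj : j < N), configH e (i + 1) (j + 1) = (e ⟨i, hi⟩ ⟨j, hj⟩).1 ∧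
      configV e (i + 1) (j + 1) = (e ⟨i, hi⟩ ⟨j, hj⟩).2 := by
    intro i j hi hj
    rw [configH, configV, dif_pos (by omega), dif_pos (by omega)]
    exact ⟨rfl, rfl⟩
  constructor
  · rintro rfl i hi j hj
    rw [(hin i j hi hj).1, (hin i j hi hj).2]
    exact ⟨rfl, rfl⟩
  · intro hω
    funext i j
    have h1 := hω i i.2 j j.2
    rw [(hin i j i.2 j.2).1, (hin i j i.2 j.2).2] at h1
    exact Prod.ext h1.1 h1.2

/-- Events that depend on finitely many edges have the same probability in all six vertex models. -/
theorem measureReal_eq (h : IsSixVertex P t a b H V) (h' : IsSixVertex P' t a b H' V') (M N : ℕ)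
    (S : Set (Fin M → Fin N → Bool × Bool)) :
    P.real {ω | edgeConfig H V M N ω ∈ S} = P'.real {ω | edgeConfig H' V' M N ω ∈ S} := by
  refine (hasSum_measureReal_fiber P (fun e => h.measurable_edgeConfig M N
    (measurableSet_singleton e)) _).unique ((congrArg (fun f => HasSum f _)
      (funext fun e => ?_)).mpr (hasSum_measureReal_fiber P' (fun e => h'.measurable_edgeConfig M N
        (measurableSet_singleton e)) {ω | edgeConfig H' V' M N ω ∈ S}))
  by_cases he : e ∈ S
  · rw [preimage_inter_fiber he, preimage_inter_fiber he, h.measureReal_edgeConfig,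
      h'.measureReal_edgeConfig]
  · rw [preimage_inter_fiber_eq_empty he, preimage_inter_fiber_eq_empty he, measureReal_empty,
      measureReal_empty]

/-- The height function in a rectangle is a function of the edges in this rectangle. -/
theorem sixVertexHeight_eq {Ω : Type*} (H V : ℕ → ℕ → Ω → Bool) {M N i j : ℕ} (hi : 0 < i)
    (hiM : i ≤ M) (hj : j ≤ N) (ω : Ω) : sixVertexHeight H i j ω =
      ((Finset.Icc 1 j).filter fun y => configH (edgeConfig H V M N ω) i y = true).card := by
  rw [sixVertexHeight]
  congr 1
  refine Finset.filter_congr fun y hy => ?_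
  rw [Finset.mem_Icc] at hy
  obtain ⟨y, rfl⟩ : ∃ z, y = z + 1 := ⟨y - 1, by omega⟩
  obtain ⟨i, rfl⟩ : ∃ z, i = z + 1 := ⟨i - 1, by omega⟩
  rw [configH, dif_pos (by omega)]
  rfl

end IsSixVertex

namespace IsHLRSKField

variable {Ω : Type*} [MeasurableSpace Ω] {P : Measure Ω} [IsProbabilityMeasure P] {t : ℝ}
  {a b : ℕ → ℝ} {r : ℕ → ℕ → Ω → ℕ} {L : (i j : ℕ) → Ω → Signature j}
  {k : ℕ} {m n : Fin (k + 1) → ℕ}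

open Classical in
/-- The law of the numbers of zeros along a path, in terms of the Hall-Littlewood process. -/
theorem hasSum_zeroCount (hF : IsHLRSKField P t a b r L) (hp : IsParam t a b)
    (hm : Antitone m) (hn : Monotone n) (c : Fin (k + 1) → ℤ) :
    HasSum (Set.indicator {lam : Fin (k + 1) → YoungDiagram |
        ∀ i, (n i : ℤ) - (lam i).colLen 0 = c i}
      (hlProcess t (plusBlock b n) (minusBlock a m)))
      (P.real {ω | ∀ i, (zeroCount L (m i) (n i) ω : ℤ) = c i}) := by
  -- the diagrams along the path, with an arbitrary value on a null set
  set Y : Ω → Fin (k + 1) → YoungDiagram := fun ω i =>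
    if h : ∃ κ, Represents (L (m i) (n i) ω) κ then h.choose else ⊥ with hY
  have hmeas : ∀ lam, MeasurableSet {ω | Y ω = lam} := by
    intro lam
    rw [show {ω | Y ω = lam} = ⋂ i, {ω | L (m i) (n i) ω ∈
        {s | (if h : ∃ κ, Represents s κ then h.choose else ⊥) = lam i}} by
      ext ω
      rw [Set.mem_iInter]
      exact funext_iff]
    exact MeasurableSet.iInter fun i => hF.measurableSet_L _ _ _
  refine (congrArg (fun f => HasSum f _) (funext fun lam => ?_)).mpr
    (hasSum_measureReal_fiber P hmeas {ω | ∀ i, (zeroCount L (m i) (n i) ω : ℤ) = c i})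
  have hrep : ∀ᵐ ω ∂P, (Y ω = lam ↔ ∀ i, Represents (L (m i) (n i) ω) (lam i)) := by
    filter_upwards [hF.ae_isGoodAt hp] with ω hω
    have hex : ∀ i, ∃ κ, Represents (L (m i) (n i) ω) κ := fun i => by
      obtain ⟨κ, hκ, -⟩ := hω (m i) (n i)
      exact ⟨κ, hκ⟩
    have hspec : ∀ i, Represents (L (m i) (n i) ω) (Y ω i) := fun i => by
      simp only [hY]
      rw [dif_pos (hex i)]
      exact (hex i).choose_spec
    exact ⟨fun h i => h ▸ hspec i, fun h => funext fun i => (hspec i).unique (h i)⟩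
  have hz : ∀ ω, (∀ i, Represents (L (m i) (n i) ω) (lam i)) →
      ((∀ i, (zeroCount L (m i) (n i) ω : ℤ) = c i) ↔
        ∀ i, (n i : ℤ) - (lam i).colLen 0 = c i) := by
    intro ω hω
    refine forall_congr' fun i => ?_
    have z : zeroCount L (m i) (n i) ω = n i - (lam i).colLen 0 := (hω i).multAt_zero
    have := (hω i).2
    rw [z, Nat.cast_sub this]
  by_cases hc : ∀ i, (n i : ℤ) - (lam i).colLen 0 = c i
  · rw [Set.indicator_of_mem (show lam ∈ {lam : Fin (k + 1) → YoungDiagram |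
        ∀ i, (n i : ℤ) - (lam i).colLen 0 = c i} from hc), ← hF.measureReal_eq_hlProcess hp hm hn]
    apply measureReal_congr
    filter_upwards [hrep] with ω hω
    exact propext ⟨fun h => ⟨(hz ω h).2 hc, hω.2 h⟩, fun h => hω.1 h.2⟩
  · rw [Set.indicator_of_notMem (show lam ∉ {lam : Fin (k + 1) → YoungDiagram |
        ∀ i, (n i : ℤ) - (lam i).colLen 0 = c i} from hc), ← measureReal_empty (μ := P)]
    apply measureReal_congr
    filter_upwards [hrep] with ω hω
    exact propext ⟨fun h => h.elim, fun h => hc ((hz ω (hω.1 h.2)).1 h.1)⟩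

end IsHLRSKField

/-- The law of the height function of the six vertex model along a path, in terms of the
Hall-Littlewood process. -/
theorem IsSixVertex.hasSum_height {Ω : Type*} [MeasurableSpace Ω] {P : Measure Ω}
    [IsProbabilityMeasure P] {t : ℝ} {a b : ℕ → ℝ} {H V : ℕ → ℕ → Ω → Bool}
    (h : IsSixVertex P t a b H V) (hp : IsParam t a b) {k : ℕ} {m n : Fin (k + 1) → ℕ}
    (hm : Antitone m) (hn : Monotone n) (hm0 : ∀ i, 0 < m i) (c : Fin (k + 1) → ℤ) :
    HasSum (Set.indicator {lam : Fin (k + 1) → YoungDiagram |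
        ∀ i, (n i : ℤ) - (lam i).colLen 0 = c i}
      (hlProcess t (plusBlock b n) (minusBlock a m)))
      (P.real {ω | ∀ i, (sixVertexHeight H (m i) (n i) ω : ℤ) = c i}) := by
  -- compare with the six vertex model of a Hall-Littlewood RSK field
  obtain ⟨Ω', _, P', _, r, L, hF⟩ := exists_isHLRSKField hp
  have hS := hF.isSixVertex hp
  set H' : ℕ → ℕ → Ω' → Bool :=
    fun i j ω => decide (zeroCount L i (j - 1) ω ≠ zeroCount L i j ω)
  set V' : ℕ → ℕ → Ω' → Bool :=
    fun i j ω => decide (zeroCount L (i - 1) j ω ≠ zeroCount L i j ω)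
  have h1 := h.measureReal_eq hS (m 0) (n (Fin.last k)) {e | ∀ i, ((((Finset.Icc 1 (n i)).filter
    fun y => configH e (m i) y = true).card : ℕ) : ℤ) = c i}
  have h2 : P.real {ω | ∀ i, (sixVertexHeight H (m i) (n i) ω : ℤ) = c i} =
      P'.real {ω | ∀ i, (sixVertexHeight H' (m i) (n i) ω : ℤ) = c i} := by
    simp_rw [fun i => sixVertexHeight_eq H V (hm0 i) (hm (Fin.zero_le i)) (hn (Fin.le_last i)),
      fun i => sixVertexHeight_eq H' V' (hm0 i) (hm (Fin.zero_le i)) (hn (Fin.le_last i))]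
    exact h1
  have h3 : P'.real {ω | ∀ i, (sixVertexHeight H' (m i) (n i) ω : ℤ) = c i} =
      P'.real {ω | ∀ i, (zeroCount L (m i) (n i) ω : ℤ) = c i} := by
    apply measureReal_congr
    filter_upwards [hF.ae_sixVertexHeight hp] with ω hω
    exact propext (forall_congr' fun i => by rw [hω])
  rw [h2, h3]
  exact hF.hasSum_zeroCount hp hm hn c

end

theorem mainTheorem3 (t : ℝ) (ht0 : 0 ≤ t) (ht1 : t < 1) (a b : ℕ → ℝ)
    (ha : ∀ i, 1 ≤ i → 0 < a i) (hb : ∀ j, 1 ≤ j → 0 < b j)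
    (hab : ∀ i j, 1 ≤ i → 1 ≤ j → a i * b j < 1) :
    -- the Hall-Littlewood RSK field exists
    (∃ (Ω : Type) (_ : MeasurableSpace Ω) (P : Measure Ω) (_ : IsProbabilityMeasure P)
      (r : ℕ → ℕ → Ω → ℕ) (L : (i j : ℕ) → Ω → Signature j), IsHLRSKField P t a b r L) ∧
    -- along a down-right path it is distributed as a Hall-Littlewood process
    (∀ {Ω : Type*} [MeasurableSpace Ω] (P : Measure Ω) [IsProbabilityMeasure P]
      (r : ℕ → ℕ → Ω → ℕ) (L : (i j : ℕ) → Ω → Signature j), IsHLRSKField P t a b r L →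
      ∀ (k : ℕ) (m n : Fin (k + 1) → ℕ), Antitone m → Monotone n →
        (∀ i, 0 < m i) → (∀ i, 0 < n i) →
        (∀ (lam : Fin (k + 1) → YoungDiagram) (mu : Fin k → YoungDiagram),
          P.real {ω | (∀ i, Represents (L (m i) (n i) ω) (lam i)) ∧
              ∀ i : Fin k, Represents (L (m i.succ) (n i.castSucc) ω) (mu i)} =
            hlProcessFull t (plusBlock b n) (minusBlock a m) lam mu) ∧
        (∀ lam : Fin (k + 1) → YoungDiagram,
          P.real {ω | ∀ i, Represents (L (m i) (n i) ω) (lam i)} =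
            hlProcess t (plusBlock b n) (minusBlock a m) lam)) ∧
    -- the zeros of the field form a stochastic six vertex model with its height function
    (∀ {Ω : Type*} [MeasurableSpace Ω] (P : Measure Ω) [IsProbabilityMeasure P]
      (r : ℕ → ℕ → Ω → ℕ) (L : (i j : ℕ) → Ω → Signature j), IsHLRSKField P t a b r L →
      IsSixVertex P t a b
        (fun i j ω => decide (zeroCount L i (j - 1) ω ≠ zeroCount L i j ω))
        (fun i j ω => decide (zeroCount L (i - 1) j ω ≠ zeroCount L i j ω)) ∧
      ∀ᵐ ω ∂P, ∀ i j, sixVertexHeight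
        (fun i j ω => decide (zeroCount L i (j - 1) ω ≠ zeroCount L i j ω)) i j ω =
          zeroCount L i j ω) ∧
    -- the six vertex height function along a down-right path is distributed as `n i` minus the
    -- length of the first column in a Hall-Littlewood process
    (∀ {Ω : Type*} [MeasurableSpace Ω] (P : Measure Ω) [IsProbabilityMeasure P]
      (H V : ℕ → ℕ → Ω → Bool), IsSixVertex P t a b H V →
      ∀ (k : ℕ) (m n : Fin (k + 1) → ℕ), Antitone m → Monotone n →
        (∀ i, 0 < m i) → (∀ i, 0 < n i) → ∀ c : Fin (k + 1) → ℤ,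
        HasSum
          (Set.indicator {lam : Fin (k + 1) → YoungDiagram |
              ∀ i, (n i : ℤ) - (lam i).colLen 0 = c i}
            (hlProcess t (plusBlock b n) (minusBlock a m)))
          (P.real {ω | ∀ i, (sixVertexHeight H (m i) (n i) ω : ℤ) = c i})) := by
  have hp : IsParam t a b := ⟨ht0, ht1, ha, hb, hab⟩
  refine ⟨exists_isHLRSKField hp, ?_, ?_, ?_⟩
  · intro Ω _ P _ r L hF k m n hm hn _ _
    exact ⟨hF.measureReal_eq_hlProcessFull hp hm hn, hF.measureReal_eq_hlProcess hp hm hn⟩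
  · intro Ω _ P _ r L hF
    exact ⟨hF.isSixVertex hp, hF.ae_sixVertexHeight hp⟩
  · intro Ω _ P _ H V h k m n hm hn hm0 _ c
    exact h.hasSum_height hp hm hn hm0 c
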